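/- **Parameters.** Let $q\in\mathbb C^*$ be not a root of unity, $2s\in\mathbb Z_{\ge0}$, and let $r_0,\zeta,\mathrm b^a,\mathrm c^a\in\mathbb C^*$ ($a\in\{\cdot,*,\diamond\}$; the label $\cdot$ is usually omitted) satisfy $r_0^{-2}=\mathrm b^a\mathrm c^a$ for every $a$, $\zeta^{-2}=\mathrm b^\diamond r_0q^{2s}$, $\zeta^2=\mathrm c^\diamond r_0q^{-2s}$. Assume the Leonard triple conditions: $\mathrm b^a/\mathrm c^a\ne q^{-2k}$ for $1\le k\le 4s-1$ and each $a$; and for $1\le k\le 2s$: $\mathrm c^*\neq -r_0q^{1-2k}\mathrm c\,\mathrm c^\diamond$, $\mathrm b\ne -r_0q^{1-2k+4s}\mathrm b^*\mathrm b^\diamond$, $\mathrm c\neq -r_0q^{2k+4s-1}\mathrm b^*\mathrm b^\diamond$, $\mathrm c^*\ne -r_0q^{2k-1}\mathrm b\,\mathrm c^\diamond$. Assume also $\mathrm b^\diamond\ne\mathrm c^\diamond$ and $\mathrm c^\diamond\neq q^{8s}\mathrm b^\diamond$ (nonvanishing denominators below). Put $b(x)=x-x^{-1}$, $[X,Y]_q=qXY-q^{-1}YX$,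 $(a;t)_N=\prod_{k<N}(1-at^k)$, $(a_1,\dots,a_j;t)_N=\prod_i(a_i;t)_N$, $\theta^a_M=\mathrm b^aq^{2M}+\mathrm c^aq^{-2M}$, $U(u)=\frac{qu^2+q^{-1}u^{-2}}{q+q^{-1}}$. With $$\omega^{\{a,b,c\}}=-(q-q^{-1})^2\Big(\theta^a_s\theta^b_s-\tfrac1{r_0}(q^{2s+1}+q^{-2s-1})\theta^c_s\Big)$$ let $\rho=-\frac{(q^2-q^{-2})^2}{r_0^2}$, $\omega=\omega^{\{\cdot,*,\diamond\}}$, $\eta=\frac{q+q^{-1}}{r_0}\omega^{\{\cdot,\diamond,*\}}$, $\eta^*=\frac{q+q^{-1}}{r_0}\omega^{\{*,\diamond,\cdot\}}$. **Transition coefficients.** For $\{a,b,c\}=\{\cdot,*,\diamond\}$ let $R^{\{a,c\}}_M(\theta^b_N)$ be the (terminating) series ${}_4\phi_3$ with base and argument $q^2$, upper parameters $q^{-2M},\frac{\mathrm b^a}{\mathrm c^a}q^{2M},q^{-2N},\frac{\mathrm b^b}{\mathrm c^b}q^{2N}$ and lower parameters $-\frac{\mathrm b^a\mathrm c^c}{\mathrm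 c^b}r_0q,\ -\frac{\mathrm b^b\mathrm b^c}{\mathrm c^a}r_0q^{4s+1},\ q^{-4s}$, and put $$k^{\{a,b,c\}}_N=\frac{(-\frac{\mathrm b^b\mathrm b^c}{\mathrm c^a}r_0q^{4s+1},-\frac{\mathrm b^a\mathrm c^c}{\mathrm c^b}r_0q,\frac{\mathrm b^b}{\mathrm c^b},q^{-4s};q^2)_N}{(q^2,-\frac{\mathrm b^b\mathrm b^c}{\mathrm b^a}r_0q,-\frac{\mathrm c^a\mathrm c^c}{\mathrm c^b}r_0q^{1-4s},\frac{\mathrm b^b}{\mathrm c^b}q^{4s+2};q^2)_N}\,\frac{1-\frac{\mathrm b^b}{\mathrm c^b}q^{4N}}{(\frac{\mathrm b^a}{\mathrm c^a})^N(1-\frac{\mathrm b^b}{\mathrm c^b})},$$ $$\nu_0^{\{a,b,c\}}=\frac{(\frac{\mathrm b^a}{\mathrm c^a}q^2,\frac{\mathrm b^b}{\mathrm c^b}q^2;q^2)_{2s}}{(-\frac{\mathrm b^b\mathrm b^c}{\mathrm c^a}r_0q^{4s+1})^{2s}(-\frac{\mathrm b^a\mathrm c^c}{\mathrm b^b}r_0q^{1-4s},-\frac{\mathrm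 c^a\mathrm c^c}{\mathrm c^b}r_0q^{1-4s};q^2)_{2s}},\qquad \Pi_{MM'}=\frac{k^{\{\cdot,\diamond,*\}}_{M'}\,R^{\{\diamond,*\}}_{M'}(\theta_M)}{\nu_0^{\{\diamond,\cdot,*\}}},$$ $$F_M=\prod_{k=0}^{M-1}\frac{\mathrm cq^{-2k-2}+r_0q^{-1}\mathrm c^*\mathrm b^\diamond}{\mathrm bq^{2k}+r_0q^{-1}\mathrm c^*\mathrm b^\diamond},\qquad H_M=\prod_{k=0}^{M-1}q^{4k}\frac{\mathrm b^\diamond}{\mathrm c^\diamond}\,\frac{\mathrm c^\diamond q^{-2k}+r_0q\,\mathrm c^*\mathrm b}{\mathrm b^\diamond q^{2k}+r_0q^{-1}\mathrm c^*\mathrm b},$$ $$\kappa=(-1)^{2s}q^{2s(2s-1)}\frac{(q^2r_0^2\mathrm b^2,\,q^2r_0^2(\mathrm b^\diamond)^2,\,q^2r_0^2(\mathrm b^*)^2;q^2)_{2s}}{(-\frac{qr_0\mathrm b\mathrm b^\diamond}{\mathrm b^*},-\frac{qr_0\mathrm b\mathrm b^*}{\mathrm b^\diamond},-\frac{qr_0\mathrm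 b^\diamond\mathrm b^*}{\mathrm b};q^2)_{2s}}.$$ **Explicit scalar products at $M''=2s$.** For $\bar u=(u_1,\dots,u_{2s})$ and $\epsilon=\pm1$ let $\mathcal G^\epsilon(\bar u)=\big(\epsilon(q+q^{-1})q^{-\epsilon(2s+1)}\mathrm b^{\frac{1-\epsilon}2}(\mathrm c^*)^{\frac{1+\epsilon}2}\big)^{2s}\prod_{i=1}^{2s}b(u_i^2)u_i^{-\epsilon}$, and for $0\le M\le 2s$ $$X^-_M(\bar u)=\mathcal G^-(\bar u)F_M\sum_{M'=0}^{2s}\Pi_{MM'}\prod_{i=1}^{2s}\Big(U(u_i)-\tfrac{r_0}{q+q^{-1}}\theta^\diamond_{M'}\Big),$$ $$X^+_M(\bar u)=\mathcal G^+(\bar u)\frac{\kappa F_M}{\nu_0^{\{*,\diamond,\cdot\}}}\sum_{M'=0}^{2s}\frac{\Pi_{MM'}}{H_{M'}}\prod_{i=1}^{2s}\Big(U(u_i)-\tfrac{r_0}{q+q^{-1}}\theta^\diamond_{M'}\Big).$$ **Linear system.** Let $$\Lambda^\epsilon_1(u)=\tfrac{q^{-2s-1}}{u^\epsilon}(q^{2s+1}u\zeta^{-1}-u^{-1}\zeta)(q^{2s+1}u\zeta-u^{-1}\zeta^{-1})(u\mathrm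 c^*q^{-2s}+u^{-1}\mathrm bq^{2s})\Big(u(\tfrac{\mathrm c}{\mathrm c^*})^{\frac{1-\epsilon}2}+u^{-1}(\tfrac{\mathrm b^*}{\mathrm b})^{\frac{1+\epsilon}2}\Big),$$ $$\Lambda^\epsilon_2(u)=\tfrac{(u^2-u^{-2})q^{-2s-1}}{u^\epsilon(qu^2-q^{-1}u^{-2})}(q^{2s-1}u^{-1}\zeta-u\zeta^{-1})(q^{2s-1}u^{-1}\zeta^{-1}-u\zeta)(q^2u\mathrm bq^{2s}+u^{-1}\mathrm c^*q^{-2s})\Big(q^2u(\tfrac{\mathrm b^*}{\mathrm b})^{\frac{1+\epsilon}2}+u^{-1}(\tfrac{\mathrm c}{\mathrm c^*})^{\frac{1-\epsilon}2}\Big),$$ $$Y_\epsilon(u|\bar u)=\tfrac{u^{2\epsilon+1}\Lambda_1^\epsilon(u)}{b(u^2)b(qu^2)}\prod_ib(\tfrac u{qu_i})b(uu_i)+\tfrac{q^{-\epsilon-1}u^{-1}\Lambda^\epsilon_2(u)}{b(u^2)b(q^2u^2)}\prod_ib(\tfrac{qu}{u_i})b(q^2uu_i)-\delta_{\epsilon,+}q^{-1-4s}\mathrm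 c^*\prod_{j=0}^{2s}b(q^{\frac12+j-s}u\zeta)b(q^{\frac12+j-s}u\zeta^{-1})$$ (for either choice of $q^{1/2}$) and $g(u,v)=(b(u/v)b(quv))^{-1}$. Let $y_1,\dots,y_{2s+1}\in\mathbb C^*$ be such that $b(y_j^2),b(qy_j^2),b(q^2y_j^2)\ne0$ for all $j$ and $b(y_j/y_k),b(qy_jy_k)\neq0$ for $j\ne k$. Let $\bar{\mathcal Y}_k$ be the family of the $y_i$ with $i\ne k$, and let $\mathcal M^{\epsilon,M}$ be the $(2s+1)\times(2s+1)$ matrix with entries $$\mathcal M^{\epsilon,M}_{jk}=\Big(\frac{y_j}{y_k}\Big)^\epsilon\frac{b(y_k^2)}{b(y_j^2)}\Big(\prod_{i\ne k}g(y_k,y_i)\Big)Y_\epsilon(y_k|\bar{\mathcal Y}_j)+\delta_{jk}\bigg(\frac{(q+q^{-1})^2}{\rho\,b(y_j^2)b(q^2y_j^2)}\Big(\eta^*+\eta\,\frac{qy_j^2+q^{-1}y_j^{-2}}{q+q^{-1}}\Big)-\theta_M\bigg).$$ **Bethe states.** Let $A,A^*$ be endomorphisms of a complex vector space $\mathcal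 V$ of dimension $2s+1$ with $$[A,[A,A^*]_q]_{q^{-1}}=\rho A^*+\omega A+\eta,\qquad [A^*,[A^*,A]_q]_{q^{-1}}=\rho A+\omega A^*+\eta^*$$ and eigenvalues $\theta_0,\dots,\theta_{2s}$, resp. $\theta^*_0,\dots,\theta^*_{2s}$; let $|\theta_M\rangle$ ($0\le M\le2s$) and $|\theta_0^*\rangle$ be corresponding eigenvectors of $A$ and $A^*$, normalized by $|\theta^*_0\rangle=\sum_M|\theta_M\rangle$, and let $\langle\theta_M|$ be covectors with $\langle\theta_M|\theta_{M'}\rangle=\delta_{MM'}\xi_M$, $\xi_M\ne0$. For $m\in\mathbb Z$, $\chi\in\mathbb C^*$ and $\alpha$ let $$\mathscr B^+(u,m)=\tfrac{b(u^2)}{\alpha q^{2m+2}}\Big(\tfrac{\chi q^m}{\rho u}[A^*,A]_q+\tfrac{q^{m-1}\chi}{\rho\,b(q^2)}\big((q^2+1)u^{-1}\omega+\rho(q^2u+u^{-3})\big)\Big),$$ $$\mathscr B^-(u,m)=\tfrac{b(u^2)q^{2m+3}}{\alpha}\Big(\tfrac{u\chi q^{-m-1}}{\rho}[A^*,A]_q+\tfrac{q^{-m-2}\chi}{\rho\,b(q^2)}\big((q^2+1)u\,\omega+\rho(q^2u^3+u^{-1})\big)\Big)$$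 (the dynamical operators with gauge parameter $\beta=0$). For $u_1,\dots,u_{2s}\in\mathbb C^*$ the Bethe states are $|\Psi_\epsilon(\bar u,m)\rangle=\mathscr B^\epsilon(u_1,m+2(2s-1))\cdots\mathscr B^\epsilon(u_{2s},m)|\Omega^\epsilon\rangle$ with $|\Omega^-\rangle=|\theta_0\rangle$, $|\Omega^+\rangle=|\theta_0^*\rangle$, where $(q^2-q^{-2})\chi^{-1}\alpha\mathrm bq^{-m}=-1$ for $\epsilon=-$ and $(q^2-q^{-2})\chi^{-1}\alpha\mathrm c^*q^{m}=1$ for $\epsilon=+$. **Theorem.** Let $0\le M\le 2s$. 1. For $\epsilon=-$ and for $\epsilon=+$, $\sum_{k=1}^{2s+1}\mathcal M^{\epsilon,M}_{jk}X^\epsilon_M(\bar{\mathcal Y}_k)=0$ for $j=1,\dots,2s+1$. 2. For both signs $\epsilon$, $\operatorname{rank}\mathcal M^{\epsilon,M}=2s$; in particular the system $\mathcal M^{\epsilon,M}X=0$ has a solution $X\ne0$. 3. The functions $X^\epsilon_M$ are the normalized scalar products of on-shell and off-shell Bethe states: $\langle\theta_M|\Psi_\epsilon(\bar u,m)\rangle/\langle\theta_M|\theta_M\rangle=X^\epsilon_M(\bar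 u)$ for $\epsilon=\pm$. -/

import Mathlib

namespace BelliardSlavnov

noncomputable section

/-- `b(x) = x - x⁻¹`. -/
def bf (x : ℂ) : ℂ := x - x⁻¹

/-- The `q`-shifted factorial `(a; t)_N = ∏_{k < N} (1 - a t^k)`. -/
def qPoch (a t : ℂ) (N : ℕ) : ℂ := ∏ k ∈ Finset.range N, (1 - a * t ^ k)

/-- The `q`-commutator `[X, Y]_q = q X Y - q⁻¹ Y X`. -/
def qComm {V : Type*} [AddCommGroup V] [Module ℂ V] (q : ℂ) (X Y : Module.End ℂ V) :
    Module.End ℂ V :=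
  q • (X * Y) - q⁻¹ • (Y * X)

/-- Labels of the three members of the triple `(A, A*, A^⋄)`. -/
inductive Label
  | dot
  | star
  | dia

/-- The sign `ε = ±`. -/
inductive Eps
  | plus
  | minus

namespace Eps

/-- The value `ε = ± 1`. -/
def val : Eps → ℤ
  | plus => 1
  | minus => -1

/-- `(1 + ε) / 2`, which is also the Kronecker symbol `δ_{ε,+}`. -/
def isPlus : Eps → ℕ
  | plus => 1
  | minus => 0

/-- `(1 - ε) / 2`. -/
def isMinus : Eps → ℕ
  | plus => 0
  | minus => 1

end Eps

/-- The scalars that enter the construction: `n = 2s`, the number `q` with a square root `qh`,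
the numbers `r₀`, `ζ`, and for each `a ∈ {·, *, ⋄}` the spectral parameters `b^a`, `c^a`. -/
structure Params where
  n : ℕ
  q : ℂ
  qh : ℂ
  r₀ : ℂ
  ζ : ℂ
  b : Label → ℂ
  c : Label → ℂ

namespace Params

open Label

variable (P : Params)

/-- The standing assumptions on the scalars. The fields `spec` and `irred₁, …, irred₄` are the
conditions under which `(A, A*, A^⋄)` is a Leonard triple of `q`-Racah type; the field `den` says
that the denominators `1 - b^⋄/c^⋄` and `1 - q^{8s} b^⋄/c^⋄` in the displayed coefficients
`k_N` do not vanish. -/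
structure Admissible : Prop where
  q_ne : P.q ≠ 0
  q_root : ∀ k : ℕ, 1 ≤ k → P.q ^ k ≠ 1
  qh_sq : P.qh ^ 2 = P.q
  r₀_ne : P.r₀ ≠ 0
  ζ_ne : P.ζ ≠ 0
  b_ne : ∀ a, P.b a ≠ 0
  c_ne : ∀ a, P.c a ≠ 0
  r₀_eq : ∀ a, (P.r₀ ^ 2)⁻¹ = P.b a * P.c a
  ζ_b : (P.ζ ^ 2)⁻¹ = P.b dia * P.r₀ * P.q ^ P.n
  ζ_c : P.ζ ^ 2 = P.c dia * P.r₀ * (P.q ^ P.n)⁻¹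
  spec : ∀ a, ∀ k : ℕ, 1 ≤ k → k < 2 * P.n → P.b a * (P.c a)⁻¹ ≠ P.q ^ (-(2 * k) : ℤ)
  irred₁ : ∀ k : ℕ, 1 ≤ k → k ≤ P.n →
    P.c star ≠ -P.r₀ * P.q ^ (-2 * k + 1 : ℤ) * P.c dot * P.c dia
  irred₂ : ∀ k : ℕ, 1 ≤ k → k ≤ P.n →
    P.b dot ≠ -P.r₀ * P.q ^ (-2 * k + 1 + 2 * P.n : ℤ) * P.b star * P.b dia
  irred₃ : ∀ k : ℕ, 1 ≤ k → k ≤ P.n →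
    P.c dot ≠ -P.r₀ * P.q ^ (2 * k + 2 * P.n - 1 : ℤ) * P.b star * P.b dia
  irred₄ : ∀ k : ℕ, 1 ≤ k → k ≤ P.n →
    P.c star ≠ -P.r₀ * P.q ^ (2 * k - 1 : ℤ) * P.b dot * P.c dia
  den : P.b dia ≠ P.c dia ∧ P.c dia ≠ P.b dia * P.q ^ (4 * P.n)

/-! ### Spectra and structure constants -/

/-- `θ^a_M = b^a q^{2M} + c^a q^{-2M}`. -/
def θ (a : Label) (M : ℕ) : ℂ := P.b a * P.q ^ (2 * M) + P.c a * (P.q ^ (2 * M))⁻¹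

/-- `θ^a_s = b^a q^{2s} + c^a q^{-2s}`. -/
def θs (a : Label) : ℂ := P.b a * P.q ^ P.n + P.c a * (P.q ^ P.n)⁻¹

/-- `ω^{a,b,c}`. -/
def ωabc (a b c : Label) : ℂ :=
  -(P.q - P.q⁻¹) ^ 2 *
    (P.θs a * P.θs b - P.r₀⁻¹ * (P.q ^ (P.n + 1) + (P.q ^ (P.n + 1))⁻¹) * P.θs c)

/-- The structure constant `ρ`. -/
def ρ : ℂ := -((P.q ^ 2 - (P.q ^ 2)⁻¹) ^ 2 / P.r₀ ^ 2)

/-- The structure constant `ω`. -/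
def ω : ℂ := P.ωabc dot star dia

/-- The structure constant `η`. -/
def η : ℂ := (P.q + P.q⁻¹) / P.r₀ * P.ωabc dot dia star

/-- The structure constant `η*`. -/
def ηs : ℂ := (P.q + P.q⁻¹) / P.r₀ * P.ωabc star dia dot

/-! ### Transition coefficients -/

/-- The `q`-Racah polynomial `R^{a,c}_M(θ^b_N)`: the basic hypergeometric series `₄φ₃` with base
and argument `q²`, numerator parameters
`q^{-2M}, (b^a/c^a) q^{2M}, q^{-2N}, (b^b/c^b) q^{2N}` and denominator parameters
`-(b^a c^c/c^b) r₀ q, -(b^b b^c/c^a) r₀ q^{4s+1}, q^{-4s}`.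
The series terminates at `k = M` because of the numerator parameter `q^{-2M}`. -/
def R (a b c : Label) (M N : ℕ) : ℂ :=
  ∑ k ∈ Finset.range (M + 1),
    (qPoch ((P.q ^ (2 * M))⁻¹) (P.q ^ 2) k * qPoch (P.b a / P.c a * P.q ^ (2 * M)) (P.q ^ 2) k *
        qPoch ((P.q ^ (2 * N))⁻¹) (P.q ^ 2) k *
        qPoch (P.b b / P.c b * P.q ^ (2 * N)) (P.q ^ 2) k) /
      (qPoch (-(P.b a * P.c c / P.c b) * P.r₀ * P.q) (P.q ^ 2) k *
        qPoch (-(P.b b * P.b c / P.c a) * P.r₀ * P.q ^ (2 * P.n + 1)) (P.q ^ 2) k *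
        qPoch ((P.q ^ (2 * P.n))⁻¹) (P.q ^ 2) k * qPoch (P.q ^ 2) (P.q ^ 2) k) *
      (P.q ^ 2) ^ k

/-- `k^{a,b,c}_N`. -/
def kc (a b c : Label) (N : ℕ) : ℂ :=
  (qPoch (-(P.b b * P.b c / P.c a) * P.r₀ * P.q ^ (2 * P.n + 1)) (P.q ^ 2) N *
      qPoch (-(P.b a * P.c c / P.c b) * P.r₀ * P.q) (P.q ^ 2) N *
      qPoch (P.b b / P.c b) (P.q ^ 2) N * qPoch ((P.q ^ (2 * P.n))⁻¹) (P.q ^ 2) N) /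
    (qPoch (P.q ^ 2) (P.q ^ 2) N *
      qPoch (-(P.b b * P.b c / P.b a) * P.r₀ * P.q) (P.q ^ 2) N *
      qPoch (-(P.c a * P.c c / P.c b) * P.r₀ * P.q ^ (1 - 2 * P.n : ℤ)) (P.q ^ 2) N *
      qPoch (P.b b / P.c b * P.q ^ (2 * P.n + 2)) (P.q ^ 2) N) *
    ((1 - P.b b / P.c b * P.q ^ (4 * N)) / ((P.b a / P.c a) ^ N * (1 - P.b b / P.c b)))

/-- `ν₀^{a,b,c}`. -/
def ν₀ (a b c : Label) : ℂ :=
  (qPoch (P.b a / P.c a * P.q ^ 2) (P.q ^ 2) P.n *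
      qPoch (P.b b / P.c b * P.q ^ 2) (P.q ^ 2) P.n) /
    ((-(P.b b * P.b c / P.c a) * P.r₀ * P.q ^ (2 * P.n + 1)) ^ P.n *
      qPoch (-(P.b a * P.c c / P.b b) * P.r₀ * P.q ^ (1 - 2 * P.n : ℤ)) (P.q ^ 2) P.n *
      qPoch (-(P.c a * P.c c / P.c b) * P.r₀ * P.q ^ (1 - 2 * P.n : ℤ)) (P.q ^ 2) P.n)

/-- The entry `((P^{a,b})⁻¹)_{NM} = (ν₀^{a,b,c})⁻¹ k^{b,a,c}_M R^{a,c}_M(θ^b_N)`, where `c` is the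
third label. -/
def Pinv (a b c : Label) (N M : ℕ) : ℂ := (P.ν₀ a b c)⁻¹ * P.kc b a c M * P.R a b c M N

/-- `f_M / f_0`, for `(a, b, c) = (·, *, ⋄)`. -/
def fRel (M : ℕ) : ℂ :=
  ∏ k ∈ Finset.range M,
    (P.c dot * P.q ^ (-2 * k - 2 : ℤ) + P.r₀ * P.q⁻¹ * P.c star * P.b dia) /
      (P.b dot * P.q ^ (2 * k) + P.r₀ * P.q⁻¹ * P.c star * P.b dia)

/-- `h_M / h_0`, for `(a, b, c) = (·, *, ⋄)`. -/
def hRel (M : ℕ) : ℂ :=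
  ∏ k ∈ Finset.range M,
    P.q ^ (4 * k) * (P.b dia / P.c dia) *
      ((P.c dia * (P.q ^ (2 * k))⁻¹ + P.r₀ * P.q * P.c star * P.b dot) /
        (P.b dia * P.q ^ (2 * k) + P.r₀ * P.q⁻¹ * P.c star * P.b dot))

/-- The scalar `f_0 h_0⁻¹ g_0⁻¹`. -/
def fgh : ℂ :=
  (-1) ^ P.n * P.q ^ (P.n * (P.n - 1)) *
    ((qPoch (P.q ^ 2 * P.r₀ ^ 2 * P.b dot ^ 2) (P.q ^ 2) P.n *
        qPoch (P.q ^ 2 * P.r₀ ^ 2 * P.b dia ^ 2) (P.q ^ 2) P.n *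
        qPoch (P.q ^ 2 * P.r₀ ^ 2 * P.b star ^ 2) (P.q ^ 2) P.n) /
      (qPoch (-(P.q * P.r₀ * P.b dot * P.b dia / P.b star)) (P.q ^ 2) P.n *
        qPoch (-(P.q * P.r₀ * P.b dot * P.b star / P.b dia)) (P.q ^ 2) P.n *
        qPoch (-(P.q * P.r₀ * P.b dia * P.b star / P.b dot)) (P.q ^ 2) P.n))

/-! ### The explicit scalar products -/

/-- `U = (q u² + q⁻¹ u⁻²) / (q + q⁻¹)`. -/
def U (u : ℂ) : ℂ := (P.q * u ^ 2 + P.q⁻¹ * (u ^ 2)⁻¹) / (P.q + P.q⁻¹)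

/-- `𝒢^ε_m(ū)`. -/
def G (ε : Eps) {m : ℕ} (u : Fin m → ℂ) : ℂ :=
  (ε.val * (P.q + P.q⁻¹) * P.q ^ (-ε.val * (m + 1)) *
      P.b dot ^ ε.isMinus * P.c star ^ ε.isPlus) ^ m *
    ∏ i, bf (u i ^ 2) * u i ^ (-ε.val)

/-- The explicit formula for the normalized scalar product of `⟨θ_M|` with the off-shell Bethe
state of type `ε = -`. -/
def scalMinus (M : ℕ) {m : ℕ} (u : Fin m → ℂ) : ℂ :=
  P.G .minus u * P.fRel M *
    ∑ M' ∈ Finset.range (P.n + 1), P.Pinv dia dot star M M' *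
      ∏ i, (P.U (u i) - P.r₀ / (P.q + P.q⁻¹) * P.θ dia M')

/-- The explicit formula for the normalized scalar product of `⟨θ_M|` with the off-shell Bethe
state of type `ε = +`. The factor `f_M / (g_0 h_{M'})` is
`(f_0 h_0⁻¹ g_0⁻¹) (f_M / f_0) (h_{M'} / h_0)⁻¹`. -/
def scalPlus (M : ℕ) {m : ℕ} (u : Fin m → ℂ) : ℂ :=
  P.G .plus u * (P.fgh * P.fRel M / P.ν₀ star dia dot) *
    ∑ M' ∈ Finset.range (P.n + 1), (P.hRel M')⁻¹ * P.Pinv dia dot star M M' *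
      ∏ i, (P.U (u i) - P.r₀ / (P.q + P.q⁻¹) * P.θ dia M')

/-! ### The Belliard–Slavnov linear system -/

/-- `Λ₁^ε(u)`. -/
def Λ₁ (ε : Eps) (u : ℂ) : ℂ :=
  P.q ^ (-(P.n : ℤ) - 1) / u ^ ε.val *
    (P.q ^ (P.n + 1) * u * P.ζ⁻¹ - u⁻¹ * P.ζ) * (P.q ^ (P.n + 1) * u * P.ζ - u⁻¹ * P.ζ⁻¹) *
    (u * P.c star * (P.q ^ P.n)⁻¹ + u⁻¹ * P.b dot * P.q ^ P.n) *
    (u * (P.c dot / P.c star) ^ ε.isMinus + u⁻¹ * (P.b star / P.b dot) ^ ε.isPlus)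

/-- `Λ₂^ε(u)`. -/
def Λ₂ (ε : Eps) (u : ℂ) : ℂ :=
  (u ^ 2 - (u ^ 2)⁻¹) * P.q ^ (-(P.n : ℤ) - 1) /
      (u ^ ε.val * (P.q * u ^ 2 - P.q⁻¹ * (u ^ 2)⁻¹)) *
    (P.q ^ ((P.n : ℤ) - 1) * u⁻¹ * P.ζ - u * P.ζ⁻¹) *
    (P.q ^ ((P.n : ℤ) - 1) * u⁻¹ * P.ζ⁻¹ - u * P.ζ) *
    (P.q ^ 2 * u * P.b dot * P.q ^ P.n + u⁻¹ * P.c star * (P.q ^ P.n)⁻¹) *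
    (P.q ^ 2 * u * (P.b star / P.b dot) ^ ε.isPlus + u⁻¹ * (P.c dot / P.c star) ^ ε.isMinus)

/-- `ν₊ = q^{-1-4s} c*`. -/
def νplus : ℂ := P.q ^ (-1 - 2 * P.n : ℤ) * P.c star

/-- `g(u, v) = (b(u/v) b(q u v))⁻¹`. -/
def g (u v : ℂ) : ℂ := (bf (u / v) * bf (P.q * u * v))⁻¹

/-- `Y_ε(u | ū)`; the power `q^{1/2 + j - s}` is `qh^{1 + 2j - 2s}`. -/
def Y (ε : Eps) (u : ℂ) {m : ℕ} (v : Fin m → ℂ) : ℂ :=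
  u ^ (2 * ε.val + 1) * P.Λ₁ ε u / (bf (u ^ 2) * bf (P.q * u ^ 2)) *
      (∏ i, bf (u / (P.q * v i)) * bf (u * v i)) +
    P.q ^ (-ε.val - 1) * u⁻¹ * P.Λ₂ ε u / (bf (u ^ 2) * bf (P.q ^ 2 * u ^ 2)) *
      (∏ i, bf (P.q * u / v i) * bf (P.q ^ 2 * u * v i)) -
    ε.isPlus * P.νplus *
      ∏ j ∈ Finset.range (P.n + 1),
        bf (P.qh ^ (1 + 2 * j - P.n : ℤ) * u * P.ζ) * bf (P.qh ^ (1 + 2 * j - P.n : ℤ) * u * P.ζ⁻¹)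

/-- The family `𝒴̄_k = {y_1, …, y_{2s+1}} \ y_k`. -/
def omit1 {m : ℕ} (y : Fin (m + 1) → ℂ) (k : Fin (m + 1)) : Fin m → ℂ := fun i => y (k.succAbove i)

/-- The coefficients `L^ε_{jk}`. -/
def L (ε : Eps) (y : Fin (P.n + 1) → ℂ) (j k : Fin (P.n + 1)) : ℂ :=
  (y j / y k) ^ ε.val * (bf (y k ^ 2) / bf (y j ^ 2)) * (∏ i, P.g (y k) (omit1 y k i)) *
      P.Y ε (y k) (omit1 y j) +
    if j = k then
      (P.q + P.q⁻¹) ^ 2 / (P.ρ * bf (y j ^ 2) * bf (P.q ^ 2 * y j ^ 2)) *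
        (P.ηs + P.η * ((P.q * y j ^ 2 + P.q⁻¹ * (y j ^ 2)⁻¹) / (P.q + P.q⁻¹)))
    else 0

/-- The matrix `ℳ^{ε,M}` of the Belliard–Slavnov linear system, `ℳ_{jk} = L_{jk} - δ_{jk} θ_M`. -/
def bsMatrix (ε : Eps) (M : ℕ) (y : Fin (P.n + 1) → ℂ) :
    Matrix (Fin (P.n + 1)) (Fin (P.n + 1)) ℂ :=
  Matrix.of fun j k => P.L ε y j k - if j = k then P.θ dot M else 0

/-- Genericity of the points `y_1, …, y_{2s+1}`: they are nonzero and no denominator of the linear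
system vanishes. In particular the points are distinct. -/
structure Generic (y : Fin (P.n + 1) → ℂ) : Prop where
  ne_zero : ∀ j, y j ≠ 0
  den₀ : ∀ j, bf (y j ^ 2) ≠ 0
  den₁ : ∀ j, bf (P.q * y j ^ 2) ≠ 0
  den₂ : ∀ j, bf (P.q ^ 2 * y j ^ 2) ≠ 0
  den_pair : ∀ j k, j ≠ k → bf (y j / y k) ≠ 0 ∧ bf (P.q * y j * y k) ≠ 0

/-! ### Leonard pairs and Bethe states -/

section Rep

variable {V : Type*} [AddCommGroup V] [Module ℂ V]

/-- `(A, A*)` is a representation of the Askey–Wilson algebra on a space of dimension `2s+1`, with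
the structure constants `ρ, ω, η, η*` and the spectra `{θ_M}`, `{θ*_N}`. -/
structure IsLeonardPair (A As : Module.End ℂ V) : Prop where
  dim : Module.finrank ℂ V = P.n + 1
  aw₁ : qComm P.q⁻¹ A (qComm P.q A As) = P.ρ • As + P.ω • A + P.η • 1
  aw₂ : qComm P.q⁻¹ As (qComm P.q As A) = P.ρ • A + P.ω • As + P.ηs • 1
  spec : ∀ M ≤ P.n, A.HasEigenvalue (P.θ dot M)
  spec_star : ∀ N ≤ P.n, As.HasEigenvalue (P.θ star N)

/-- `|θ_0⟩, …, |θ_{2s}⟩` are eigenvectors of `A` and `|θ*_0⟩` is an eigenvector of `A*`. Their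
relative normalization is `|θ*_0⟩ = ∑_M |θ_M⟩`: the first column of the transition matrix
consists of ones. -/
structure IsEigenData (A As : Module.End ℂ V) (v : Fin (P.n + 1) → V) (w₀ : V) : Prop where
  eig : ∀ M : Fin (P.n + 1), A.HasEigenvector (P.θ dot M) (v M)
  eig_star : As.HasEigenvector (P.θ star 0) w₀
  norm : w₀ = ∑ M, v M

/-- The dynamical operators `ℬ^ε(u, m)` with gauge parameters `α, β, χ`. The factor `β` in front of
the operators has been multiplied into the parentheses, so that `β = 0` is allowed. -/
def dynB (A As : Module.End ℂ V) (α β χ : ℂ) : Eps → ℂ → ℤ → Module.End ℂ V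
  | .plus, u, m =>
    (bf (u ^ 2) / (α * P.q ^ (2 * m + 2) - β)) •
      ((χ * P.q ^ m / (P.ρ * u)) • qComm P.q As A
        - (β ^ 2 * P.q ^ (-m) / (u * χ)) • qComm P.q A As
        + (β * (P.q ^ 2 + 1) / (P.q * u)) • A
        - (β * (1 / (P.q * u ^ 3) + P.q * u)) • As
        + (P.q ^ (-m - 3) / (P.ρ * χ * bf (P.q ^ 2)) *
            ((P.q ^ 2 + 1) * u⁻¹ *
                (P.ω * (χ ^ 2 * P.q ^ (2 * m + 2) - β ^ 2 * P.q ^ 2 * P.ρ)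
                  + β * (P.q ^ 4 - 1) * P.ηs * χ * P.q ^ m)
              - P.q ^ 2 * P.ρ * (P.q ^ 2 * u + (u ^ 3)⁻¹) *
                (β ^ 2 * P.ρ - χ ^ 2 * P.q ^ (2 * m)))) • (1 : Module.End ℂ V))
  | .minus, u, m =>
    (bf (u ^ 2) * P.q ^ (2 * m + 1) / (α * P.q ^ (-2 : ℤ) - β * P.q ^ (2 * m))) •
      ((u * χ * P.q ^ (-m - 1) / P.ρ) • qComm P.q As A
        - (β ^ 2 * u * P.q ^ (m - 1) / χ) • qComm P.q A As
        + (β * (P.q ^ 2 * u ^ 4 + 1) / (P.q ^ 2 * u)) • A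
        - (β * (P.q ^ 2 + 1) * u / P.q ^ 2) • As
        - (P.q ^ (-m - 4) / (P.ρ * χ * bf (P.q ^ 2)) *
            (P.ρ * P.q ^ 2 * (P.q ^ 2 * u ^ 3 + u⁻¹) * (β ^ 2 * P.ρ * P.q ^ (2 * m) - χ ^ 2)
              + (P.q ^ 2 + 1) * u *
                (P.ω * (β ^ 2 * P.ρ * P.q ^ (2 * m + 2) - P.q ^ 2 * χ ^ 2)
                  + β * (P.q ^ 4 - 1) * P.η * χ * P.q ^ m))) • (1 : Module.End ℂ V))

/-- The string of dynamical operators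
`ℬ^ε(u_1, m + 2(M-1)) ⋯ ℬ^ε(u_M, m)`, for `β = 0`. -/
def stringB (A As : Module.End ℂ V) (α χ : ℂ) (ε : Eps) (m₀ : ℤ) {m : ℕ} (u : Fin m → ℂ) :
    Module.End ℂ V :=
  (List.ofFn fun i : Fin m => P.dynB A As α 0 χ ε (u i) (m₀ + 2 * ((m : ℤ) - 1 - (i : ℕ)))).prod

/-- The condition on the gauge parameters `α, χ` under which the reference state of type `ε` is
annihilated. -/
def Gauge (α χ : ℂ) (m₀ : ℤ) : Eps → Prop
  | .minus => (P.q ^ 2 - (P.q ^ 2)⁻¹) * χ⁻¹ * α * P.b dot * P.q ^ (-m₀) = -1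
  | .plus => (P.q ^ 2 - (P.q ^ 2)⁻¹) * χ⁻¹ * α * P.c star * P.q ^ m₀ = 1

/-- The Bethe state `|Ψ_ε(ū, m₀)⟩`, with the reference states `|Ω⁻⟩ = |θ_0⟩` and
`|Ω⁺⟩ = |θ*_0⟩`. -/
def bethe (A As : Module.End ℂ V) (v : Fin (P.n + 1) → V) (w₀ : V) (α χ : ℂ) (m₀ : ℤ)
    (ε : Eps) {m : ℕ} (u : Fin m → ℂ) : V :=
  P.stringB A As α χ ε m₀ u (match ε with | .minus => v 0 | .plus => w₀)

end Rep

end Params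

end

end BelliardSlavnov

/-! Scalar products. With `β = 0` every dynamical operator is a scalar multiple of `specV u - r₀
A^⋄`, where `r₀ A^⋄` is the affine function `opZ` of the q-commutator of `A^*` and `A` (`dynB_eq`).
A Bethe state is therefore a polynomial in `A^⋄`, with roots at the spectral values of the `u_i`,
applied to a reference vector. Expanding along eigenvectors of `A^⋄` ("dual coordinates"), this
polynomial multiplies the `N`-th coordinate by its value at `tauM N = r₀ θ^⋄_N`, and the coefficient
of `|θ_M⟩` is read off from the transition matrix `f_M Pinv_{MN}` of q-Racah polynomials
(`apply_vecOf`, `opZ_vec`). The reference vector `|θ_0⟩` has all dual coordinates `1`, by the row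
sums `sum_Pinv`. The vector `|θ*_0⟩` has dual coordinates proportional to `1 / h_N`, because both
vectors obey the same first-order recursion in `M` (`vecOf_hRel_const`); the constant comes from a
`₆φ₅` summation (`fgh_mul_vecOf_hRel`).

Linear system. For fixed `M` the scalar product is, up to explicit factors, a linear functional
`pairing ε M` evaluated on the monic polynomial with roots `specV u_i`. The q-Racah difference
equation, transposed by summation by parts, makes this functional a left eigenvector with eigenvalue
`θ_M` of a q-difference operator (`exists_image`). The operator acts on polynomials through its
action on the products `qPair`, hence the same operator can be read on the grid of `A^⋄` and at
arbitrary points. At arbitrary points its coefficients are those of `Y_ε` together with the term in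
`η, η*`. Lagrange interpolation at `y_1, …, y_{2s+1}` of the image of the polynomial that omits
`y_j` produces exactly the coefficients `L_{jk}` (`L_eq`), so pairing gives `L X_M = θ_M X_M`
(`sum_L_solVec`). For `ε = +` the operator is conjugated by `h`; it raises the degree by a multiple
of the nodal polynomial of the grid, which is invisible on the grid and is removed at generic points
by the term with `ν₊`.

Rank. The matrix `L` does not depend on `M`, the vectors `X_M` are nonzero and the `θ_M` are
distinct, so `L` has simple spectrum and `L - θ_M` has corank one.

Abstract Leonard pairs. The first Askey–Wilson relation makes `A^*` tridiagonal in the eigenbasis of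
`A` and fixes most diagonal entries; the eigenvectors `|θ*_0⟩` and `A|θ*_0⟩ - c|θ*_0⟩` of `A^*`
supply the remaining equations (`sum_matrix_star`). -/

namespace BelliardSlavnov

noncomputable section

/-! ### The Askey–Wilson operator on the products `qPair` -/

/-- The product `(w⁻¹; Q)_k (X w; Q)_k`, a polynomial of degree `k` in `w⁻¹ + X w`. -/
def qPair (Q X w : ℂ) (k : ℕ) : ℂ := qPoch w⁻¹ Q k * qPoch (X * w) Q k

lemma qPoch_zero (a t : ℂ) : qPoch a t 0 = 1 := by simp [qPoch]

lemma qPoch_succ (a t : ℂ) (k : ℕ) : qPoch a t (k + 1) = qPoch a t k * (1 - a * t ^ k) := by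
  simp [qPoch, Finset.prod_range_succ]

lemma qPoch_shift (a t : ℂ) (k : ℕ) : (1 - a) * qPoch (a * t) t k = qPoch a t (k + 1) := by
  rw [qPoch, qPoch, Finset.prod_range_succ', mul_comm]
  simp [pow_succ', mul_assoc]

lemma qPoch_ne_zero {a t : ℂ} {N : ℕ} (h : ∀ k < N, a * t ^ k ≠ 1) : qPoch a t N ≠ 0 :=
  Finset.prod_ne_zero_iff.2 fun k hk => sub_ne_zero.2 (h k (Finset.mem_range.1 hk)).symm

lemma qPoch_eq_zero {a t : ℂ} {N k : ℕ} (hk : k < N) (h : a * t ^ k = 1) : qPoch a t N = 0 :=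
  Finset.prod_eq_zero (Finset.mem_range.2 hk) (by rw [h, sub_self])

lemma qPair_zero (Q X w : ℂ) : qPair Q X w 0 = 1 := by simp [qPair, qPoch_zero]

lemma qPair_succ (Q X w : ℂ) (k : ℕ) :
    qPair Q X w (k + 1) = (1 - w⁻¹ * Q ^ k) * (1 - X * w * Q ^ k) * qPair Q X w k := by
  rw [qPair, qPair, qPoch_succ, qPoch_succ]; ring

/-- A shift of `w` by `Q` moves both Pochhammer symbols by one place, so only boundary factors
change. The multiplier `1 - X w` that clears the denominator is a factor of the generic `u₀`; in the
same way `1 - w⁻¹` in `qPair_down` matches the factor `1 - w` of the generic `d₀`. -/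
lemma qPair_up {Q X w : ℂ} (hQ : Q ≠ 0) (k : ℕ) :
    (1 - X * w) * qPair Q X (Q * w) (k + 1) =
      (1 - (Q * w)⁻¹) * (1 - X * w * Q ^ k) * (1 - X * w * Q ^ (k + 1)) * qPair Q X w k := by
  have h1 : qPoch (Q * w)⁻¹ Q (k + 1) = (1 - (Q * w)⁻¹) * qPoch w⁻¹ Q k := by
    rw [← qPoch_shift, mul_inv, mul_right_comm, inv_mul_cancel₀ hQ, one_mul]
  have h2 : (1 - X * w) * qPoch (X * (Q * w)) Q (k + 1) = qPoch (X * w) Q (k + 2) := by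
    rw [← qPoch_shift _ _ (k + 1), show X * (Q * w) = X * w * Q by ring]
  rw [qPoch_succ (X * w) Q (k + 1), qPoch_succ (X * w) Q k] at h2
  rw [qPair, qPair, h1]
  linear_combination (1 - (Q * w)⁻¹) * qPoch w⁻¹ Q k * h2

lemma qPair_down {Q X w : ℂ} (hQ : Q ≠ 0) (k : ℕ) :
    (1 - w⁻¹) * qPair Q X (w / Q) (k + 1) =
      (1 - X * w / Q) * (1 - w⁻¹ * Q ^ k) * (1 - w⁻¹ * Q ^ (k + 1)) * qPair Q X w k := by
  have h1 : qPoch (X * (w / Q)) Q (k + 1) = (1 - X * w / Q) * qPoch (X * w) Q k := by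
    rw [← qPoch_shift, ← mul_div_assoc, div_mul_cancel₀ _ hQ]
  have h2 : (1 - w⁻¹) * qPoch (w / Q)⁻¹ Q (k + 1) = qPoch w⁻¹ Q (k + 2) := by
    rw [← qPoch_shift _ _ (k + 1), inv_div, div_eq_mul_inv, mul_comm Q]
  rw [qPoch_succ w⁻¹ Q (k + 1), qPoch_succ w⁻¹ Q k] at h2
  rw [qPair, qPair, h1]
  linear_combination (1 - X * w / Q) * qPoch (X * w) Q k * h2

lemma qPair_one (Q X : ℂ) (k : ℕ) : qPair Q X 1 (k + 1) = 0 := by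
  rw [qPair, qPoch_eq_zero (Nat.succ_pos k) (by simp), zero_mul]

/-- The common part `u₀` and `d₀` of the coefficients of an Askey–Wilson difference operator at the
point `w`: the generic expression, and its values at the two ends of the grid. -/
def AWCoef (Q X d₂ d₃ w u₀ d₀ : ℂ) : Prop :=
  (1 - X * w ^ 2 ≠ 0 ∧ 1 - X * Q * w ^ 2 ≠ 0 ∧ X * w ^ 2 - Q ≠ 0 ∧
    u₀ = (1 - X * w) * (1 - d₂ * w) * (1 - d₃ * w) / ((1 - X * w ^ 2) * (1 - X * Q * w ^ 2)) ∧
    d₀ = (1 - w) * (X * w - d₂) * (X * w - d₃) / (X * (1 - X * w ^ 2) * (X * w ^ 2 - Q))) ∨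
  (w = 1 ∧ 1 - X * Q ≠ 0 ∧ u₀ = (1 - d₂) * (1 - d₃) / (1 - X * Q) ∧ d₀ = 0) ∨
  (d₃ = w⁻¹ ∧ X * w ^ 2 - Q ≠ 0 ∧ u₀ = 0 ∧
    d₀ = (w - 1) * (X * w - d₂) / (X * w * (X * w ^ 2 - Q))) ∨
  (w = 1 ∧ d₃ = 1 ∧ u₀ = 0 ∧ d₀ = 0)

section AWCoef

variable {Q X d₂ d₃ w u₀ d₀ : ℂ}

/-- The Askey–Wilson operator acts on the products `qPair` by a bidiagonal matrix. -/
lemma AWCoef.apply_qPair (h : AWCoef Q X d₂ d₃ w u₀ d₀) (hQ : Q ≠ 0) (hX : X ≠ 0) (hw : w ≠ 0)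
    (d₁ : ℂ) (k : ℕ) :
    u₀ * (1 - d₁ * w) * (qPair Q X (Q * w) (k + 1) - qPair Q X w (k + 1)) +
        d₀ * (X * w - d₁) * (qPair Q X (w / Q) (k + 1) - qPair Q X w (k + 1)) =
      ((Q ^ (k + 1))⁻¹ - 1) * (1 - d₁ * d₂ * d₃ / (X * Q) * Q ^ (k + 1)) * qPair Q X w (k + 1) +
        (1 - (Q ^ (k + 1))⁻¹) * ((1 - d₁ * Q ^ k) * (1 - d₂ * Q ^ k) * (1 - d₃ * Q ^ k)) *
          qPair Q X w k := by
  have hs : Q ^ k ≠ 0 := pow_ne_zero _ hQ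
  rcases h with ⟨h1, h2, h3, rfl, rfl⟩ | ⟨rfl, h1, rfl, rfl⟩ | ⟨rfl, h1, rfl, rfl⟩ |
    ⟨rfl, rfl, rfl, rfl⟩
  · have hu := qPair_up (X := X) (w := w) hQ k
    have hd := qPair_down (X := X) (w := w) hQ k
    have hd' : (1 - w) * qPair Q X (w / Q) (k + 1) = -w * ((1 - X * w / Q) * (1 - w⁻¹ * Q ^ k) *
        (1 - w⁻¹ * Q ^ (k + 1)) * qPair Q X w k) := by
      rw [← hd]; field_simp; ring
    rw [qPair_succ Q X w k]
    generalize qPair Q X (Q * w) (k + 1) = pu at *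
    generalize qPair Q X (w / Q) (k + 1) = pd at *
    generalize qPair Q X w k = p at *
    -- Grouped so that the shifted products occur only with the multipliers of `qPair_up` and
    -- `qPair_down`. Everything then becomes a multiple of `qPair Q X w k`, and a rational identity
    -- remains.
    trans (1 - d₂ * w) * (1 - d₃ * w) / ((1 - X * w ^ 2) * (1 - X * Q * w ^ 2)) * (1 - d₁ * w) *
        ((1 - X * w) * pu - (1 - X * w) * ((1 - w⁻¹ * Q ^ k) * (1 - X * w * Q ^ k) * p)) +
      (X * w - d₂) * (X * w - d₃) / (X * (1 - X * w ^ 2) * (X * w ^ 2 - Q)) * (X * w - d₁) *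
        ((1 - w) * pd - (1 - w) * ((1 - w⁻¹ * Q ^ k) * (1 - X * w * Q ^ k) * p))
    · ring
    rw [hu, hd', pow_succ Q k]
    generalize Q ^ k = s at *
    clear hu hd hd'
    generalize he1 : 1 - X * w ^ 2 = e₁ at *
    generalize he2 : 1 - X * Q * w ^ 2 = e₂ at *
    generalize he3 : X * w ^ 2 - Q = e₃ at *
    field_simp
    subst he1 he2 he3
    ring
  · rcases k with _ | k
    · simp only [zero_add, pow_zero, pow_one, qPair_succ, qPair_zero]
      field_simp
      ring
    -- At `w = 1` the downward term is absent, and products with at least two factors vanish both at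
    -- `1` and at `Q`.
    · have : qPair Q X (Q * 1) (k + 1 + 1) = 0 := by
        rw [mul_one, qPair, qPoch_eq_zero (k := 1) (by omega) (by field_simp), zero_mul]
      rw [this, qPair_one, qPair_one]; ring
  · have hd := qPair_down (X := X) (w := w) hQ k
    have hd' : (w - 1) * qPair Q X (w / Q) (k + 1) = w * ((1 - X * w / Q) * (1 - w⁻¹ * Q ^ k) *
        (1 - w⁻¹ * Q ^ (k + 1)) * qPair Q X w k) := by
      rw [← hd]; field_simp
    rw [qPair_succ Q X w k]
    generalize qPair Q X (w / Q) (k + 1) = pd at *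
    generalize qPair Q X w k = p at *
    trans (X * w - d₂) / (X * w * (X * w ^ 2 - Q)) * (X * w - d₁) *
        ((w - 1) * pd - (w - 1) * ((1 - w⁻¹ * Q ^ k) * (1 - X * w * Q ^ k) * p))
    · ring
    rw [hd', pow_succ Q k]
    generalize Q ^ k = s at *
    clear hd hd'
    generalize he3 : X * w ^ 2 - Q = e₃ at *
    field_simp
    subst he3
    ring
  · rcases k with _ | k
    · simp [qPair_succ, qPair_zero]
    · simp [qPair_one]

/-- The operator with one interchanged factor acts on the products `qPair` by a tridiagonal
matrix. -/
lemma AWCoef.apply_qPair' (h : AWCoef Q X d₂ d₃ w u₀ d₀) (hQ : Q ≠ 0) (hX : X ≠ 0) (hw : w ≠ 0)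
    (d₁ : ℂ) (k : ℕ) :
    u₀ * (1 - d₁ / (X * Q * w)) * qPair Q X (Q * w) (k + 1) +
        d₀ * X * w * (1 - d₁ * w / Q) * qPair Q X (w / Q) (k + 1) -
        (u₀ * (1 - d₁ * w) + d₀ * (X * w - d₁)) * qPair Q X w (k + 1) =
      d₁ / (X * Q * (Q ^ (k + 1)) ^ 2) * qPair Q X w (k + 2) +
      ((Q ^ (k + 1))⁻¹ - 1 - d₁ * d₂ * d₃ / (X * Q) + d₁ / (X * Q) *
        ((d₂ + d₃ + Q) / Q ^ (k + 1) - (Q + 1) / (Q ^ (k + 1)) ^ 2)) * qPair Q X w (k + 1) +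
        (1 - (Q ^ (k + 1))⁻¹) * ((1 - d₂ * Q ^ k) * (1 - d₃ * Q ^ k) *
          (1 - d₁ / (X * Q ^ (k + 1)))) * qPair Q X w k := by
  have hs : Q ^ k ≠ 0 := pow_ne_zero _ hQ
  rcases h with ⟨h1, h2, h3, rfl, rfl⟩ | ⟨rfl, h1, rfl, rfl⟩ | ⟨rfl, h1, rfl, rfl⟩ |
    ⟨rfl, rfl, rfl, rfl⟩
  · have hu := qPair_up (X := X) (w := w) hQ k
    have hd := qPair_down (X := X) (w := w) hQ k
    have hd' : (1 - w) * qPair Q X (w / Q) (k + 1) = -w * ((1 - X * w / Q) * (1 - w⁻¹ * Q ^ k) *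
        (1 - w⁻¹ * Q ^ (k + 1)) * qPair Q X w k) := by
      rw [← hd]; field_simp; ring
    rw [qPair_succ Q X w (k + 1), qPair_succ Q X w k]
    generalize qPair Q X (Q * w) (k + 1) = pu at *
    generalize qPair Q X (w / Q) (k + 1) = pd at *
    generalize qPair Q X w k = p at *
    trans (1 - d₂ * w) * (1 - d₃ * w) / ((1 - X * w ^ 2) * (1 - X * Q * w ^ 2)) *
        ((1 - d₁ / (X * Q * w)) * ((1 - X * w) * pu) -
        (1 - d₁ * w) * (1 - X * w) * ((1 - w⁻¹ * Q ^ k) * (1 - X * w * Q ^ k) * p)) +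
      (X * w - d₂) * (X * w - d₃) / (X * (1 - X * w ^ 2) * (X * w ^ 2 - Q)) *
        (X * w * (1 - d₁ * w / Q) * ((1 - w) * pd) -
        (X * w - d₁) * (1 - w) * ((1 - w⁻¹ * Q ^ k) * (1 - X * w * Q ^ k) * p))
    · ring
    rw [hu, hd', pow_succ Q k]
    generalize Q ^ k = s at *
    clear hu hd hd'
    generalize he1 : 1 - X * w ^ 2 = e₁ at *
    generalize he2 : 1 - X * Q * w ^ 2 = e₂ at *
    generalize he3 : X * w ^ 2 - Q = e₃ at *
    field_simp
    subst he1 he2 he3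
    ring
  · rcases k with _ | k
    · simp only [zero_add, pow_zero, pow_one, qPair_succ, qPair_zero]
      field_simp
      ring
    · have : qPair Q X (Q * 1) (k + 1 + 1) = 0 := by
        rw [mul_one, qPair, qPoch_eq_zero (k := 1) (by omega) (by field_simp), zero_mul]
      rw [this, qPair_one, qPair_one, qPair_one]; ring
  · have hd := qPair_down (X := X) (w := w) hQ k
    have hd' : (w - 1) * qPair Q X (w / Q) (k + 1) = w * ((1 - X * w / Q) * (1 - w⁻¹ * Q ^ k) *
        (1 - w⁻¹ * Q ^ (k + 1)) * qPair Q X w k) := by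
      rw [← hd]; field_simp
    rw [qPair_succ Q X w (k + 1), qPair_succ Q X w k]
    generalize qPair Q X (w / Q) (k + 1) = pd at *
    generalize qPair Q X w k = p at *
    trans (X * w - d₂) / (X * w * (X * w ^ 2 - Q)) *
        (X * w * (1 - d₁ * w / Q) * ((w - 1) * pd) -
        (X * w - d₁) * (w - 1) * ((1 - w⁻¹ * Q ^ k) * (1 - X * w * Q ^ k) * p))
    · ring
    rw [hd', pow_succ Q k]
    generalize Q ^ k = s at *
    clear hd hd'
    generalize he3 : X * w ^ 2 - Q = e₃ at *
    field_simp
    subst he3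
    ring
  · rcases k with _ | k
    · simp [qPair_succ, qPair_zero]
    · simp [qPair_one]

/-- The constant function, treated apart because it has no lower neighbour. After the interchange
the coefficients no longer sum to zero, so constants are not annihilated; their image is affine in
`w⁻¹ + X w`, which is the source of the eigenvalue property of `1 / h_N`. -/
lemma AWCoef.apply_one' (h : AWCoef Q X d₂ d₃ w u₀ d₀) (hQ : Q ≠ 0) (hX : X ≠ 0) (hw : w ≠ 0)
    (d₁ : ℂ) :
    u₀ * (1 - d₁ / (X * Q * w)) + d₀ * X * w * (1 - d₁ * w / Q) -
        (u₀ * (1 - d₁ * w) + d₀ * (X * w - d₁)) =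
      d₁ / (X * Q) * qPair Q X w 1 +
      (- d₁ * d₂ * d₃ / (X * Q) + d₁ / (X * Q) * (d₂ + d₃ - 1)) := by
  rw [qPair_succ, qPair_zero]
  rcases h with ⟨h1, h2, h3, rfl, rfl⟩ | ⟨rfl, h1, rfl, rfl⟩ | ⟨rfl, h1, rfl, rfl⟩ |
    ⟨rfl, rfl, rfl, rfl⟩
  · generalize he1 : 1 - X * w ^ 2 = e₁ at *
    generalize he2 : 1 - X * Q * w ^ 2 = e₂ at *
    generalize he3 : X * w ^ 2 - Q = e₃ at *
    field_simp
    subst he1 he2 he3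
    ring
  · field_simp
    ring
  · field_simp
    ring
  · ring

end AWCoef

end

end BelliardSlavnov

/-! ### The q-Racah difference equation and the very-well-poised `₆φ₅` sum -/

namespace BelliardSlavnov

noncomputable section

/-- The `k`-th coefficient of a `q`-Racah function in the basis `qPair`. -/
def racCoef (Q Y d₁ d₂ d₃ v : ℂ) (k : ℕ) : ℂ :=
  qPair Q Y v k * Q ^ k / (qPoch d₁ Q k * qPoch d₂ Q k * qPoch d₃ Q k * qPoch Q Q k)

/-- The `q`-Racah function with `n + 1` terms. -/
def rac (Q X Y d₁ d₂ d₃ : ℂ) (n : ℕ) (w v : ℂ) : ℂ :=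
  ∑ k ∈ Finset.range (n + 1), racCoef Q Y d₁ d₂ d₃ v k * qPair Q X w k

/-- With `λ(v) = (v⁻¹ - 1)(1 - Y v)`, two consecutive coefficients differ by `λ(v) - λ(Q^k)` over
the off-diagonal entry of the bidiagonal action. This is the recursion that any eigenvector
expansion in the basis `qPair` must satisfy. -/
lemma racCoef_succ {Q Y d₁ d₂ d₃ v : ℂ} (hQ : Q ≠ 0) (hv : v ≠ 0) {k : ℕ}
    (h₁ : qPoch d₁ Q (k + 1) ≠ 0) (h₂ : qPoch d₂ Q (k + 1) ≠ 0) (h₃ : qPoch d₃ Q (k + 1) ≠ 0)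
    (h₄ : qPoch Q Q (k + 1) ≠ 0) :
    racCoef Q Y d₁ d₂ d₃ v (k + 1) * ((1 - (Q ^ (k + 1))⁻¹) *
      ((1 - d₁ * Q ^ k) * (1 - d₂ * Q ^ k) * (1 - d₃ * Q ^ k))) =
    ((v⁻¹ - 1) * (1 - Y * v) - ((Q ^ k)⁻¹ - 1) * (1 - Y * Q ^ k)) *
      racCoef Q Y d₁ d₂ d₃ v k := by
  have hs : Q ^ k ≠ 0 := pow_ne_zero _ hQ
  rw [qPoch_succ] at h₁ h₂ h₃ h₄
  rw [racCoef, racCoef, qPair_succ, qPoch_succ, qPoch_succ, qPoch_succ, qPoch_succ, pow_succ Q k]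
  obtain ⟨a1, b1⟩ := mul_ne_zero_iff.1 h₁
  obtain ⟨a2, b2⟩ := mul_ne_zero_iff.1 h₂
  obtain ⟨a3, b3⟩ := mul_ne_zero_iff.1 h₃
  obtain ⟨a4, b4⟩ := mul_ne_zero_iff.1 h₄
  generalize Q ^ k = s at *
  generalize qPair Q Y v k = p at *
  generalize qPoch d₁ Q k = p₁ at *
  generalize qPoch d₂ Q k = p₂ at *
  generalize qPoch d₃ Q k = p₃ at *
  generalize qPoch Q Q k = p₄ at *
  clear h₁ h₂ h₃ h₄
  generalize he1 : 1 - d₁ * s = e₁ at *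
  generalize he2 : 1 - d₂ * s = e₂ at *
  generalize he3 : 1 - d₃ * s = e₃ at *
  generalize he4 : 1 - Q * s = e₄ at *
  field_simp
  subst he4
  ring

/-- The difference equation of the `q`-Racah functions. -/
lemma AWCoef.apply_rac {Q X Y d₁ d₂ d₃ w u₀ d₀ v : ℂ} {n : ℕ}
    (h : AWCoef Q X d₂ d₃ w u₀ d₀) (hQ : Q ≠ 0) (hX : X ≠ 0) (hw : w ≠ 0) (hv : v ≠ 0)
    (hY : d₁ * d₂ * d₃ = X * Y * Q) (hN : qPair Q Y v (n + 1) = 0)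
    (h₁ : ∀ k ≤ n, qPoch d₁ Q k ≠ 0) (h₂ : ∀ k ≤ n, qPoch d₂ Q k ≠ 0)
    (h₃ : ∀ k ≤ n, qPoch d₃ Q k ≠ 0) (h₄ : ∀ k ≤ n, qPoch Q Q k ≠ 0) :
    u₀ * (1 - d₁ * w) * (rac Q X Y d₁ d₂ d₃ n (Q * w) v - rac Q X Y d₁ d₂ d₃ n w v) +
        d₀ * (X * w - d₁) * (rac Q X Y d₁ d₂ d₃ n (w / Q) v - rac Q X Y d₁ d₂ d₃ n w v) =
      (v⁻¹ - 1) * (1 - Y * v) * rac Q X Y d₁ d₂ d₃ n w v := by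
  have hY' : d₁ * d₂ * d₃ / (X * Q) = Y := by rw [hY]; field_simp
  -- The eigenvalue equation for the series truncated at `m` holds up to one boundary term, because
  -- the bidiagonal contributions telescope.
  have key : ∀ m ≤ n,
      u₀ * (1 - d₁ * w) * (rac Q X Y d₁ d₂ d₃ m (Q * w) v - rac Q X Y d₁ d₂ d₃ m w v) +
        d₀ * (X * w - d₁) * (rac Q X Y d₁ d₂ d₃ m (w / Q) v - rac Q X Y d₁ d₂ d₃ m w v) =
      (v⁻¹ - 1) * (1 - Y * v) * rac Q X Y d₁ d₂ d₃ m w v -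
        ((v⁻¹ - 1) * (1 - Y * v) - ((Q ^ m)⁻¹ - 1) * (1 - Y * Q ^ m)) *
          racCoef Q Y d₁ d₂ d₃ v m * qPair Q X w m := by
    intro m
    induction m with
    | zero => intro _; simp [rac, qPair_zero]
    | succ m ih =>
      intro hm
      have e := h.apply_qPair hQ hX hw d₁ m
      rw [hY'] at e
      have r := racCoef_succ (Y := Y) hQ hv (h₁ _ hm) (h₂ _ hm) (h₃ _ hm) (h₄ _ hm)
      have i := ih (by omega)
      simp only [rac] at i ⊢
      rw [Finset.sum_range_succ _ (m + 1), Finset.sum_range_succ _ (m + 1),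
        Finset.sum_range_succ _ (m + 1)]
      linear_combination i + racCoef Q Y d₁ d₂ d₃ v (m + 1) * e + qPair Q X w m * r
  rw [key n le_rfl, sub_eq_self]
  -- `λ(v) - λ(Q^n)` times the `n`-th product is, up to a unit, the `(n+1)`-st product, which
  -- vanishes by `hN`.
  have : ((v⁻¹ - 1) * (1 - Y * v) - ((Q ^ n)⁻¹ - 1) * (1 - Y * Q ^ n)) * qPair Q Y v n = 0 := by
    have hs : Q ^ n ≠ 0 := pow_ne_zero _ hQ
    rw [qPair_succ] at hN
    trans -(Q ^ n)⁻¹ * ((1 - v⁻¹ * Q ^ n) * (1 - Y * v * Q ^ n) * qPair Q Y v n)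
    · field_simp
      ring
    · rw [hN, mul_zero]
  rw [racCoef]
  linear_combination Q ^ n / (qPoch d₁ Q n * qPoch d₂ Q n * qPoch d₃ Q n * qPoch Q Q n) *
    qPair Q X w n * this

/-- The terms of the terminating very-well-poised series `₆φ₅`, with one of the parameters given
by the homogeneous coordinates `γ / δ`. -/
def vwpTerm (Q a b γ δ : ℂ) (N k : ℕ) : ℂ :=
  qPoch a Q k * qPoch b Q k * (∏ j ∈ Finset.range k, (δ - γ * Q ^ j)) * qPoch (Q ^ N)⁻¹ Q k /
    (qPoch Q Q k * qPoch (a * Q / b) Q k * (∏ j ∈ Finset.range k, (γ - a * Q ^ (j + 1) * δ)) *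
      qPoch (a * Q ^ (N + 1)) Q k) * ((1 - a * Q ^ (2 * k)) / (1 - a)) *
    (a * Q ^ (N + 1) / b) ^ k


section VeryWellPoised

variable {Q a b γ δ : ℂ}

/-- The ratio of consecutive terms, arranged as an equality of two flows: the outgoing one at `k`
and the incoming one at `k + 1`. These are the two halves of the right side of `vwp_certificate`,
and the same relation yields detailed balance. -/
lemma vwpTerm_succ {N k : ℕ} (h₀ : 1 - a * (Q ^ k) ^ 2 ≠ 0)
    (h₀' : 1 - a * (Q ^ (k + 1)) ^ 2 ≠ 0) (h₁ : 1 - Q ^ (k + 1) ≠ 0)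
    (h₂ : 1 - a * Q ^ (k + 1) / b ≠ 0) (h₃ : γ - a * Q ^ (k + 1) * δ ≠ 0)
    (h₅ : 1 - Q ^ k * (Q ^ N)⁻¹ ≠ 0) :
    vwpTerm Q a b γ δ N (k + 1) * ((1 - Q ^ (k + 1)) * (1 - a * Q ^ (k + 1) / b) *
      (γ - a * Q ^ (k + 1) * δ) / ((1 - a * (Q ^ (k + 1)) ^ 2) * (1 - Q ^ k * (Q ^ N)⁻¹))) =
    vwpTerm Q a b γ δ N k * (a * Q ^ (N + 1) / b * (1 - a * Q ^ k) * (1 - b * Q ^ k) *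
      (δ - γ * Q ^ k) / ((1 - a * Q ^ (N + 1) * Q ^ k) * (1 - a * (Q ^ k) ^ 2))) := by
  have e₁ : 1 - Q * Q ^ k ≠ 0 := by rwa [pow_succ'] at h₁
  have e₂ : 1 - a * Q / b * Q ^ k ≠ 0 := by
    rwa [show a * Q / b * Q ^ k = a * Q ^ (k + 1) / b by ring]
  rw [vwpTerm, vwpTerm, qPoch_succ, qPoch_succ, qPoch_succ, qPoch_succ, qPoch_succ, qPoch_succ,
    Finset.prod_range_succ, Finset.prod_range_succ]
  rw [show 1 - a * Q ^ (k + 1) / b = 1 - a * Q / b * Q ^ k by ring,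
    show 1 - Q ^ (k + 1) = 1 - Q * Q ^ k by ring,
    show a * Q ^ (2 * (k + 1)) = a * (Q ^ (k + 1)) ^ 2 by ring,
    show a * Q ^ (2 * k) = a * (Q ^ k) ^ 2 by ring,
    show (Q ^ N)⁻¹ * Q ^ k = Q ^ k * (Q ^ N)⁻¹ by ring, pow_succ (a * Q ^ (N + 1) / b)]
  generalize 1 - a * (Q ^ (k + 1)) ^ 2 = f₁ at *
  generalize γ - a * Q ^ (k + 1) * δ = f₂ at *
  generalize 1 - Q ^ k * (Q ^ N)⁻¹ = f₃ at *
  generalize 1 - Q * Q ^ k = f₄ at *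
  generalize 1 - a * Q / b * Q ^ k = f₅ at *
  generalize 1 - a * Q ^ (N + 1) * Q ^ k = f₆ at *
  generalize 1 - a * (Q ^ k) ^ 2 = f₇ at *
  generalize a * Q ^ (N + 1) / b = f₈ at *
  generalize 1 - a * Q ^ k = f₉ at *
  generalize 1 - b * Q ^ k = g₁ at *
  generalize δ - γ * Q ^ k = g₂ at *
  generalize Finset.prod (Finset.range k) (fun j => δ - γ * Q ^ j) = p₁
  generalize Finset.prod (Finset.range k) (fun j => γ - a * Q ^ (j + 1) * δ) = p₂
  trans qPoch a Q k * qPoch b Q k * p₁ * qPoch (Q ^ N)⁻¹ Q k * (qPoch Q Q k)⁻¹ *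
    (qPoch (a * Q / b) Q k)⁻¹ * p₂⁻¹ * (qPoch (a * Q ^ (N + 1)) Q k)⁻¹ * (1 - a)⁻¹ *
    f₈ ^ k * f₈ * f₉ * g₁ * g₂ * f₆⁻¹
  · rw [← mul_one (_ * f₆⁻¹), ← mul_inv_cancel₀ e₁, ← mul_one (_ * (f₄ * f₄⁻¹)),
      ← mul_inv_cancel₀ e₂, ← mul_one (_ * (f₅ * f₅⁻¹)), ← mul_inv_cancel₀ h₃,
      ← mul_one (_ * (f₂ * f₂⁻¹)), ← mul_inv_cancel₀ h₅, ← mul_one (_ * (f₃ * f₃⁻¹)),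
      ← mul_inv_cancel₀ h₀']
    ring
  · rw [← mul_one (_ * f₆⁻¹), ← mul_inv_cancel₀ h₀]
    ring

lemma vwpTerm_succ_left {N k : ℕ} (hQ : Q ≠ 0) (h₁ : 1 - a * Q ^ (N + 1) ≠ 0)
    (h₅ : 1 - Q ^ k * (Q ^ (N + 1))⁻¹ ≠ 0) :
    vwpTerm Q a b γ δ (N + 1) k = vwpTerm Q a b γ δ N k *
      ((1 - (Q ^ (N + 1))⁻¹) * (1 - a * Q ^ (N + 1)) * Q ^ k /
        ((1 - Q ^ k * (Q ^ (N + 1))⁻¹) * (1 - a * Q ^ (N + 1) * Q ^ k))) := by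
  have e₁ : qPoch (Q ^ (N + 1))⁻¹ Q k =
      (1 - (Q ^ (N + 1))⁻¹) / (1 - Q ^ k * (Q ^ (N + 1))⁻¹) * qPoch (Q ^ N)⁻¹ Q k := by
    have := qPoch_shift (Q ^ (N + 1))⁻¹ Q k
    rw [qPoch_succ, show (Q ^ (N + 1))⁻¹ * Q = (Q ^ N)⁻¹ by rw [pow_succ]; field_simp] at this
    rw [div_mul_eq_mul_div, eq_div_iff h₅, this]; ring
  have e₂ : (qPoch (a * Q ^ (N + 1 + 1)) Q k)⁻¹ =
      (1 - a * Q ^ (N + 1)) / (1 - a * Q ^ (N + 1) * Q ^ k) * (qPoch (a * Q ^ (N + 1)) Q k)⁻¹ := by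
    have := qPoch_shift (a * Q ^ (N + 1)) Q k
    rw [qPoch_succ, mul_assoc a, ← pow_succ Q (N + 1)] at this
    rw [show qPoch (a * Q ^ (N + 1 + 1)) Q k =
      qPoch (a * Q ^ (N + 1)) Q k * (1 - a * Q ^ (N + 1) * Q ^ k) / (1 - a * Q ^ (N + 1)) by
        rw [eq_div_iff h₁, mul_comm, this]]
    rw [inv_div, mul_comm (qPoch _ _ _), ← div_div, div_eq_mul_inv]
  rw [vwpTerm, vwpTerm, e₁, div_eq_mul_inv, mul_inv, e₂,
    show a * Q ^ (N + 1 + 1) / b = a * Q ^ (N + 1) / b * Q by ring, mul_pow]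
  simp only [mul_inv, div_eq_mul_inv]
  ring

/-- A certificate in the sense of Wilf and Zeilberger, with `A = a Q^(N+1)`, `s = Q^k`, `r =
Q^(-N-1)`: the recursion in `N` expected from the product formula holds for each term up to a
difference in `k`, so it telescopes under summation. -/
lemma vwp_certificate {A s r : ℂ} (hb : b ≠ 0) (hA : 1 - A * s ≠ 0)
    (hs : 1 - s * r ≠ 0) (h₀ : 1 - a * s ^ 2 ≠ 0) (hAr : A * r = a) :
    (1 - r) * (1 - A) * s / ((1 - s * r) * (1 - A * s)) * ((1 - A / b) * (γ - A * δ)) -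
        (1 - A) * (γ - A * δ / b) =
      (1 - A) * (A / b * (1 - a * s) * (1 - b * s) * (δ - γ * s) /
          ((1 - A * s) * (1 - a * s ^ 2))) -
        (1 - A) * ((1 - s) * (1 - a * s / b) * (γ - a * s * δ) /
          ((1 - a * s ^ 2) * (1 - s * r))) := by
  subst hAr
  generalize he1 : 1 - A * s = e₁ at *
  generalize he2 : 1 - s * r = e₂ at *
  generalize he3 : 1 - A * r * s ^ 2 = e₃ at *
  field_simp
  subst he1 he2 he3
  ring

lemma vwp_partial {N : ℕ} (hQ : Q ≠ 0) (hb : b ≠ 0) (h₁ : ∀ j, Q ^ (j + 1) ≠ 1)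
    (ha : ∀ j ≤ 2 * N + 1, a * Q ^ j ≠ 1)
    (h₂ : ∀ j < N, 1 - a * Q ^ (j + 1) / b ≠ 0) (h₃ : ∀ j < N, γ - a * Q ^ (j + 1) * δ ≠ 0)
    {m : ℕ} (hm : m ≤ N) :
    ∑ k ∈ Finset.range (m + 1), (vwpTerm Q a b γ δ (N + 1) k *
        ((1 - a * Q ^ (N + 1) / b) * (γ - a * Q ^ (N + 1) * δ)) -
        vwpTerm Q a b γ δ N k * ((1 - a * Q ^ (N + 1)) * (γ - a * Q ^ (N + 1) * δ / b))) =
      vwpTerm Q a b γ δ N m * ((1 - a * Q ^ (N + 1)) * (a * Q ^ (N + 1) / b * (1 - a * Q ^ m) *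
        (1 - b * Q ^ m) * (δ - γ * Q ^ m) /
          ((1 - a * Q ^ (N + 1) * Q ^ m) * (1 - a * (Q ^ m) ^ 2)))) := by
  have hA : ∀ k ≤ N, 1 - a * Q ^ (N + 1) * Q ^ k ≠ 0 := fun k hk => by
    rw [mul_assoc, ← pow_add]; exact sub_ne_zero.2 (ha _ (by omega)).symm
  have hA0 : 1 - a * Q ^ (N + 1) ≠ 0 := sub_ne_zero.2 (ha _ (by omega)).symm
  have hs : ∀ k n, k < n → 1 - Q ^ k * (Q ^ n)⁻¹ ≠ 0 := fun k n hk h0 => by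
    obtain ⟨i, rfl⟩ := Nat.exists_eq_add_of_lt hk
    refine h₁ i ?_
    have : Q ^ k ≠ 0 := pow_ne_zero _ hQ
    have := sub_eq_zero.1 h0
    rw [add_assoc, pow_add] at this
    field_simp at this
    exact this
  have h₀ : ∀ k ≤ N, 1 - a * (Q ^ k) ^ 2 ≠ 0 := fun k hk => by
    rw [← pow_mul]; exact sub_ne_zero.2 (ha _ (by omega)).symm
  have cert : ∀ k ≤ N, _ := fun k hk => vwp_certificate (a := a) (γ := γ) (δ := δ)
    (A := a * Q ^ (N + 1)) (s := Q ^ k) (r := (Q ^ (N + 1))⁻¹) hb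
    (hA k hk) (hs k _ (by omega)) (h₀ k hk)
    (by rw [mul_assoc, mul_inv_cancel₀ (pow_ne_zero _ hQ), mul_one])
  induction m with
  | zero =>
    have c := cert 0 (by omega)
    rw [zero_add, Finset.sum_range_one, vwpTerm_succ_left hQ hA0
      (hs 0 _ (by omega))]
    simp only [pow_zero, sub_self, zero_mul, zero_div, mul_zero, sub_zero] at c ⊢
    linear_combination vwpTerm Q a b γ δ N 0 * c
  | succ m ih =>
    have c := cert (m + 1) hm
    have e := vwpTerm_succ (γ := γ) (δ := δ) (b := b) (N := N) (h₀ m (by omega)) (h₀ (m + 1) hm)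
      (sub_ne_zero.2 (h₁ m).symm) (h₂ m (by omega)) (h₃ m (by omega))
      (hs m N (by omega))
    rw [show Q ^ m * (Q ^ N)⁻¹ = Q ^ (m + 1) * (Q ^ (N + 1))⁻¹ by
      rw [pow_succ, pow_succ]; field_simp] at e
    rw [Finset.sum_range_succ, ih (by omega), vwpTerm_succ_left hQ hA0
      (hs (m + 1) _ (by omega))]
    linear_combination vwpTerm Q a b γ δ N (m + 1) * c - (1 - a * Q ^ (N + 1)) * e

/-- The summation formula for the terminating very-well-poised `₆φ₅` series. -/
theorem vwp_sum {N : ℕ} (hQ : Q ≠ 0) (hb : b ≠ 0) (h₁ : ∀ j, Q ^ (j + 1) ≠ 1)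
    (ha : ∀ j ≤ 2 * N, a * Q ^ j ≠ 1)
    (h₂ : ∀ j < N, 1 - a * Q ^ (j + 1) / b ≠ 0) (h₃ : ∀ j < N, γ - a * Q ^ (j + 1) * δ ≠ 0) :
    (∑ k ∈ Finset.range (N + 1), vwpTerm Q a b γ δ N k) *
        (qPoch (a * Q / b) Q N * ∏ j ∈ Finset.range N, (γ - a * Q ^ (j + 1) * δ)) =
      qPoch (a * Q) Q N * ∏ j ∈ Finset.range N, (γ - a * Q ^ (j + 1) * δ / b) := by
  induction N with
  | zero =>
    have : 1 - a ≠ 0 := sub_ne_zero.2 (by simpa using (ha 0 le_rfl).symm)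
    simp [vwpTerm, qPoch_zero, this]
  | succ N ih =>
    have i := ih (fun j hj => ha j (by omega)) (fun j hj => h₂ j (by omega))
      (fun j hj => h₃ j (by omega))
    have p := vwp_partial (γ := γ) (δ := δ) (N := N) hQ hb h₁ (fun j hj => ha j (by omega))
      (fun j hj => h₂ j (by omega)) (fun j hj => h₃ j (by omega)) le_rfl
    have hN : Q ^ N ≠ 0 := pow_ne_zero _ hQ
    -- The sum for `N + 1` has one term more than the sum for `N`; it cancels the boundary term left
    -- by the telescoping at `m = N`.
    have last : vwpTerm Q a b γ δ (N + 1) (N + 1) *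
        ((1 - a * Q ^ (N + 1) / b) * (γ - a * Q ^ (N + 1) * δ)) =
        -(vwpTerm Q a b γ δ N N * ((1 - a * Q ^ (N + 1)) * (a * Q ^ (N + 1) / b *
        (1 - a * Q ^ N) * (1 - b * Q ^ N) * (δ - γ * Q ^ N) /
          ((1 - a * Q ^ (N + 1) * Q ^ N) * (1 - a * (Q ^ N) ^ 2))))) := by
      have f1 : qPoch (Q ^ (N + 1))⁻¹ Q (N + 1) = (1 - (Q ^ (N + 1))⁻¹) * qPoch (Q ^ N)⁻¹ Q N := by
        rw [← qPoch_shift, show (Q ^ (N + 1))⁻¹ * Q = (Q ^ N)⁻¹ by rw [pow_succ]; field_simp]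
      have n1 : 1 - a * Q ^ (N + 1) ≠ 0 := sub_ne_zero.2 (ha _ (by omega)).symm
      have n2 : 1 - a * Q ^ (N + 1) * Q ^ N ≠ 0 := by
        rw [mul_assoc, ← pow_add]; exact sub_ne_zero.2 (ha _ (by omega)).symm
      have n3 : 1 - a * Q ^ (N + 1) * Q ^ (N + 1) ≠ 0 := by
        rw [mul_assoc, ← pow_add]; exact sub_ne_zero.2 (ha _ (by omega)).symm
      have n4 : 1 - a * (Q ^ N) ^ 2 ≠ 0 := by
        rw [← pow_mul]; exact sub_ne_zero.2 (ha _ (by omega)).symm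
      have n5 : 1 - Q ^ (N + 1) ≠ 0 := sub_ne_zero.2 (h₁ N).symm
      have n6 := h₂ N (by omega)
      have n7 := h₃ N (by omega)
      have f2 : (qPoch (a * Q ^ (N + 1 + 1)) Q (N + 1))⁻¹ =
          (1 - a * Q ^ (N + 1)) / ((1 - a * Q ^ (N + 1) * Q ^ N) *
            (1 - a * Q ^ (N + 1) * Q ^ (N + 1))) * (qPoch (a * Q ^ (N + 1)) Q N)⁻¹ := by
        have := qPoch_shift (a * Q ^ (N + 1)) Q (N + 1)
        rw [qPoch_succ (a * Q ^ (N + 1)) Q (N + 1), qPoch_succ (a * Q ^ (N + 1)) Q N,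
          mul_assoc a (Q ^ (N + 1)) Q, ← pow_succ Q (N + 1)] at this
        rw [show qPoch (a * Q ^ (N + 1 + 1)) Q (N + 1) = qPoch (a * Q ^ (N + 1)) Q N *
          (1 - a * Q ^ (N + 1) * Q ^ N) * (1 - a * Q ^ (N + 1) * Q ^ (N + 1)) /
            (1 - a * Q ^ (N + 1)) by
            rw [eq_div_iff n1, mul_comm, this]]
        rw [inv_div, mul_assoc, mul_comm (qPoch _ _ _), ← div_div, div_eq_mul_inv]
      rw [vwpTerm, vwpTerm, f1, div_eq_mul_inv, mul_inv, f2, qPoch_succ, qPoch_succ, qPoch_succ,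
        qPoch_succ, Finset.prod_range_succ, Finset.prod_range_succ,
        show a * Q / b * Q ^ N = a * Q ^ (N + 1) / b by ring,
        show a * Q ^ (N + 1 + 1) / b = a * Q ^ (N + 1) / b * Q by ring, mul_pow,
        pow_succ (a * Q ^ (N + 1) / b) N,
        show a * Q ^ (2 * (N + 1)) = a * Q ^ (N + 1) * Q ^ (N + 1) by ring,
        show a * Q ^ (2 * N) = a * (Q ^ N) ^ 2 by ring,
        show 1 - Q * Q ^ N = 1 - Q ^ (N + 1) by ring,
        show 1 - (Q ^ (N + 1))⁻¹ = -(1 - Q ^ (N + 1)) * (Q ^ (N + 1))⁻¹ by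
          have := pow_ne_zero (N + 1) hQ; field_simp; ring]
      have n8 : Q ^ (N + 1) ≠ 0 := pow_ne_zero _ hQ
      generalize 1 - a * Q ^ (N + 1) * Q ^ (N + 1) = f₁ at *
      generalize 1 - a * Q ^ (N + 1) * Q ^ N = f₂ at *
      generalize γ - a * Q ^ (N + 1) * δ = f₃ at *
      generalize 1 - a * Q ^ (N + 1) / b = f₄ at *
      generalize 1 - a * (Q ^ N) ^ 2 = f₅ at *
      generalize 1 - a * Q ^ (N + 1) = f₆ at *
      generalize 1 - Q ^ (N + 1) = f₇ at *
      generalize a * Q ^ (N + 1) / b = f₈ at *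
      generalize 1 - a * Q ^ N = f₉ at *
      generalize 1 - b * Q ^ N = g₁ at *
      generalize δ - γ * Q ^ N = g₂ at *
      generalize qPoch (a * Q ^ (N + 1)) Q N = p₃
      generalize Q ^ (N + 1) = T at *
      generalize Finset.prod (Finset.range N) (fun j => δ - γ * Q ^ j) = p₁
      generalize Finset.prod (Finset.range N) (fun j => γ - a * Q ^ (j + 1) * δ) = p₂
      trans -(qPoch a Q N * qPoch b Q N * p₁ * qPoch (Q ^ N)⁻¹ Q N * (qPoch Q Q N)⁻¹ *
        (qPoch (a * Q / b) Q N)⁻¹ * p₂⁻¹ * p₃⁻¹ * (1 - a)⁻¹ *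
        f₈ ^ N * f₈ * f₉ * g₁ * g₂ * f₆ * f₂⁻¹)
      · rw [← mul_one (_ * f₂⁻¹), ← mul_inv_cancel₀ n5, ← mul_one (_ * (f₇ * f₇⁻¹)),
          ← mul_inv_cancel₀ n6, ← mul_one (_ * (f₄ * f₄⁻¹)), ← mul_inv_cancel₀ n7,
          ← mul_one (_ * (f₃ * f₃⁻¹)), ← mul_inv_cancel₀ n3, ← mul_one (_ * (f₁ * f₁⁻¹)),
          ← mul_inv_cancel₀ n8]
        ring
      · rw [← mul_one (_ * f₂⁻¹), ← mul_inv_cancel₀ n4]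
        ring
    rw [Finset.sum_sub_distrib, ← Finset.sum_mul, ← Finset.sum_mul] at p
    rw [Finset.sum_range_succ, qPoch_succ, qPoch_succ, Finset.prod_range_succ,
      Finset.prod_range_succ]
    rw [show a * Q * Q ^ N = a * Q ^ (N + 1) by ring,
      show a * Q / b * Q ^ N = a * Q ^ (N + 1) / b by ring]
    linear_combination (qPoch (a * Q / b) Q N *
      ∏ j ∈ Finset.range N, (γ - a * Q ^ (j + 1) * δ)) * (p + last) +
      (1 - a * Q ^ (N + 1)) * (γ - a * Q ^ (N + 1) * δ / b) * i

end VeryWellPoised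

end

end BelliardSlavnov

/-! ### Polynomials in the spectral variable -/

namespace BelliardSlavnov

noncomputable section

open Polynomial in
/-- A property of polynomials that is closed under linear combinations and holds for one polynomial
of each degree up to `n` holds for all polynomials of degree at most `n`. -/
lemma polynomial_induction_of_natDegree {P : ℂ[X] → Prop} (hadd : ∀ p r, P p → P r → P (p + r))
    (hmul : ∀ a p, P p → P (C a * p)) {φ : ℕ → ℂ[X]} (hdeg : ∀ k, (φ k).natDegree = k)
    (hne : ∀ k, φ k ≠ 0) {n : ℕ} (h : ∀ k ≤ n, P (φ k)) (p : ℂ[X]) (hp : p.natDegree ≤ n) :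
    P p := by
  have lead : ∀ k, (φ k).coeff k ≠ 0 := fun k => by
    have := leadingCoeff_ne_zero.2 (hne k)
    rwa [leadingCoeff, hdeg] at this
  suffices ∀ m ≤ n, ∀ p : ℂ[X], p.natDegree ≤ m → P p from this n le_rfl p hp
  intro m
  induction m with
  | zero =>
    intro _ p hp
    have e : p = C (p.coeff 0 / (φ 0).coeff 0) * φ 0 := by
      rw [eq_C_of_natDegree_le_zero hp, eq_C_of_natDegree_le_zero (hdeg 0).le, ← C_mul]
      simp [div_mul_cancel₀ _ (lead 0)]
    rw [e]
    exact hmul _ _ (h 0 (by omega))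
  | succ m ih =>
    intro hm p hp
    set a := p.coeff (m + 1) / (φ (m + 1)).coeff (m + 1) with ha
    have e : p = (p + C (-a) * φ (m + 1)) + C a * φ (m + 1) := by simp
    rw [e]
    refine hadd _ _ (ih (by omega) _ ?_) (hmul _ _ (h _ hm))
    rw [natDegree_le_iff_coeff_eq_zero]
    intro N hN
    rw [coeff_add, coeff_C_mul]
    rcases (show m + 1 ≤ N from hN).eq_or_lt with rfl | hN'
    · rw [ha, neg_mul, div_mul_cancel₀ _ (lead _), add_neg_cancel]
    · rw [coeff_eq_zero_of_natDegree_lt (by omega), coeff_eq_zero_of_natDegree_lt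
        (by rw [hdeg]; omega)]
      simp

/-- The uniformization `τ = z w + (z w)⁻¹` of the spectral parameter. -/
def tau (z w : ℂ) : ℂ := z * w + (z * w)⁻¹

/-- `tau z s - tau z t` factors into `s - t` and `z² s t - 1`. This splits every coincidence of
eigenvalues into a root-of-unity condition on `q` and a condition excluded by `spec`. -/
lemma tau_eq_tau {z s t : ℂ} (hz : z ≠ 0) (hs : s ≠ 0) (ht : t ≠ 0) (h : tau z s = tau z t) :
    s = t ∨ z ^ 2 * (s * t) = 1 := by
  rw [tau, tau] at h
  have : (s - t) * (z ^ 2 * (s * t) - 1) = 0 := by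
    field_simp at h
    linear_combination h
  rcases mul_eq_zero.1 this with h1 | h1
  · exact Or.inl (sub_eq_zero.1 h1)
  · exact Or.inr (sub_eq_zero.1 h1)

/-- The product `qPair Q (z²) w k` as a polynomial in `tau z w`. -/
def pairPoly (Q z : ℂ) (k : ℕ) : Polynomial ℂ :=
  ∏ j ∈ Finset.range k,
    (Polynomial.C (-(Q ^ j * z)) * Polynomial.X + Polynomial.C (1 + z ^ 2 * Q ^ (2 * j)))

section pairPoly

open Polynomial

variable {Q z : ℂ}

lemma eval_pairPoly (hz : z ≠ 0) {w : ℂ} (hw : w ≠ 0) (k : ℕ) :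
    (pairPoly Q z k).eval (tau z w) = qPair Q (z ^ 2) w k := by
  rw [pairPoly, eval_prod, qPair, qPoch, qPoch, ← Finset.prod_mul_distrib]
  refine Finset.prod_congr rfl fun j _ => ?_
  simp only [eval_add, eval_mul, eval_C, eval_X, tau]
  field_simp
  ring

/-- The roots are the first `k` grid points. In degree `n + 1` this is the nodal polynomial of the
whole grid, the only obstruction to preserving degree `n` for the interchanged operator. -/
lemma eval_pairPoly_eq_prod (hQ : Q ≠ 0) (hz : z ≠ 0) (t : ℂ) (k : ℕ) :
    (pairPoly Q z k).eval t =
      (∏ j ∈ Finset.range k, -(Q ^ j * z)) * ∏ j ∈ Finset.range k, (t - tau z (Q ^ j)) := by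
  rw [pairPoly, eval_prod, ← Finset.prod_mul_distrib]
  refine Finset.prod_congr rfl fun j _ => ?_
  have : Q ^ j ≠ 0 := pow_ne_zero _ hQ
  simp only [eval_add, eval_mul, eval_C, eval_X, tau]
  field_simp
  ring

lemma natDegree_pairPoly (hQ : Q ≠ 0) (hz : z ≠ 0) (k : ℕ) : (pairPoly Q z k).natDegree = k := by
  have h : ∀ j, -(Q ^ j * z) ≠ 0 := fun j => neg_ne_zero.2 (mul_ne_zero (pow_ne_zero _ hQ) hz)
  rw [pairPoly, natDegree_prod]
  · rw [Finset.sum_congr rfl fun j _ => natDegree_linear (h j)]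
    simp
  · intro j _ h0
    have := natDegree_linear (b := 1 + z ^ 2 * Q ^ (2 * j)) (h j)
    rw [h0] at this
    simp at this

lemma pairPoly_ne_zero (hQ : Q ≠ 0) (hz : z ≠ 0) (k : ℕ) : pairPoly Q z k ≠ 0 := by
  rcases k with _ | k
  · simp [pairPoly]
  · intro h
    have := natDegree_pairPoly hQ hz (k + 1)
    rw [h] at this
    simp at this

lemma coeff_pairPoly (hQ : Q ≠ 0) (hz : z ≠ 0) (k : ℕ) :
    (pairPoly Q z k).coeff k = ∏ j ∈ Finset.range k, -(Q ^ j * z) := by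
  have h : ∀ j, -(Q ^ j * z) ≠ 0 := fun j => neg_ne_zero.2 (mul_ne_zero (pow_ne_zero _ hQ) hz)
  have e : (pairPoly Q z k).coeff k = (pairPoly Q z k).leadingCoeff := by
    rw [leadingCoeff, natDegree_pairPoly hQ hz]
  rw [e, pairPoly, leadingCoeff_prod]
  exact Finset.prod_congr rfl fun j _ => leadingCoeff_linear (h j)

/-- The Askey–Wilson operator maps polynomials of degree at most `n` to such polynomials. -/
lemma exists_poly_AWCoef (hQ : Q ≠ 0) (hz : z ≠ 0) (d₁ d₂ d₃ : ℂ) {n : ℕ} (p : ℂ[X])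
    (hp : p.natDegree ≤ n) :
    ∃ r : ℂ[X], r.natDegree ≤ n ∧ ∀ w u₀ d₀, w ≠ 0 → AWCoef Q (z ^ 2) d₂ d₃ w u₀ d₀ →
      u₀ * (1 - d₁ * w) * (p.eval (tau z (Q * w)) - p.eval (tau z w)) +
        d₀ * (z ^ 2 * w - d₁) * (p.eval (tau z (w / Q)) - p.eval (tau z w)) =
      r.eval (tau z w) := by
  have hX : z ^ 2 ≠ 0 := pow_ne_zero _ hz
  refine polynomial_induction_of_natDegree (P := fun p => ∃ r : ℂ[X], r.natDegree ≤ n ∧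
    ∀ w u₀ d₀, w ≠ 0 → AWCoef Q (z ^ 2) d₂ d₃ w u₀ d₀ →
      u₀ * (1 - d₁ * w) * (p.eval (tau z (Q * w)) - p.eval (tau z w)) +
        d₀ * (z ^ 2 * w - d₁) * (p.eval (tau z (w / Q)) - p.eval (tau z w)) =
      r.eval (tau z w)) ?_ ?_ (natDegree_pairPoly hQ hz) (pairPoly_ne_zero hQ hz) ?_ p hp
  · rintro p₁ p₂ ⟨r₁, hr₁, h₁⟩ ⟨r₂, hr₂, h₂⟩
    refine ⟨r₁ + r₂, natDegree_add_le_of_degree_le hr₁ hr₂, fun w u₀ d₀ hw h => ?_⟩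
    simp only [eval_add]
    linear_combination h₁ w u₀ d₀ hw h + h₂ w u₀ d₀ hw h
  · rintro a p ⟨r, hr, h'⟩
    refine ⟨C a * r, (natDegree_C_mul_le _ _).trans hr, fun w u₀ d₀ hw h => ?_⟩
    simp only [eval_mul, eval_C]
    linear_combination a * h' w u₀ d₀ hw h
  · rintro (_ | k) hk
    · exact ⟨0, by simp, fun w u₀ d₀ _ _ => by simp [pairPoly]⟩
    · refine ⟨C (((Q ^ (k + 1))⁻¹ - 1) * (1 - d₁ * d₂ * d₃ / (z ^ 2 * Q) * Q ^ (k + 1))) *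
          pairPoly Q z (k + 1) + C ((1 - (Q ^ (k + 1))⁻¹) *
          ((1 - d₁ * Q ^ k) * (1 - d₂ * Q ^ k) * (1 - d₃ * Q ^ k))) * pairPoly Q z k,
        natDegree_add_le_of_degree_le ?_ ?_, fun w u₀ d₀ hw h => ?_⟩
      · exact (natDegree_C_mul_le _ _).trans (by rw [natDegree_pairPoly hQ hz]; omega)
      · exact (natDegree_C_mul_le _ _).trans (by rw [natDegree_pairPoly hQ hz]; omega)
      · simp only [eval_add, eval_mul, eval_C]
        rw [eval_pairPoly hz hw, eval_pairPoly hz hw, eval_pairPoly hz (mul_ne_zero hQ hw),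
          eval_pairPoly hz (div_ne_zero hw hQ), h.apply_qPair hQ hX hw]

/-- The Askey–Wilson operator with one interchanged factor maps polynomials of degree at most `n`
to such polynomials, up to a multiple of the nodal polynomial. -/
lemma exists_poly_AWCoef' (hQ : Q ≠ 0) (hz : z ≠ 0) (d₁ d₂ d₃ : ℂ) {n : ℕ} (p : ℂ[X])
    (hp : p.natDegree ≤ n) :
    ∃ r : ℂ[X], r.natDegree ≤ n ∧ ∀ w u₀ d₀, w ≠ 0 → AWCoef Q (z ^ 2) d₂ d₃ w u₀ d₀ →
      u₀ * (1 - d₁ / (z ^ 2 * Q * w)) * p.eval (tau z (Q * w)) +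
        d₀ * z ^ 2 * w * (1 - d₁ * w / Q) * p.eval (tau z (w / Q)) -
        (u₀ * (1 - d₁ * w) + d₀ * (z ^ 2 * w - d₁)) * p.eval (tau z w) =
      r.eval (tau z w) + -(d₁ / (z * Q ^ (n + 1))) * p.coeff n *
        ∏ j ∈ Finset.range (n + 1), (tau z w - tau z (Q ^ j)) := by
  have hX : z ^ 2 ≠ 0 := pow_ne_zero _ hz
  refine polynomial_induction_of_natDegree (P := fun p => ∃ r : ℂ[X], r.natDegree ≤ n ∧
    ∀ w u₀ d₀, w ≠ 0 → AWCoef Q (z ^ 2) d₂ d₃ w u₀ d₀ →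
      u₀ * (1 - d₁ / (z ^ 2 * Q * w)) * p.eval (tau z (Q * w)) +
        d₀ * z ^ 2 * w * (1 - d₁ * w / Q) * p.eval (tau z (w / Q)) -
        (u₀ * (1 - d₁ * w) + d₀ * (z ^ 2 * w - d₁)) * p.eval (tau z w) =
      r.eval (tau z w) + -(d₁ / (z * Q ^ (n + 1))) * p.coeff n *
        ∏ j ∈ Finset.range (n + 1), (tau z w - tau z (Q ^ j)))
    ?_ ?_ (natDegree_pairPoly hQ hz) (pairPoly_ne_zero hQ hz) ?_ p hp
  · rintro p₁ p₂ ⟨r₁, hr₁, h₁⟩ ⟨r₂, hr₂, h₂⟩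
    refine ⟨r₁ + r₂, natDegree_add_le_of_degree_le hr₁ hr₂, fun w u₀ d₀ hw h => ?_⟩
    simp only [eval_add, coeff_add]
    linear_combination h₁ w u₀ d₀ hw h + h₂ w u₀ d₀ hw h
  · rintro a p ⟨r, hr, h'⟩
    refine ⟨C a * r, (natDegree_C_mul_le _ _).trans hr, fun w u₀ d₀ hw h => ?_⟩
    simp only [eval_mul, eval_C, coeff_C_mul]
    linear_combination a * h' w u₀ d₀ hw h
  · intro k hk
    obtain ⟨β, r, hr, hk'⟩ : ∃ β, ∃ r : ℂ[X], r.natDegree ≤ n ∧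
        ∀ w u₀ d₀, w ≠ 0 → AWCoef Q (z ^ 2) d₂ d₃ w u₀ d₀ →
        u₀ * (1 - d₁ / (z ^ 2 * Q * w)) * qPair Q (z ^ 2) (Q * w) k +
        d₀ * z ^ 2 * w * (1 - d₁ * w / Q) * qPair Q (z ^ 2) (w / Q) k -
        (u₀ * (1 - d₁ * w) + d₀ * (z ^ 2 * w - d₁)) * qPair Q (z ^ 2) w k =
        d₁ / (z ^ 2 * Q * (Q ^ k) ^ 2) * qPair Q (z ^ 2) w (k + 1) +
          β * qPair Q (z ^ 2) w k + r.eval (tau z w) := by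
      rcases k with _ | k
      · refine ⟨- d₁ * d₂ * d₃ / (z ^ 2 * Q) + d₁ / (z ^ 2 * Q) * (d₂ + d₃ - 1), 0, by simp,
          fun w u₀ d₀ hw h => ?_⟩
        have := h.apply_one' hQ hX hw d₁
        simp only [qPair_zero, mul_one, zero_add, pow_zero, one_pow, eval_zero, add_zero] at this ⊢
        exact this
      · refine ⟨(Q ^ (k + 1))⁻¹ - 1 - d₁ * d₂ * d₃ / (z ^ 2 * Q) + d₁ / (z ^ 2 * Q) *
          ((d₂ + d₃ + Q) / Q ^ (k + 1) - (Q + 1) / (Q ^ (k + 1)) ^ 2),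
          C ((1 - (Q ^ (k + 1))⁻¹) * ((1 - d₂ * Q ^ k) * (1 - d₃ * Q ^ k) *
          (1 - d₁ / (z ^ 2 * Q ^ (k + 1))))) * pairPoly Q z k,
          (natDegree_C_mul_le _ _).trans (by rw [natDegree_pairPoly hQ hz]; omega),
          fun w u₀ d₀ hw h => ?_⟩
        simp only [eval_mul, eval_C]
        rw [eval_pairPoly hz hw]
        exact h.apply_qPair' hQ hX hw d₁ k
    rcases hk.eq_or_lt with rfl | hlt
    · refine ⟨C β * pairPoly Q z k + r, natDegree_add_le_of_degree_le
        ((natDegree_C_mul_le _ _).trans (natDegree_pairPoly hQ hz k).le) hr,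
        fun w u₀ d₀ hw h => ?_⟩
      simp only [eval_add, eval_mul, eval_C]
      rw [eval_pairPoly hz hw, eval_pairPoly hz (mul_ne_zero hQ hw),
          eval_pairPoly hz (div_ne_zero hw hQ), hk' w u₀ d₀ hw h, coeff_pairPoly hQ hz,
          ← eval_pairPoly hz hw (k + 1), eval_pairPoly_eq_prod hQ hz,
          Finset.prod_range_succ (fun j => -(Q ^ j * z))]
      have : Q ^ k ≠ 0 := pow_ne_zero _ hQ
      -- Passing from the product of index `k + 1` to the monic nodal polynomial costs the last
      -- leading factor `-(Q^k z)`; the other factors form the leading coefficient of the product of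
      -- index `k`.
      rw [show d₁ / (z * Q ^ (k + 1)) = d₁ / (z ^ 2 * Q * (Q ^ k) ^ 2) * (Q ^ k * z) by
        rw [pow_succ]; field_simp]
      ring
    · refine ⟨C (d₁ / (z ^ 2 * Q * (Q ^ k) ^ 2)) * pairPoly Q z (k + 1) +
          C β * pairPoly Q z k + r, natDegree_add_le_of_degree_le
          (natDegree_add_le_of_degree_le ((natDegree_C_mul_le _ _).trans
          (by rw [natDegree_pairPoly hQ hz]; omega)) ((natDegree_C_mul_le _ _).trans
          (by rw [natDegree_pairPoly hQ hz]; omega))) hr, fun w u₀ d₀ hw h => ?_⟩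
      simp only [eval_add, eval_mul, eval_C]
      rw [coeff_eq_zero_of_natDegree_lt (by rw [natDegree_pairPoly hQ hz]; omega),
        eval_pairPoly hz hw, eval_pairPoly hz hw, eval_pairPoly hz (mul_ne_zero hQ hw),
        eval_pairPoly hz (div_ne_zero hw hQ), hk' w u₀ d₀ hw h]
      ring

/-- Lagrange interpolation with the omitted node written through `succAbove`, the form in which the
products of `g` and the families `omit1` occur in the linear system. -/
lemma eval_eq_sum_lagrange {n : ℕ} {r : ℂ[X]} (hr : r.natDegree ≤ n) {v : Fin (n + 1) → ℂ}
    (hv : Function.Injective v) (t : ℂ) :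
    r.eval t = ∑ k, r.eval (v k) * ((∏ i : Fin n, (v k - v (k.succAbove i))⁻¹) *
      ∏ i : Fin n, (t - v (k.succAbove i))) := by
  have h := Lagrange.eq_interpolate (s := Finset.univ) (v := v) (f := r) hv.injOn
    (by rw [Finset.card_univ, Fintype.card_fin]
        exact degree_le_natDegree.trans_lt (by exact_mod_cast Nat.lt_succ_of_le hr))
  conv_lhs => rw [h]
  rw [Lagrange.interpolate_apply, eval_finsetSum]
  refine Finset.sum_congr rfl fun k _ => ?_
  rw [eval_mul, eval_C, Lagrange.basis, eval_prod, ← Finset.prod_mul_distrib]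
  congr 1
  rw [Fin.univ_succAbove n k, Finset.cons_eq_insert, Finset.erase_insert (by simp),
    Finset.prod_map]
  refine Finset.prod_congr rfl fun i _ => ?_
  simp [Lagrange.basisDivisor]

end pairPoly

end

end BelliardSlavnov

/-! ### The operator on the finite grid: detailed balance and summation by parts -/

namespace BelliardSlavnov

noncomputable section

/-- The common part of the coefficients `B` of the Askey–Wilson operator at `w = Q^M`. -/
def awU (Q X d₂ : ℂ) (n M : ℕ) : ℂ :=
  if M = n then 0
  else if M = 0 then (1 - d₂) * (1 - (Q ^ n)⁻¹) / (1 - X * Q)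
  else (1 - X * Q ^ M) * (1 - d₂ * Q ^ M) * (1 - (Q ^ n)⁻¹ * Q ^ M) /
    ((1 - X * (Q ^ M) ^ 2) * (1 - X * Q * (Q ^ M) ^ 2))

/-- The common part of the coefficients `D` of the Askey–Wilson operator at `w = Q^M`. -/
def awD (Q X d₂ : ℂ) (n M : ℕ) : ℂ :=
  if M = 0 then 0
  else if M = n then (Q ^ M - 1) * (X * Q ^ M - d₂) / (X * Q ^ M * (X * (Q ^ M) ^ 2 - Q))
  else (1 - Q ^ M) * (X * Q ^ M - d₂) * (X * Q ^ M - (Q ^ n)⁻¹) /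
    (X * (1 - X * (Q ^ M) ^ 2) * (X * (Q ^ M) ^ 2 - Q))

section

variable {Q X d₂ : ℂ} {n M : ℕ}

lemma awU_top : awU Q X d₂ n n = 0 := by simp [awU]

lemma awD_zero : awD Q X d₂ n 0 = 0 := by simp [awD]

/-- The hypothesis leaves `X = 1` and `X Q^(2n) = 1` open. The factors that would then vanish occur
only at the two ends of the grid, where they cancel against numerators; this is why the end values
are defined separately. -/
lemma AWCoef_node (hQ : Q ≠ 0) (hX : ∀ k, 1 ≤ k → k < 2 * n → X * Q ^ k ≠ 1) (hM : M ≤ n) :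
    AWCoef Q X d₂ (Q ^ n)⁻¹ (Q ^ M) (awU Q X d₂ n M) (awD Q X d₂ n M) := by
  have sub : ∀ k, 1 ≤ k → k < 2 * n → X * Q ^ (k + 1) - Q ≠ 0 := fun k h1 h2 h => by
    refine hX k h1 h2 (mul_right_cancel₀ hQ ?_)
    linear_combination h
  rcases Nat.eq_zero_or_pos M with rfl | hM0
  · rcases Nat.eq_zero_or_pos n with rfl | hn
    · right; right; right; simp [awU, awD]
    · right; left
      refine ⟨by simp, ?_, by simp [awU, hn.ne], by simp [awD]⟩
      have := hX 1 le_rfl (by omega)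
      rw [pow_one] at this
      exact sub_ne_zero.2 this.symm
  · rcases hM.eq_or_lt with rfl | hlt
    · right; right; left
      refine ⟨rfl, ?_, awU_top, by simp [awD, hM0.ne']⟩
      have := sub (2 * M - 1) (by omega) (by omega)
      rwa [show 2 * M - 1 + 1 = M * 2 by omega, pow_mul] at this
    · left
      refine ⟨?_, ?_, ?_, by simp [awU, hM0.ne', hlt.ne], by simp [awD, hM0.ne', hlt.ne]⟩
      · rw [← pow_mul]; exact sub_ne_zero.2 (hX _ (by omega) (by omega)).symm
      · rw [← pow_mul, mul_assoc, ← pow_succ']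
        exact sub_ne_zero.2 (hX _ (by omega) (by omega)).symm
      · have := sub (2 * M - 1) (by omega) (by omega)
        rwa [show 2 * M - 1 + 1 = M * 2 by omega, pow_mul] at this

/-- Detailed balance between the very-well-poised weights and the Askey–Wilson coefficients. -/
lemma vwpTerm_balance {d₁ : ℂ} {k : ℕ} (hQ : Q ≠ 0) (hX0 : X ≠ 0) (hd₂ : d₂ ≠ 0)
    (hQ1 : ∀ j, Q ^ (j + 1) ≠ 1) (hX : ∀ j ≤ 2 * n, X * Q ^ j ≠ 1) (hk : k < n)
    (h₁ : d₁ - X * Q ^ (k + 1) ≠ 0) (h₂ : 1 - X * Q ^ (k + 1) / d₂ ≠ 0) :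
    vwpTerm Q X d₂ d₁ 1 n k * (awU Q X d₂ n k * (1 - d₁ * Q ^ k)) =
      vwpTerm Q X d₂ d₁ 1 n (k + 1) * (awD Q X d₂ n (k + 1) * (X * Q ^ (k + 1) - d₁)) := by
  have s1 : ∀ j ≤ 2 * n, 1 - X * Q ^ j ≠ 0 := fun j hj => sub_ne_zero.2 (hX j hj).symm
  have a0 : 1 - X * (Q ^ k) ^ 2 ≠ 0 := by rw [← pow_mul]; exact s1 _ (by omega)
  have a1 : 1 - X * (Q ^ (k + 1)) ^ 2 ≠ 0 := by rw [← pow_mul]; exact s1 _ (by omega)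
  have a2 : 1 - X * Q * (Q ^ k) ^ 2 ≠ 0 := by
    rw [← pow_mul, mul_assoc, ← pow_succ']; exact s1 _ (by omega)
  have a3 : 1 - X * Q ^ (n + 1) * Q ^ k ≠ 0 := by
    rw [mul_assoc, ← pow_add]; exact s1 _ (by omega)
  have a4 : 1 - Q ^ k * (Q ^ n)⁻¹ ≠ 0 := fun h0 => by
    obtain ⟨i, rfl⟩ := Nat.exists_eq_add_of_lt hk
    refine hQ1 i ?_
    have : Q ^ k ≠ 0 := pow_ne_zero _ hQ
    have := sub_eq_zero.1 h0
    rw [add_assoc, pow_add] at this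
    field_simp at this
    exact this
  have hs : Q ^ k ≠ 0 := pow_ne_zero _ hQ
  have hn : Q ^ n ≠ 0 := pow_ne_zero _ hQ
  -- Here `X Q^j ≠ 1` also for `j = 0` and `j = 2n`, so the cancelled end values agree with the
  -- generic formula and the ends need no separate treatment.
  have eU : awU Q X d₂ n k = (1 - X * Q ^ k) * (1 - d₂ * Q ^ k) * (1 - Q ^ k * (Q ^ n)⁻¹) /
      ((1 - X * (Q ^ k) ^ 2) * (1 - X * Q * (Q ^ k) ^ 2)) := by
    rw [awU, if_neg hk.ne]
    rcases Nat.eq_zero_or_pos k with rfl | h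
    · have := s1 0 (by omega)
      simp only [pow_zero, mul_one, one_pow, one_mul, if_true] at this a2 ⊢
      field_simp
    · rw [if_neg h.ne', mul_comm (Q ^ n)⁻¹]
  have eD : awD Q X d₂ n (k + 1) = (1 - Q ^ (k + 1)) * (X * Q ^ (k + 1) - d₂) *
      (X * Q ^ (k + 1) - (Q ^ n)⁻¹) /
      (X * (1 - X * (Q ^ (k + 1)) ^ 2) * (-Q * (1 - X * Q * (Q ^ k) ^ 2))) := by
    rw [awD, if_neg (Nat.succ_ne_zero k)]
    rw [show -Q * (1 - X * Q * (Q ^ k) ^ 2) = X * (Q ^ (k + 1)) ^ 2 - Q by ring]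
    rcases (show k + 1 ≤ n from hk).eq_or_lt with rfl | h
    · rw [if_pos rfl]
      have : X * (Q ^ (k + 1)) ^ 2 - Q ≠ 0 := by
        rw [show X * (Q ^ (k + 1)) ^ 2 - Q = -Q * (1 - X * Q * (Q ^ k) ^ 2) by ring]
        exact mul_ne_zero (neg_ne_zero.2 hQ) a2
      generalize Q ^ (k + 1) = w at *
      generalize he : X * w ^ 2 - Q = e at *
      generalize he' : 1 - X * w ^ 2 = e' at *
      field_simp
      subst he'
      ring
    · rw [if_neg h.ne]
  have e := vwpTerm_succ (δ := 1) (N := n) a0 a1 (sub_ne_zero.2 (hQ1 k).symm) h₂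
    (by rwa [mul_one]) a4
  rw [eU, eD]
  have t : ∀ c : ℂ, c * (vwpTerm Q X d₂ d₁ 1 n (k + 1) * ((1 - Q ^ (k + 1)) *
      (1 - X * Q ^ (k + 1) / d₂) * (d₁ - X * Q ^ (k + 1) * 1) /
      ((1 - X * (Q ^ (k + 1)) ^ 2) * (1 - Q ^ k * (Q ^ n)⁻¹)))) =
    c * (vwpTerm Q X d₂ d₁ 1 n k * (X * Q ^ (n + 1) / d₂ * (1 - X * Q ^ k) * (1 - d₂ * Q ^ k) *
      (1 - d₁ * Q ^ k) / ((1 - X * Q ^ (n + 1) * Q ^ k) * (1 - X * (Q ^ k) ^ 2)))) :=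
    fun c => by rw [e]
  have t' := t ((1 - Q ^ k * (Q ^ n)⁻¹) * (1 - X * Q ^ (n + 1) * Q ^ k) * d₂ /
    (X * Q ^ (n + 1) * (1 - X * Q * (Q ^ k) ^ 2)))
  generalize vwpTerm Q X d₂ d₁ 1 n k = t0 at *
  generalize vwpTerm Q X d₂ d₁ 1 n (k + 1) = t1 at *
  clear e t eU eD
  rw [pow_succ Q k, pow_succ Q n] at *
  trans (1 - Q ^ k * (Q ^ n)⁻¹) * (1 - X * (Q ^ n * Q) * Q ^ k) * d₂ /
      (X * (Q ^ n * Q) * (1 - X * Q * (Q ^ k) ^ 2)) * (t0 * (X * (Q ^ n * Q) / d₂ *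
      (1 - X * Q ^ k) * (1 - d₂ * Q ^ k) * (1 - d₁ * Q ^ k) /
      ((1 - X * (Q ^ n * Q) * Q ^ k) * (1 - X * (Q ^ k) ^ 2))))
  · clear t'
    generalize 1 - X * (Q ^ n * Q) * Q ^ k = f1 at *
    generalize 1 - X * (Q ^ k) ^ 2 = f2 at *
    generalize 1 - X * Q * (Q ^ k) ^ 2 = f3 at *
    generalize 1 - Q ^ k * (Q ^ n)⁻¹ = f4 at *
    field_simp
  · rw [← t']
    clear t'
    generalize he4 : 1 - Q ^ k * (Q ^ n)⁻¹ = f4 at *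
    generalize he2 : 1 - X * (Q ^ k * Q) ^ 2 = f2 at *
    generalize he3 : 1 - X * Q * (Q ^ k) ^ 2 = f3 at *
    generalize Q ^ k = s at *
    generalize Q ^ n = r at *
    field_simp
    ring

end

/-- Summation by parts: a tridiagonal operator is symmetric with respect to a weight that satisfies
detailed balance. -/
lemma sum_by_parts {k up dn : ℕ → ℂ} {n : ℕ} (hu : up n = 0) (hd : dn 0 = 0)
    (hb : ∀ N < n, k N * up N = k (N + 1) * dn (N + 1)) (f g : ℕ → ℂ) :
    ∑ N ∈ Finset.range (n + 1),
        k N * g N * (up N * (f (N + 1) - f N) + dn N * (f (N - 1) - f N)) =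
      ∑ N ∈ Finset.range (n + 1),
        k N * f N * (up N * (g (N + 1) - g N) + dn N * (g (N - 1) - g N)) := by
  rw [← sub_eq_zero, ← Finset.sum_sub_distrib]
  -- The partial sums collapse to a discrete Wronskian at the last point, and `up n = 0` removes it.
  -- The value `N - 1` at `N = 0` is harmless because `dn 0 = 0`.
  have key : ∀ m ≤ n, ∑ N ∈ Finset.range (m + 1),
      (k N * g N * (up N * (f (N + 1) - f N) + dn N * (f (N - 1) - f N)) -
        k N * f N * (up N * (g (N + 1) - g N) + dn N * (g (N - 1) - g N))) =
      k m * up m * (g m * f (m + 1) - f m * g (m + 1)) := by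
    intro m
    induction m with
    | zero => intro _; rw [zero_add, Finset.sum_range_one, hd]; ring
    | succ m ih =>
      intro hm
      rw [Finset.sum_range_succ, ih (by omega), hb m (by omega), Nat.add_sub_cancel]
      ring
  rw [key n le_rfl, hu]
  ring

end

end BelliardSlavnov

/-! ### The q-Racah data of the triple -/

namespace BelliardSlavnov

noncomputable section

namespace Params

open Label

/-- The normalized spectral parameter `r₀ b^a`, so that `b^a = x^a / r₀` and
`c^a = 1 / (r₀ x^a)`. -/
def x (P : Params) (a : Label) : ℂ := P.r₀ * P.b a

/-- The first denominator parameter of the `q`-Racah functions. -/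
def dA (P : Params) : ℂ := -(P.x dot * P.x dia * P.q / P.x star)

/-- The second denominator parameter of the `q`-Racah functions. -/
def dB (P : Params) : ℂ := -(P.x dot * P.x star * P.x dia * P.q ^ (2 * P.n + 1))

namespace Admissible

variable {P : Params}

lemma x_ne (hP : P.Admissible) (a : Label) : P.x a ≠ 0 := mul_ne_zero hP.r₀_ne (hP.b_ne a)

lemma b_eq (hP : P.Admissible) (a : Label) : P.b a = P.x a / P.r₀ := by
  have := hP.r₀_ne
  rw [x]; field_simp

lemma c_eq (hP : P.Admissible) (a : Label) : P.c a = (P.r₀ * P.x a)⁻¹ := by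
  have h := hP.r₀_eq a
  have h1 := hP.r₀_ne
  have h2 := hP.b_ne a
  rw [x]
  field_simp at h ⊢
  linear_combination -h

lemma b_div_c (hP : P.Admissible) (a : Label) : P.b a / P.c a = P.x a ^ 2 := by
  have := hP.r₀_ne
  have := hP.x_ne a
  rw [hP.b_eq, hP.c_eq]; field_simp

lemma Q_ne (hP : P.Admissible) : P.q ^ 2 ≠ 0 := pow_ne_zero _ hP.q_ne

lemma Q_pow_ne (hP : P.Admissible) (j : ℕ) : (P.q ^ 2) ^ (j + 1) ≠ 1 := by
  rw [← pow_mul]; exact hP.q_root _ (by omega)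

lemma spec' (hP : P.Admissible) (a : Label) (k : ℕ) (h1 : 1 ≤ k) (h2 : k < 2 * P.n) :
    P.x a ^ 2 * (P.q ^ 2) ^ k ≠ 1 := by
  have h := hP.spec a k h1 h2
  rw [← div_eq_mul_inv, hP.b_div_c, zpow_neg] at h
  contrapose! h
  rw [← pow_mul] at h
  rw [show (2 * k : ℤ) = ((2 * k : ℕ) : ℤ) by push_cast; ring, zpow_natCast]
  exact eq_inv_of_mul_eq_one_left h

/-- The end values `k = 0` and `k = 2n`, not covered by `spec`, come from `den`. They are needed for
`⋄` because the factors `1 - a` and `1 - a Q^(2n)` stand in denominators of the weights. -/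
lemma spec_dia (hP : P.Admissible) (k : ℕ) (h : k ≤ 2 * P.n) :
    P.x dia ^ 2 * (P.q ^ 2) ^ k ≠ 1 := by
  obtain ⟨h1, h2⟩ := hP.den
  have hc := hP.c_ne dia
  rcases Nat.eq_zero_or_pos k with rfl | h0
  · rw [pow_zero, mul_one, ← hP.b_div_c, Ne, div_eq_one_iff_eq hc]; exact h1
  · rcases h.eq_or_lt with rfl | hlt
    · rw [← hP.b_div_c, ← pow_mul, div_mul_eq_mul_div, Ne, div_eq_one_iff_eq hc,
        show 2 * (2 * P.n) = 4 * P.n by ring]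
      exact h2.symm
    · exact hP.spec' dia k h0 hlt

/-- The irreducibility conditions in the variables `x^a`. The first and third are the factors of the
Pochhammer symbols of `dA` and `dB`; the second and fourth are the reflected factors, which occur in
the denominators of the well-poised weights. The fourth also controls `dS`. -/
lemma irred₁' (hP : P.Admissible) (j : ℕ) (h : j < P.n) :
    P.x dot * P.x dia * P.q ^ (2 * j + 1) + P.x star ≠ 0 := by
  have h := hP.irred₁ (j + 1) (by omega) (by omega)
  have h1 := hP.r₀_ne
  have h2 := hP.x_ne
  have hq := hP.q_ne
  contrapose! h
  rw [hP.c_eq, hP.c_eq, hP.c_eq, show (-2 * ((j + 1 : ℕ) : ℤ) + 1) = -((2 * j + 1 : ℕ) : ℤ) by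
    push_cast; ring, zpow_neg, zpow_natCast]
  have := h2 dot
  have := h2 star
  have := h2 dia
  have := pow_ne_zero (2 * j + 1) hq
  field_simp
  linear_combination h

lemma irred₂' (hP : P.Admissible) (j : ℕ) (h : j < P.n) :
    P.x star * P.x dia * P.q ^ (2 * j + 1) + P.x dot ≠ 0 := by
  have h := hP.irred₂ (P.n - j) (by omega) (by omega)
  have h1 := hP.r₀_ne
  contrapose! h
  rw [hP.b_eq, hP.b_eq, hP.b_eq, show (-2 * ((P.n - j : ℕ) : ℤ) + 1 + 2 * P.n) =
    ((2 * j + 1 : ℕ) : ℤ) by rw [Nat.cast_sub (by omega)]; push_cast; ring, zpow_natCast]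
  field_simp
  linear_combination h

lemma irred₃' (hP : P.Admissible) (j : ℕ) (h : j < P.n) :
    P.x dot * P.x star * P.x dia * P.q ^ (2 * P.n + 2 * j + 1) + 1 ≠ 0 := by
  have h := hP.irred₃ (j + 1) (by omega) (by omega)
  have h1 := hP.r₀_ne
  have h2 := hP.x_ne dot
  contrapose! h
  rw [hP.c_eq, hP.b_eq, hP.b_eq, show (2 * ((j + 1 : ℕ) : ℤ) + 2 * P.n - 1) =
    ((2 * P.n + 2 * j + 1 : ℕ) : ℤ) by push_cast; ring, zpow_natCast]
  field_simp
  linear_combination h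

lemma irred₄' (hP : P.Admissible) (j : ℕ) (h : j < P.n) :
    P.x dot * P.x star * P.q ^ (2 * j + 1) + P.x dia ≠ 0 := by
  have h := hP.irred₄ (j + 1) (by omega) (by omega)
  have h1 := hP.r₀_ne
  have h2 := hP.x_ne star
  have h3 := hP.x_ne dia
  contrapose! h
  rw [hP.c_eq, hP.b_eq, hP.c_eq, show (2 * ((j + 1 : ℕ) : ℤ) - 1) =
    ((2 * j + 1 : ℕ) : ℤ) by push_cast; ring, zpow_natCast]
  field_simp
  linear_combination h

lemma dA_ne (hP : P.Admissible) : P.dA ≠ 0 := by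
  have := hP.x_ne dot
  have := hP.x_ne star
  have := hP.x_ne dia
  have := hP.q_ne
  rw [dA]; exact neg_ne_zero.2 (by simp_all)

lemma dB_ne (hP : P.Admissible) : P.dB ≠ 0 := by
  have := hP.x_ne dot
  have := hP.x_ne star
  have := hP.x_ne dia
  have := hP.q_ne
  rw [dB]; exact neg_ne_zero.2 (by simp_all)

lemma dA_fac (hP : P.Admissible) (j : ℕ) (h : j < P.n) : 1 - P.dA * (P.q ^ 2) ^ j ≠ 0 := by
  have h1 := hP.irred₁' j h
  have h2 := hP.x_ne star
  contrapose! h1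
  rw [dA] at h1
  field_simp at h1
  linear_combination h1

lemma dB_fac (hP : P.Admissible) (j : ℕ) (h : j < P.n) : 1 - P.dB * (P.q ^ 2) ^ j ≠ 0 := by
  have h1 := hP.irred₃' j h
  contrapose! h1
  rw [dB] at h1
  linear_combination h1

/-- The reflected factors of `dA`. -/
lemma dA_fac' (hP : P.Admissible) (j : ℕ) (h : j < P.n) :
    P.dA - P.x dia ^ 2 * (P.q ^ 2) ^ (j + 1) ≠ 0 := by
  have h1 := hP.irred₂' j h
  have h2 := hP.x_ne star
  have h3 := hP.x_ne dia
  have h4 := hP.q_ne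
  contrapose! h1
  rw [dA] at h1
  field_simp at h1
  refine (mul_eq_zero.1 (show P.q * P.x dia * _ = 0 from ?_)).resolve_left (mul_ne_zero h4 h3)
  linear_combination -h1

/-- The reflected factors of `dB`. -/
lemma dB_fac' (hP : P.Admissible) (j : ℕ) (h : j < P.n) :
    1 - P.x dia ^ 2 * (P.q ^ 2) ^ (j + 1) / P.dB ≠ 0 := by
  obtain ⟨i, hi⟩ : ∃ i, P.n = j + 1 + i := ⟨P.n - (j + 1), by omega⟩
  have h1 := hP.irred₄' i (by omega)
  have h2 := hP.x_ne star
  have h3 := hP.x_ne dia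
  have h5 := hP.x_ne dot
  have h4 := hP.q_ne
  have h6 : P.q ^ (2 * i + 1) ≠ 0 := pow_ne_zero _ h4
  have h7 : P.q ^ (2 * j + 2) ≠ 0 := pow_ne_zero _ h4
  contrapose! h1
  have e : P.q ^ (2 * P.n + 1) = P.q ^ (2 * i + 1) * P.q ^ (2 * j + 2) := by
    rw [← pow_add]; congr 1; omega
  rw [dB, e, ← pow_mul, show 2 * (j + 1) = 2 * j + 2 by ring] at h1
  field_simp at h1
  linear_combination h1

lemma qPoch_dA (hP : P.Admissible) (k : ℕ) (h : k ≤ P.n) : qPoch P.dA (P.q ^ 2) k ≠ 0 :=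
  qPoch_ne_zero fun j hj h0 => hP.dA_fac j (by omega) (by rw [h0, sub_self])

lemma qPoch_dB (hP : P.Admissible) (k : ℕ) (h : k ≤ P.n) : qPoch P.dB (P.q ^ 2) k ≠ 0 :=
  qPoch_ne_zero fun j hj h0 => hP.dB_fac j (by omega) (by rw [h0, sub_self])

lemma qPoch_Q (hP : P.Admissible) (k : ℕ) : qPoch (P.q ^ 2) (P.q ^ 2) k ≠ 0 :=
  qPoch_ne_zero fun j _ => by rw [← pow_succ']; exact hP.Q_pow_ne j

lemma qPoch_top (hP : P.Admissible) (k : ℕ) (h : k ≤ P.n) :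
    qPoch ((P.q ^ 2) ^ P.n)⁻¹ (P.q ^ 2) k ≠ 0 := by
  refine qPoch_ne_zero fun j hj h0 => ?_
  obtain ⟨i, hi⟩ : ∃ i, P.n = j + (i + 1) := ⟨P.n - (j + 1), by omega⟩
  refine hP.Q_pow_ne i ?_
  have h1 : (P.q ^ 2) ^ j ≠ 0 := pow_ne_zero _ hP.Q_ne
  have h2 : (P.q ^ 2) ^ (i + 1) ≠ 0 := pow_ne_zero _ hP.Q_ne
  rw [hi, pow_add] at h0
  field_simp at h0
  exact h0.symm

lemma node (hP : P.Admissible) (a : Label) (d : ℂ) {M : ℕ} (h : M ≤ P.n) :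
    AWCoef (P.q ^ 2) (P.x a ^ 2) d ((P.q ^ 2) ^ P.n)⁻¹ ((P.q ^ 2) ^ M)
      (awU (P.q ^ 2) (P.x a ^ 2) d P.n M) (awD (P.q ^ 2) (P.x a ^ 2) d P.n M) :=
  AWCoef_node hP.Q_ne (hP.spec' a) h

/-- The balancing condition of the `₄φ₃` series, required for the q-Racah difference equation. Its
right side is symmetric in `·` and `⋄`, hence it serves both variables. -/
lemma dABC (hP : P.Admissible) :
    P.dA * P.dB * ((P.q ^ 2) ^ P.n)⁻¹ = P.x dot ^ 2 * P.x dia ^ 2 * P.q ^ 2 := by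
  have h2 := hP.x_ne star
  have h3 : P.q ^ P.n ≠ 0 := pow_ne_zero _ hP.q_ne
  rw [dA, dB, ← pow_mul, pow_succ P.q (2 * P.n), mul_comm 2 P.n, pow_mul]
  field_simp

end Admissible

/-- The value at `(θ_M, M')` of the `q`-Racah polynomials for the pair `(·, ⋄)`. -/
def racP (P : Params) (M M' : ℕ) : ℂ :=
  rac (P.q ^ 2) (P.x dot ^ 2) (P.x dia ^ 2) P.dA P.dB ((P.q ^ 2) ^ P.n)⁻¹ P.n ((P.q ^ 2) ^ M)
    ((P.q ^ 2) ^ M')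

/-- The weights of the dual orthogonality relation. -/
def wt (P : Params) (N : ℕ) : ℂ := vwpTerm (P.q ^ 2) (P.x dia ^ 2) P.dB P.dA 1 P.n N

/-- The Askey–Wilson coefficient `B` on the grid of `A^⋄`. -/
def upDia (P : Params) (N : ℕ) : ℂ :=
  awU (P.q ^ 2) (P.x dia ^ 2) P.dB P.n N * (1 - P.dA * (P.q ^ 2) ^ N)

/-- The Askey–Wilson coefficient `D` on the grid of `A^⋄`. -/
def dnDia (P : Params) (N : ℕ) : ℂ :=
  awD (P.q ^ 2) (P.x dia ^ 2) P.dB P.n N * (P.x dia ^ 2 * (P.q ^ 2) ^ N - P.dA)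

lemma qPair_grid_eq_zero {Q : ℂ} (hQ : Q ≠ 0) (X : ℂ) {M k : ℕ} (h : M < k) :
    qPair Q X (Q ^ M) k = 0 := by
  rw [qPair, qPoch_eq_zero h (inv_mul_cancel₀ (pow_ne_zero _ hQ)), zero_mul]

namespace Admissible

variable {P : Params}

lemma R_eq (hP : P.Admissible) {M M' : ℕ} (hM' : M' ≤ P.n) :
    P.R dia dot star M' M = P.racP M M' := by
  have h1 := hP.r₀_ne
  have h2 := hP.x_ne star
  have h3 := hP.x_ne dia
  have h4 := hP.x_ne dot
  rw [R, racP, rac]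
  -- The range is extended from `M'` to `n`: the added terms vanish because of the numerator
  -- parameter `q^(-2M')`.
  rw [← Finset.sum_subset (s₁ := Finset.range (M' + 1)) (s₂ := Finset.range (P.n + 1))]
  · refine Finset.sum_congr rfl fun k _ => ?_
    rw [hP.b_div_c, hP.b_div_c, racCoef, qPair, qPair]
    rw [show -(P.b dia * P.c star / P.c dot) * P.r₀ * P.q = P.dA by
        rw [hP.b_eq, hP.c_eq, hP.c_eq, dA]; field_simp,
      show -(P.b dot * P.b star / P.c dia) * P.r₀ * P.q ^ (2 * P.n + 1) = P.dB by
        rw [hP.b_eq, hP.b_eq, hP.c_eq, dB]; field_simp]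
    simp only [pow_mul]
    ring
  · exact Finset.range_subset_range.2 (by omega)
  · intro k _ hk
    rw [racCoef, qPair_grid_eq_zero hP.Q_ne _ (by simpa using hk)]
    simp

lemma kc_eq (hP : P.Admissible) (N : ℕ) : P.kc dot dia star N = P.wt N := by
  have h1 := hP.r₀_ne
  have h2 := hP.x_ne star
  have h3 := hP.x_ne dia
  have h4 := hP.x_ne dot
  have h5 := hP.q_ne
  have hA := hP.dA_ne
  have hB := hP.dB_ne
  rw [kc, wt, vwpTerm, hP.b_div_c, hP.b_div_c]
  rw [show -(P.b dot * P.c star / P.c dia) * P.r₀ * P.q = P.dA by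
      rw [hP.b_eq, hP.c_eq, hP.c_eq, dA]; field_simp,
    show -(P.b dia * P.b star / P.c dot) * P.r₀ * P.q ^ (2 * P.n + 1) = P.dB by
      rw [hP.b_eq, hP.b_eq, hP.c_eq, dB]; field_simp,
    show -(P.b dia * P.b star / P.b dot) * P.r₀ * P.q = P.x dia ^ 2 * P.q ^ 2 / P.dA by
      rw [hP.b_eq, hP.b_eq, hP.b_eq, dA]; field_simp,
    show -(P.c dot * P.c star / P.c dia) * P.r₀ * P.q ^ (1 - 2 * P.n : ℤ) =
        P.x dia ^ 2 * P.q ^ 2 / P.dB by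
      rw [hP.c_eq, hP.c_eq, hP.c_eq, dB, zpow_sub₀ h5, zpow_one, zpow_mul, zpow_natCast, zpow_ofNat,
        pow_succ P.q (2 * P.n), pow_mul]
      have := pow_ne_zero P.n (pow_ne_zero 2 h5)
      field_simp]
  have e1 : ∏ j ∈ Finset.range N, (1 - P.dA * (P.q ^ 2) ^ j) = qPoch P.dA (P.q ^ 2) N := rfl
  have e2 : ∏ j ∈ Finset.range N, (P.dA - P.x dia ^ 2 * (P.q ^ 2) ^ (j + 1) * 1) =
      P.dA ^ N * qPoch (P.x dia ^ 2 * P.q ^ 2 / P.dA) (P.q ^ 2) N := by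
    rw [qPoch, ← Finset.card_range N, ← Finset.prod_const, Finset.card_range,
      ← Finset.prod_mul_distrib]
    refine Finset.prod_congr rfl fun j _ => ?_
    field_simp
    ring
  -- By the balancing condition the argument of the well-poised series is `dA / x²` with `x` the
  -- parameter of `·`. The power of `dA` cancels the one in `e2` and leaves the factor `(b/c)^(-N)`
  -- of `k_N`.
  have e3 : P.x dia ^ 2 * (P.q ^ 2) ^ (P.n + 1) / P.dB = P.dA / P.x dot ^ 2 := by
    have := hP.dABC
    have h6 : (P.q ^ 2) ^ P.n ≠ 0 := pow_ne_zero _ hP.Q_ne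
    rw [pow_succ]
    field_simp at this ⊢
    linear_combination -this
  have e4 : P.q ^ (2 * P.n + 2) = (P.q ^ 2) ^ (P.n + 1) := by rw [← pow_mul]; ring_nf
  have e5 : P.q ^ (4 * N) = (P.q ^ 2) ^ (2 * N) := by rw [← pow_mul]; ring_nf
  have e6 : P.q ^ (2 * P.n) = (P.q ^ 2) ^ P.n := by rw [← pow_mul]
  rw [e1, e2, e3, e4, e5, e6, div_pow]
  have := pow_ne_zero N hA
  simp only [div_eq_mul_inv, mul_inv]
  rw [← mul_one (_ * (_ * _) : ℂ), ← mul_inv_cancel₀ this]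
  ring

lemma Pinv_eq (hP : P.Admissible) {M M' : ℕ} (hM' : M' ≤ P.n) :
    P.Pinv dia dot star M M' = (P.ν₀ dia dot star)⁻¹ * P.wt M' * P.racP M M' := by
  rw [Pinv, hP.kc_eq, hP.R_eq hM']

lemma wt_balance (hP : P.Admissible) (N : ℕ) (h : N < P.n) :
    P.wt N * P.upDia N = P.wt (N + 1) * P.dnDia (N + 1) :=
  vwpTerm_balance hP.Q_ne (pow_ne_zero _ (hP.x_ne dia)) hP.dB_ne hP.Q_pow_ne hP.spec_dia h
    (hP.dA_fac' N h) (hP.dB_fac' N h)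

lemma racP_zero (hP : P.Admissible) (M' : ℕ) : P.racP 0 M' = 1 := by
  rw [racP, rac, Finset.sum_range_succ', Finset.sum_eq_zero]
  · simp [qPair_zero, racCoef, qPoch_zero]
  · intro k _
    rw [qPair_grid_eq_zero hP.Q_ne _ (Nat.succ_pos k), mul_zero]

lemma racP_zero_right (hP : P.Admissible) (M : ℕ) : P.racP M 0 = 1 := by
  rw [racP, rac, Finset.sum_range_succ', Finset.sum_eq_zero]
  · simp [qPair_zero, racCoef, qPoch_zero]
  · intro k _
    rw [racCoef, qPair_grid_eq_zero hP.Q_ne _ (Nat.succ_pos k)]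
    simp

/-- The difference equation of the `q`-Racah polynomials in the dual variable `M'`. -/
lemma racP_dia (hP : P.Admissible) {M N : ℕ} (hM : M ≤ P.n) (hN : N ≤ P.n) :
    P.upDia N * (P.racP M (N + 1) - P.racP M N) + P.dnDia N * (P.racP M (N - 1) - P.racP M N) =
      (((P.q ^ 2) ^ M)⁻¹ - 1) * (1 - P.x dot ^ 2 * (P.q ^ 2) ^ M) * P.racP M N := by
  have hQ := hP.Q_ne
  -- Duality of q-Racah functions: the series is symmetric under exchange of degree and variable, so
  -- the same difference equation applies in `M'`.
  have e : ∀ v, rac (P.q ^ 2) (P.x dot ^ 2) (P.x dia ^ 2) P.dA P.dB ((P.q ^ 2) ^ P.n)⁻¹ P.n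
      ((P.q ^ 2) ^ M) v = rac (P.q ^ 2) (P.x dia ^ 2) (P.x dot ^ 2) P.dA P.dB
        ((P.q ^ 2) ^ P.n)⁻¹ P.n v ((P.q ^ 2) ^ M) := fun v => by
    rw [rac, rac]
    refine Finset.sum_congr rfl fun k _ => ?_
    rw [racCoef, racCoef]; ring
  have := (hP.node dia P.dB hN).apply_rac (Y := P.x dot ^ 2) (v := (P.q ^ 2) ^ M) (n := P.n) hQ
    (pow_ne_zero _ (hP.x_ne dia)) (pow_ne_zero _ hQ) (pow_ne_zero _ hQ)
    (by rw [hP.dABC]; ring) (qPair_grid_eq_zero hQ _ (by omega))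
    (fun k hk => hP.qPoch_dA k hk) (fun k hk => hP.qPoch_dB k hk) (fun k hk => hP.qPoch_top k hk)
    (fun k _ => hP.qPoch_Q k)
  rw [← pow_succ'] at this
  simp only [racP, e, upDia, dnDia]
  -- At `N = 0` the truncated index `N - 1` does not correspond to `w / Q`, but the coefficient in
  -- front of it is zero.
  rcases N with _ | N
  · rw [awD_zero] at this ⊢
    linear_combination this
  · rw [pow_succ _ N, mul_div_cancel_right₀ _ hQ, ← pow_succ] at this
    exact this

/-- The difference equation of the `q`-Racah polynomials in the variable `M`. -/
lemma racP_dot (hP : P.Admissible) {M N : ℕ} (hM : M ≤ P.n) (hN : N ≤ P.n) :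
    awU (P.q ^ 2) (P.x dot ^ 2) P.dB P.n M * (1 - P.dA * (P.q ^ 2) ^ M) *
        (P.racP (M + 1) N - P.racP M N) +
      awD (P.q ^ 2) (P.x dot ^ 2) P.dB P.n M * (P.x dot ^ 2 * (P.q ^ 2) ^ M - P.dA) *
        (P.racP (M - 1) N - P.racP M N) =
      (((P.q ^ 2) ^ N)⁻¹ - 1) * (1 - P.x dia ^ 2 * (P.q ^ 2) ^ N) * P.racP M N := by
  have hQ := hP.Q_ne
  have := (hP.node dot P.dB hM).apply_rac (Y := P.x dia ^ 2) (v := (P.q ^ 2) ^ N) (n := P.n) hQ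
    (pow_ne_zero _ (hP.x_ne dot)) (pow_ne_zero _ hQ) (pow_ne_zero _ hQ)
    hP.dABC (qPair_grid_eq_zero hQ _ (by omega))
    (fun k hk => hP.qPoch_dA k hk) (fun k hk => hP.qPoch_dB k hk) (fun k hk => hP.qPoch_top k hk)
    (fun k _ => hP.qPoch_Q k)
  rw [← pow_succ'] at this
  simp only [racP]
  rcases M with _ | M
  · rw [awD_zero] at this ⊢
    linear_combination this
  · rw [pow_succ _ M, mul_div_cancel_right₀ _ hQ, ← pow_succ] at this
    exact this

/-- The rows of the transition matrix are left eigenvectors of a tridiagonal matrix. -/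
lemma sum_Pinv_apply (hP : P.Admissible) {M : ℕ} (hM : M ≤ P.n) (f : ℕ → ℂ) :
    ∑ N ∈ Finset.range (P.n + 1), P.Pinv dia dot star M N *
        (P.upDia N * (f (N + 1) - f N) + P.dnDia N * (f (N - 1) - f N)) =
      (((P.q ^ 2) ^ M)⁻¹ - 1) * (1 - P.x dot ^ 2 * (P.q ^ 2) ^ M) *
        ∑ N ∈ Finset.range (P.n + 1), P.Pinv dia dot star M N * f N := by
  -- The operator is moved from `f` to the q-Racah polynomial, on which it acts by its eigenvalue.
  have h := sum_by_parts (k := P.wt) (up := P.upDia) (dn := P.dnDia) (n := P.n)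
    (by rw [upDia, awU_top, zero_mul]) (by rw [dnDia, awD_zero, zero_mul]) hP.wt_balance f
    (P.racP M)
  have e : ∀ g : ℕ → ℂ, ∑ N ∈ Finset.range (P.n + 1), P.Pinv dia dot star M N * g N =
      (P.ν₀ dia dot star)⁻¹ * ∑ N ∈ Finset.range (P.n + 1), P.wt N * P.racP M N * g N := by
    intro g
    rw [Finset.mul_sum]
    refine Finset.sum_congr rfl fun N hN => ?_
    rw [hP.Pinv_eq (by simpa [Nat.lt_succ_iff] using hN)]; ring
  rw [e, e, h, mul_left_comm]
  congr 1
  rw [Finset.mul_sum]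
  refine Finset.sum_congr rfl fun N hN => ?_
  rw [hP.racP_dia hM (by simpa [Nat.lt_succ_iff] using hN)]
  ring

end Admissible

end Params

end

end BelliardSlavnov

/-! ### Total mass of the weights and row sums of the transition matrix -/

namespace BelliardSlavnov

noncomputable section

lemma prod_pow_succ_sq (q : ℂ) (n : ℕ) :
    ∏ j ∈ Finset.range n, (q ^ 2) ^ (j + 1) = q ^ (n * (n + 1)) := by
  induction n with
  | zero => simp
  | succ n ih => rw [Finset.prod_range_succ, ih, ← pow_mul, ← pow_add]; congr 1; ring

lemma prod_pow_odd (q : ℂ) (n : ℕ) :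
    ∏ j ∈ Finset.range n, q ^ (2 * j + 1) = q ^ (n ^ 2) := by
  induction n with
  | zero => simp
  | succ n ih => rw [Finset.prod_range_succ, ih, ← pow_add]; congr 1; ring

/-- Reversing the order of the factors turns the exponents `1 - 2n, …, -1` into inverses of `1, …,
2n - 1`; the extracted monomials multiply to `t^n q^(n²)`. -/
lemma qPoch_reflect {q t : ℂ} (hq : q ≠ 0) (ht : t ≠ 0) (n : ℕ) :
    qPoch (-(t⁻¹ * q ^ (1 - 2 * n : ℤ))) (q ^ 2) n =
      (t ^ n * q ^ (n ^ 2))⁻¹ * qPoch (-(q * t)) (q ^ 2) n := by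
  rw [qPoch, ← Finset.prod_range_reflect, ← prod_pow_odd, qPoch]
  nth_rw 4 [← Finset.card_range n]
  rw [← Finset.prod_const, ← Finset.prod_mul_distrib, ← Finset.prod_inv_distrib,
    ← Finset.prod_mul_distrib]
  refine Finset.prod_congr rfl fun j hj => ?_
  have hj : j < n := Finset.mem_range.1 hj
  have e : q ^ (1 - 2 * n : ℤ) * (q ^ 2) ^ (n - 1 - j) = (q ^ (2 * j + 1))⁻¹ := by
    rw [← pow_mul, ← zpow_natCast, ← zpow_add₀ hq, ← zpow_natCast q (2 * j + 1), ← zpow_neg]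
    congr 1
    push_cast [Nat.sub_sub, Nat.cast_sub (show 1 + j ≤ n by omega)]
    ring
  rw [neg_mul, mul_assoc, e, ← pow_mul, pow_succ]
  have := pow_ne_zero (2 * j) hq
  field_simp
  ring

namespace Params

open Label

namespace Admissible

variable {P : Params}

lemma qPoch_sq (hP : P.Admissible) (a : Label) :
    qPoch (P.x a ^ 2 * P.q ^ 2) (P.q ^ 2) P.n ≠ 0 :=
  qPoch_ne_zero fun j hj => by
    rw [mul_assoc, ← pow_succ']; exact hP.spec' a _ (by omega) (by omega)

lemma ν₀_eq (hP : P.Admissible) :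
    P.ν₀ dia dot star = qPoch (P.x dia ^ 2 * P.q ^ 2) (P.q ^ 2) P.n *
        qPoch (P.x dot ^ 2 * P.q ^ 2) (P.q ^ 2) P.n /
      (P.dB ^ P.n * qPoch (P.x dia ^ 2 * P.q ^ 2 / P.dB) (P.q ^ 2) P.n *
        (((P.x star * P.x dia / P.x dot) ^ P.n * P.q ^ (P.n ^ 2))⁻¹ *
          qPoch (-(P.q * (P.x star * P.x dia / P.x dot))) (P.q ^ 2) P.n)) := by
  have h1 := hP.r₀_ne
  have h2 := hP.x_ne star
  have h3 := hP.x_ne dia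
  have h4 := hP.x_ne dot
  have h5 := hP.q_ne
  rw [ν₀, hP.b_div_c, hP.b_div_c, ← qPoch_reflect h5 (div_ne_zero (mul_ne_zero h2 h3) h4)]
  rw [show -(P.b dot * P.b star / P.c dia) * P.r₀ * P.q ^ (2 * P.n + 1) = P.dB by
      rw [hP.b_eq, hP.b_eq, hP.c_eq, dB]; field_simp,
    show -(P.b dia * P.c star / P.b dot) * P.r₀ * P.q ^ (1 - 2 * P.n : ℤ) =
        P.x dia ^ 2 * P.q ^ 2 / P.dB by
      rw [hP.b_eq, hP.c_eq, hP.b_eq, dB, zpow_sub₀ h5, zpow_one, zpow_mul, zpow_natCast, zpow_ofNat,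
        pow_succ P.q (2 * P.n), pow_mul]
      have := pow_ne_zero P.n (pow_ne_zero 2 h5)
      field_simp,
    show -(P.c dia * P.c star / P.c dot) * P.r₀ * P.q ^ (1 - 2 * P.n : ℤ) =
        -((P.x star * P.x dia / P.x dot)⁻¹ * P.q ^ (1 - 2 * P.n : ℤ)) by
      rw [hP.c_eq, hP.c_eq, hP.c_eq]; field_simp]

lemma vwp_hyp_dB (hP : P.Admissible) :
    qPoch (P.x dia ^ 2 * P.q ^ 2 / P.dB) (P.q ^ 2) P.n ≠ 0 :=
  qPoch_ne_zero fun j hj h => hP.dB_fac' j hj (by rw [pow_succ']; linear_combination -h)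

lemma qPoch_star_dia (hP : P.Admissible) :
    qPoch (-(P.q * (P.x star * P.x dia / P.x dot))) (P.q ^ 2) P.n ≠ 0 :=
  qPoch_ne_zero fun j hj h => hP.irred₂' j hj (by
    have := hP.x_ne dot
    field_simp at h
    linear_combination -h)

lemma qPoch_dot_dia (hP : P.Admissible) :
    qPoch (-(P.q * (P.x dot * P.x dia / P.x star))) (P.q ^ 2) P.n ≠ 0 :=
  qPoch_ne_zero fun j hj h => hP.irred₁' j hj (by
    have := hP.x_ne star
    field_simp at h
    linear_combination -h)

lemma qPoch_dot_star (hP : P.Admissible) :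
    qPoch (-(P.q * (P.x dot * P.x star / P.x dia))) (P.q ^ 2) P.n ≠ 0 :=
  qPoch_ne_zero fun j hj h => hP.irred₄' j hj (by
    have := hP.x_ne dia
    field_simp at h
    linear_combination -h)

lemma ν₀_ne (hP : P.Admissible) : P.ν₀ dia dot star ≠ 0 := by
  rw [hP.ν₀_eq]
  refine div_ne_zero (mul_ne_zero (hP.qPoch_sq _) (hP.qPoch_sq _)) (mul_ne_zero (mul_ne_zero
    (pow_ne_zero _ hP.dB_ne) hP.vwp_hyp_dB) (mul_ne_zero (inv_ne_zero (mul_ne_zero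
    (pow_ne_zero _ (div_ne_zero (mul_ne_zero (hP.x_ne _) (hP.x_ne _)) (hP.x_ne _)))
    (pow_ne_zero _ hP.q_ne))) hP.qPoch_star_dia))

/-- The total mass of the dual weights. -/
lemma sum_wt (hP : P.Admissible) :
    ∑ N ∈ Finset.range (P.n + 1), P.wt N = P.ν₀ dia dot star := by
  have h2 := hP.x_ne star
  have h3 := hP.x_ne dia
  have h4 := hP.x_ne dot
  have h5 := hP.q_ne
  have hA := hP.dA_ne
  have hB := hP.dB_ne
  have h := vwp_sum (Q := P.q ^ 2) (a := P.x dia ^ 2) (b := P.dB) (γ := P.dA) (δ := 1) (N := P.n)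
    hP.Q_ne hB hP.Q_pow_ne hP.spec_dia hP.dB_fac' (by simpa using hP.dA_fac')
  have e1 : ∏ j ∈ Finset.range P.n, (P.dA - P.x dia ^ 2 * (P.q ^ 2) ^ (j + 1) * 1) =
      P.dA ^ P.n * qPoch (-(P.q * (P.x star * P.x dia / P.x dot))) (P.q ^ 2) P.n := by
    nth_rw 2 [← Finset.card_range P.n]
    rw [qPoch, ← Finset.prod_const, ← Finset.prod_mul_distrib]
    refine Finset.prod_congr rfl fun j _ => ?_
    rw [dA]
    field_simp
    ring
  -- The balancing condition gives `dA = x² z² Q^(n+1) / dB`, with `x`, `z` the parameters of `·`,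
  -- `⋄`. Each factor then splits off `-(z² / dB) Q^(j+1)`, and the remaining factors form a
  -- Pochhammer symbol in reverse order.
  have e2 : ∏ j ∈ Finset.range P.n, (P.dA - P.x dia ^ 2 * (P.q ^ 2) ^ (j + 1) * 1 / P.dB) =
      (-(P.x dia ^ 2) / P.dB) ^ P.n * P.q ^ (P.n * (P.n + 1)) *
        qPoch (P.x dot ^ 2 * P.q ^ 2) (P.q ^ 2) P.n := by
    rw [qPoch, ← Finset.prod_range_reflect (fun k => 1 - P.x dot ^ 2 * P.q ^ 2 * (P.q ^ 2) ^ k),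
      ← prod_pow_succ_sq]
    have c : ∀ c : ℂ, c ^ P.n = ∏ _j ∈ Finset.range P.n, c := by simp
    rw [c (-(P.x dia ^ 2) / P.dB), ← Finset.prod_mul_distrib, ← Finset.prod_mul_distrib]
    refine Finset.prod_congr rfl fun j hj => ?_
    have hj : j < P.n := Finset.mem_range.1 hj
    have e := hP.dABC
    have e3 : (P.q ^ 2) ^ P.n = (P.q ^ 2) ^ (j + 1) * (P.q ^ 2) ^ (P.n - 1 - j) := by
      rw [← pow_add]; congr 1; omega
    rw [e3] at e
    have h6 := pow_ne_zero (j + 1) hP.Q_ne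
    have h7 := pow_ne_zero (P.n - 1 - j) hP.Q_ne
    generalize (P.q ^ 2) ^ (j + 1) = s at *
    generalize (P.q ^ 2) ^ (P.n - 1 - j) = t at *
    field_simp at e ⊢
    linear_combination e
  rw [e1, e2] at h
  rw [hP.ν₀_eq]
  have n1 := hP.vwp_hyp_dB
  have n2 := hP.qPoch_star_dia
  have n3 := pow_ne_zero P.n hA
  have n4 := pow_ne_zero P.n hB
  have n5 := pow_ne_zero P.n h2
  have n6 := pow_ne_zero P.n h3
  have n7 := pow_ne_zero P.n h4
  have n8 := pow_ne_zero (P.n ^ 2) h5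
  rw [eq_div_iff (mul_ne_zero (mul_ne_zero n4 n1) (mul_ne_zero (inv_ne_zero (mul_ne_zero
    (pow_ne_zero _ (div_ne_zero (mul_ne_zero h2 h3) h4)) n8)) n2))]
  have e4 : P.dA ^ P.n * (P.x star * P.x dia / P.x dot) ^ P.n * P.q ^ (P.n ^ 2) =
      (-(P.x dia ^ 2)) ^ P.n * P.q ^ (P.n * (P.n + 1)) := by
    rw [show P.n * (P.n + 1) = P.n ^ 2 + P.n by ring, pow_add, ← mul_pow, ← mul_assoc,
      mul_right_comm ((-(P.x dia ^ 2)) ^ P.n), ← mul_pow]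
    congr 2
    rw [dA]; field_simp
  have n9 := pow_ne_zero P.n (div_ne_zero (mul_ne_zero h2 h3) h4)
  generalize P.x star * P.x dia / P.x dot = t at *
  rw [div_pow] at h
  generalize (-(P.x dia ^ 2)) ^ P.n = s at *
  clear e1 e2
  change (∑ k ∈ Finset.range (P.n + 1), P.wt k) * _ = _ at h
  generalize (∑ k ∈ Finset.range (P.n + 1), P.wt k) = S at *
  generalize qPoch (P.x dia ^ 2 * P.q ^ 2 / P.dB) (P.q ^ 2) P.n = p₁ at *
  generalize qPoch (P.x dia ^ 2 * P.q ^ 2) (P.q ^ 2) P.n = p₂ at *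
  generalize qPoch (P.x dot ^ 2 * P.q ^ 2) (P.q ^ 2) P.n = p₃ at *
  generalize qPoch (-(P.q * t)) (P.q ^ 2) P.n = p₄ at *
  field_simp at h ⊢
  refine mul_left_cancel₀ n3 ?_
  linear_combination h - p₂ * p₃ * e4

/-- The row sums of the transition matrix. -/
lemma sum_Pinv (hP : P.Admissible) {M : ℕ} (hM : M ≤ P.n) :
    ∑ N ∈ Finset.range (P.n + 1), P.Pinv dia dot star M N = if M = 0 then 1 else 0 := by
  rcases Nat.eq_zero_or_pos M with rfl | h0
  · rw [if_pos rfl, ← mul_inv_cancel₀ hP.ν₀_ne, ← hP.sum_wt, Finset.sum_mul]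
    refine Finset.sum_congr rfl fun N hN => ?_
    rw [hP.Pinv_eq (by simpa [Nat.lt_succ_iff] using hN), hP.racP_zero, hP.sum_wt]
    ring
  · rw [if_neg h0.ne']
    -- Constants are annihilated by the difference operator, whereas the eigenvalue of row `M` is
    -- nonzero for `M > 0`; hence such a row is orthogonal to constants.
    have h := hP.sum_Pinv_apply hM (fun _ => 1)
    simp only [sub_self, mul_zero, add_zero, Finset.sum_const_zero, mul_one] at h
    refine (mul_eq_zero.1 h.symm).resolve_left (mul_ne_zero ?_ ?_)
    · intro h1
      obtain ⟨j, rfl⟩ : ∃ j, M = j + 1 := ⟨M - 1, by omega⟩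
      exact hP.Q_pow_ne j (inv_eq_one.1 (sub_eq_zero.1 h1))
    · exact sub_ne_zero.2 (hP.spec' dot M h0 (by omega)).symm

end Admissible

end Params

end

end BelliardSlavnov

/-! ### The matrix of `A^⋄` in the eigenbasis of `A` -/

namespace BelliardSlavnov

noncomputable section

/-- The row sums of the tridiagonal matrix of `A^⋄` are affine functions of the grid variable
`x² w + w⁻¹`. -/
lemma AWCoef.row_sum {q x y z r w u₀ d₀ : ℂ}
    (h : AWCoef (q ^ 2) (x ^ 2) (-(x * y * z * q * r)) r⁻¹ w u₀ d₀) (hx : x ≠ 0)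
    (hy : y ≠ 0) (hz : z ≠ 0) (hr : r ≠ 0) (hw : w ≠ 0) :
    u₀ * (1 + x * y * q / z * w) * (x * q * w / y) +
        d₀ * (x ^ 2 * w + x * y * q / z) * (q / (x * y * w)) +
        (1 + z ^ 2 - u₀ * (1 + x * z * q / y * w) - d₀ * (x ^ 2 * w + x * z * q / y)) / z =
      (z ^ 2 - x * y * z * q * r + r⁻¹) / z + y * q / x * (x ^ 2 * w + w⁻¹ - 1) := by
  rcases h with ⟨h1, h2, h3, rfl, rfl⟩ | ⟨rfl, h1, rfl, rfl⟩ | ⟨h0, h1, rfl, rfl⟩ |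
    ⟨rfl, h1, rfl, rfl⟩
  · generalize he1 : 1 - x ^ 2 * w ^ 2 = e₁ at *
    generalize he2 : 1 - x ^ 2 * q ^ 2 * w ^ 2 = e₂ at *
    generalize he3 : x ^ 2 * w ^ 2 - q ^ 2 = e₃ at *
    field_simp
    subst he1 he2 he3
    ring
  · generalize he1 : 1 - x ^ 2 * q ^ 2 = e₁ at *
    field_simp
    subst he1
    ring
  · obtain rfl : r = w := inv_injective h0
    generalize he3 : x ^ 2 * r ^ 2 - q ^ 2 = e₃ at *
    field_simp
    subst he3
    ring
  · obtain rfl : r = 1 := inv_eq_one.1 h1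
    field_simp
    ring

namespace Params

open Label

/-- The first denominator parameter of the `q`-Racah functions for the pair `(·, *)`. -/
def dS (P : Params) : ℂ := -(P.x dot * P.x star * P.q / P.x dia)

/-- The superdiagonal of the matrix of `r₀ A^⋄` in the eigenbasis of `A`. -/
def upZ (P : Params) (M : ℕ) : ℂ :=
  awU (P.q ^ 2) (P.x dot ^ 2) P.dB P.n M * (1 - P.dS * (P.q ^ 2) ^ M) *
    (P.x dot * P.q * (P.q ^ 2) ^ M / P.x star)

/-- The subdiagonal of the matrix of `r₀ A^⋄` in the eigenbasis of `A`. -/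
def dnZ (P : Params) (M : ℕ) : ℂ :=
  awD (P.q ^ 2) (P.x dot ^ 2) P.dB P.n M * (P.x dot ^ 2 * (P.q ^ 2) ^ M - P.dS) *
    (P.q / (P.x dot * P.x star * (P.q ^ 2) ^ M))

/-- The diagonal of the matrix of `r₀ A^⋄` in the eigenbasis of `A`. -/
def dgZ (P : Params) (M : ℕ) : ℂ :=
  (1 + P.x dia ^ 2 - awU (P.q ^ 2) (P.x dot ^ 2) P.dB P.n M * (1 - P.dA * (P.q ^ 2) ^ M) -
    awD (P.q ^ 2) (P.x dot ^ 2) P.dB P.n M * (P.x dot ^ 2 * (P.q ^ 2) ^ M - P.dA)) / P.x dia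

/-- The eigenvalue `r₀ θ^⋄_M`. -/
def tauM (P : Params) (M : ℕ) : ℂ := tau (P.x dia) ((P.q ^ 2) ^ M)

/-- The vector with dual coordinates `h`, in the eigenbasis of `A`. -/
def vecOf (P : Params) (h : ℕ → ℂ) (M : ℕ) : ℂ :=
  P.fRel M * ∑ N ∈ Finset.range (P.n + 1), P.Pinv dia dot star M N * h N

namespace Admissible

variable {P : Params}

lemma dABC_neg (hP : P.Admissible) :
    -P.dA * P.dB * ((P.q ^ 2) ^ P.n)⁻¹ / (P.x dia ^ 2 * P.q ^ 2) = -P.x dot ^ 2 := by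
  have h3 := hP.x_ne dia
  have h5 := hP.q_ne
  rw [neg_mul, neg_mul, hP.dABC]
  field_simp

lemma dS_fac (hP : P.Admissible) (j : ℕ) (h : j < P.n) : 1 - P.dS * (P.q ^ 2) ^ j ≠ 0 := by
  have h1 := hP.irred₄' j h
  have h2 := hP.x_ne dia
  contrapose! h1
  rw [dS] at h1
  field_simp at h1
  linear_combination h1

lemma fRel_succ (hP : P.Admissible) (M : ℕ) :
    P.fRel (M + 1) = P.fRel M * ((1 - P.dA * (P.q ^ 2) ^ M) * (P.q * P.x star) /
      (P.x dot * (P.q ^ 2) ^ (M + 1) * P.x dia * (1 - P.dS * (P.q ^ 2) ^ M))) := by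
  rw [fRel, Finset.prod_range_succ, ← fRel]
  congr 1
  have h1 := hP.r₀_ne
  have h2 := hP.x_ne star
  have h3 := hP.x_ne dia
  have h4 := hP.x_ne dot
  have h5 := hP.q_ne
  have h6 := pow_ne_zero M hP.Q_ne
  rw [show (-2 * (M : ℤ) - 2) = -((2 * (M + 1) : ℕ) : ℤ) by push_cast; ring, zpow_neg, zpow_natCast,
    pow_mul, pow_mul, pow_succ _ M]
  have e1 : P.c dot * ((P.q ^ 2) ^ M * P.q ^ 2)⁻¹ + P.r₀ * P.q⁻¹ * P.c star * P.b dia =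
      (P.r₀ * P.x dot * ((P.q ^ 2) ^ M * P.q ^ 2))⁻¹ * (1 - P.dA * (P.q ^ 2) ^ M) := by
    rw [hP.c_eq, hP.c_eq, hP.b_eq, dA]
    field_simp
    ring
  have e2 : P.b dot * (P.q ^ 2) ^ M + P.r₀ * P.q⁻¹ * P.c star * P.b dia =
      P.x dia * (P.r₀ * P.q * P.x star)⁻¹ * (1 - P.dS * (P.q ^ 2) ^ M) := by
    rw [hP.b_eq, hP.c_eq, hP.b_eq, dS]
    field_simp
    ring
  rw [e1, e2]
  simp only [mul_inv, div_eq_mul_inv, inv_inv]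
  linear_combination ((P.x dot)⁻¹ * (((P.q ^ 2) ^ M)⁻¹ * (P.q ^ 2)⁻¹) *
    (1 - P.dA * (P.q ^ 2) ^ M) * ((P.x dia)⁻¹ * (P.q * P.x star) *
    (1 - P.dS * (P.q ^ 2) ^ M)⁻¹)) * mul_inv_cancel₀ h1

/-- Rescaling the dual coordinates by `1 / h_N` exchanges the factor `1 - dA w` for `1 - dA / (X Q
w)`. This is the interchanged factor of `AWCoef.apply_qPair'` and the reason for the second form of
the operator. -/
lemma hRel_succ (hP : P.Admissible) {N : ℕ} (h : N < P.n) :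
    (P.hRel (N + 1))⁻¹ * (1 - P.dA * (P.q ^ 2) ^ N) =
      (P.hRel N)⁻¹ * (1 - P.dA / (P.x dia ^ 2 * P.q ^ 2 * (P.q ^ 2) ^ N)) := by
  rw [hRel, Finset.prod_range_succ, ← hRel]
  have h1 := hP.r₀_ne
  have h2 := hP.x_ne star
  have h3 := hP.x_ne dia
  have h4 := hP.x_ne dot
  have h5 := hP.q_ne
  have h6 := pow_ne_zero N hP.Q_ne
  have h7 := hP.dA_fac N h
  rw [show P.q ^ (4 * N) = ((P.q ^ 2) ^ N) ^ 2 by rw [← pow_mul, ← pow_mul]; ring_nf,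
    pow_mul P.q 2 N]
  have e1 : P.c dia * ((P.q ^ 2) ^ N)⁻¹ + P.r₀ * P.q * P.c star * P.b dot =
      (P.r₀ * P.x dia * (P.q ^ 2) ^ N)⁻¹ * (1 - P.dA * (P.q ^ 2) ^ N) := by
    rw [hP.c_eq, hP.c_eq, hP.b_eq, dA]
    field_simp
    ring
  have e2 : P.b dia * (P.q ^ 2) ^ N + P.r₀ * P.q⁻¹ * P.c star * P.b dot =
      P.x dia * (P.q ^ 2) ^ N / P.r₀ *
        (1 - P.dA / (P.x dia ^ 2 * P.q ^ 2 * (P.q ^ 2) ^ N)) := by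
    rw [hP.b_eq, hP.c_eq, hP.b_eq, dA]
    field_simp
    ring
  rw [e1, e2, hP.b_div_c]
  generalize 1 - P.dA * (P.q ^ 2) ^ N = f at *
  generalize 1 - P.dA / (P.x dia ^ 2 * P.q ^ 2 * (P.q ^ 2) ^ N) = g at *
  clear e1 e2
  field_simp

/-- The matrix of `A^⋄` carries `dS`, the q-Racah equation carries `dA`. The ratio `f_{M+1} / f_M`
contains the factor of `dA` over the factor of `dS`, so rescaling by `f` turns `A^⋄` into the
q-Racah difference operator. This is what `f_M` is for. -/
lemma upZ_fRel (hP : P.Admissible) {M : ℕ} (hM : M ≤ P.n) :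
    P.upZ M * P.fRel (M + 1) = P.fRel M *
      (awU (P.q ^ 2) (P.x dot ^ 2) P.dB P.n M * (1 - P.dA * (P.q ^ 2) ^ M) / P.x dia) := by
  have h2 := hP.x_ne star
  have h3 := hP.x_ne dia
  have h4 := hP.x_ne dot
  have h5 := hP.q_ne
  rcases hM.eq_or_lt with rfl | hlt
  · rw [upZ, awU_top]; ring
  · have h6 := pow_ne_zero M hP.Q_ne
    have h7 := hP.dS_fac M hlt
    rw [upZ, hP.fRel_succ, pow_succ _ M]
    generalize 1 - P.dS * (P.q ^ 2) ^ M = f at *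
    field_simp

lemma dnZ_fRel (hP : P.Admissible) {M : ℕ} (hM : M ≤ P.n) :
    P.dnZ M * P.fRel (M - 1) = P.fRel M *
      (awD (P.q ^ 2) (P.x dot ^ 2) P.dB P.n M * (P.x dot ^ 2 * (P.q ^ 2) ^ M - P.dA) /
        P.x dia) := by
  have h2 := hP.x_ne star
  have h3 := hP.x_ne dia
  have h4 := hP.x_ne dot
  have h5 := hP.q_ne
  rcases M with _ | M
  · rw [dnZ, awD_zero]; ring
  · have h6 := pow_ne_zero M hP.Q_ne
    have h7 := hP.dS_fac M hM
    rw [dnZ, Nat.add_sub_cancel, hP.fRel_succ, pow_succ _ M]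
    have e1 : P.x dot ^ 2 * ((P.q ^ 2) ^ M * P.q ^ 2) - P.dS =
        P.x dot * P.x star * P.q / P.x dia * (1 - P.dA * (P.q ^ 2) ^ M) := by
      rw [dS, dA]
      field_simp
      ring
    have e2 : P.x dot ^ 2 * ((P.q ^ 2) ^ M * P.q ^ 2) - P.dA =
        P.x dot * P.x dia * P.q / P.x star * (1 - P.dS * (P.q ^ 2) ^ M) := by
      rw [dS, dA]
      field_simp
      ring
    rw [e1, e2]
    generalize 1 - P.dS * (P.q ^ 2) ^ M = f at *
    field_simp

/-- The columns of the transition matrix are eigenvectors of `r₀ A^⋄`. -/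
lemma apply_vecOf (hP : P.Admissible) {M : ℕ} (hM : M ≤ P.n) (h : ℕ → ℂ) :
    P.upZ M * P.vecOf h (M + 1) + P.dnZ M * P.vecOf h (M - 1) + P.dgZ M * P.vecOf h M =
      P.vecOf (fun N => P.tauM N * h N) M := by
  simp only [vecOf]
  rw [← mul_assoc, ← mul_assoc, hP.upZ_fRel hM, hP.dnZ_fRel hM]
  simp only [mul_assoc, Finset.mul_sum, mul_left_comm (P.dgZ M)]
  rw [← Finset.sum_add_distrib, ← Finset.sum_add_distrib]
  refine Finset.sum_congr rfl fun N hN => ?_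
  have hN : N ≤ P.n := by simpa [Nat.lt_succ_iff] using hN
  have e := hP.racP_dot hM hN
  have h3 := hP.x_ne dia
  have h6 := pow_ne_zero N hP.Q_ne
  -- The eigenvalue `r₀ θ^⋄_N` is the q-Racah eigenvalue shifted by `1 + x²` and divided by `x`,
  -- with `x` the parameter of `⋄`; the diagonal `dgZ` carries the same shift.
  have et : P.tauM N = ((((P.q ^ 2) ^ N)⁻¹ - 1) * (1 - P.x dia ^ 2 * (P.q ^ 2) ^ N) +
      1 + P.x dia ^ 2) / P.x dia := by
    rw [tauM, tau]; field_simp; ring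
  rw [hP.Pinv_eq hN, hP.Pinv_eq hN, hP.Pinv_eq hN, et, dgZ]
  linear_combination P.fRel M * ((P.ν₀ dia dot star)⁻¹ * P.wt N) * h N / P.x dia * e

/-- Irreducibility of the tridiagonal matrix, which lets a solution be propagated from `M` to `M +
1`. -/
lemma upZ_ne (hP : P.Admissible) {M : ℕ} (hM : M < P.n) : P.upZ M ≠ 0 := by
  have h6 := pow_ne_zero M hP.Q_ne
  have h7 := hP.Q_ne
  have s1 : ∀ j, 1 ≤ j → j < 2 * P.n → 1 - P.x dot ^ 2 * (P.q ^ 2) ^ j ≠ 0 :=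
    fun j h1 h2 => sub_ne_zero.2 (hP.spec' dot j h1 h2).symm
  have t1 := hP.qPoch_top (M + 1) (by omega)
  rw [qPoch_succ] at t1
  have t1 := (mul_ne_zero_iff.1 t1).2
  refine mul_ne_zero (mul_ne_zero ?_ (hP.dS_fac M hM)) (div_ne_zero (mul_ne_zero (mul_ne_zero
    (hP.x_ne _) hP.q_ne) h6) (hP.x_ne _))
  rw [awU, if_neg hM.ne]
  have hB := hP.dB_fac M hM
  rcases Nat.eq_zero_or_pos M with rfl | h0
  · rw [if_pos rfl]
    rw [pow_zero, mul_one] at hB t1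
    have := s1 1 le_rfl (by omega)
    rw [pow_one] at this
    exact div_ne_zero (mul_ne_zero hB t1) this
  · rw [if_neg h0.ne']
    refine div_ne_zero (mul_ne_zero (mul_ne_zero (s1 M h0 (by omega)) hB) t1) (mul_ne_zero ?_ ?_)
    · rw [← pow_mul]; exact s1 _ (by omega) (by omega)
    · rw [mul_assoc, ← pow_mul, ← pow_succ']; exact s1 _ (by omega) (by omega)

lemma row_sum_Z (hP : P.Admissible) {M : ℕ} (hM : M ≤ P.n) :
    P.upZ M + P.dnZ M + P.dgZ M =
      (P.x dia ^ 2 + P.dB + ((P.q ^ 2) ^ P.n)⁻¹) / P.x dia +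
        P.x star * P.q / P.x dot * (P.x dot ^ 2 * (P.q ^ 2) ^ M + ((P.q ^ 2) ^ M)⁻¹ - 1) := by
  have e : P.dB = -(P.x dot * P.x star * P.x dia * P.q * (P.q ^ 2) ^ P.n) := by
    rw [dB, ← pow_mul, pow_succ]; ring
  have h := hP.node dot P.dB hM
  rw [e] at h
  have := h.row_sum (hP.x_ne _) (hP.x_ne _) (hP.x_ne _) (pow_ne_zero _ hP.Q_ne)
    (pow_ne_zero _ hP.Q_ne)
  rw [← e] at this
  rw [upZ, dnZ, dgZ, dA, dS, e]
  rw [e] at this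
  linear_combination this

/-- Conjugation of the dual operator by `h` gives the interchanged operator. At `N = n` the factor
relation is not available, but the coefficient vanishes. -/
lemma upDia_hRel (hP : P.Admissible) {N : ℕ} (hN : N ≤ P.n) :
    P.upDia N * (P.hRel (N + 1))⁻¹ = awU (P.q ^ 2) (P.x dia ^ 2) P.dB P.n N *
      ((1 - P.dA / (P.x dia ^ 2 * P.q ^ 2 * (P.q ^ 2) ^ N)) * (P.hRel N)⁻¹) := by
  rcases hN.eq_or_lt with rfl | hlt
  · rw [upDia, awU_top]; ring
  · rw [mul_comm _ (P.hRel N)⁻¹, ← hP.hRel_succ hlt, upDia]; ring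

lemma dnDia_hRel (hP : P.Admissible) {N : ℕ} (hN : N ≤ P.n) :
    P.dnDia N * (P.hRel (N - 1))⁻¹ = awD (P.q ^ 2) (P.x dia ^ 2) P.dB P.n N *
      (P.x dia ^ 2 * (P.q ^ 2) ^ N * (1 - P.dA * (P.q ^ 2) ^ N / P.q ^ 2) * (P.hRel N)⁻¹) := by
  have h3 := hP.x_ne dia
  have h5 := hP.q_ne
  rcases N with _ | N
  · rw [dnDia, awD_zero]; ring
  · have h7 := pow_ne_zero N hP.Q_ne
    have := hP.hRel_succ hN
    rw [Nat.add_sub_cancel, dnDia, pow_succ _ N,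
      show 1 - P.dA * ((P.q ^ 2) ^ N * P.q ^ 2) / P.q ^ 2 = 1 - P.dA * (P.q ^ 2) ^ N by
        field_simp, mul_assoc (P.x dia ^ 2 * _), mul_comm _ (P.hRel (N + 1))⁻¹, this]
    field_simp

/-- The vector with dual coordinates `1 / h_N` has the same eigenvalue property as the constant
vector. -/
lemma apply_vecOf_hRel (hP : P.Admissible) {M : ℕ} (hM : M ≤ P.n) :
    P.vecOf (fun N => P.tauM N * (P.hRel N)⁻¹) M =
      (P.upZ M + P.dnZ M + P.dgZ M) * P.vecOf (fun N => (P.hRel N)⁻¹) M := by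
  have h2 := hP.x_ne star
  have h3 := hP.x_ne dia
  have h4 := hP.x_ne dot
  have h5 := hP.q_ne
  have key := hP.sum_Pinv_apply hM (fun N => (P.hRel N)⁻¹)
  have e : ∀ N ∈ Finset.range (P.n + 1), P.Pinv dia dot star M N *
      (P.upDia N * ((P.hRel (N + 1))⁻¹ - (P.hRel N)⁻¹) +
        P.dnDia N * ((P.hRel (N - 1))⁻¹ - (P.hRel N)⁻¹)) =
      P.Pinv dia dot star M N * (P.x dot / (P.x star * P.q) * (P.tauM N * (P.hRel N)⁻¹)) +
      P.Pinv dia dot star M N * ((-(P.x dot ^ 2) - P.x dot / (P.x star * P.x dia * P.q) *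
        (P.x dia ^ 2 + P.dB + ((P.q ^ 2) ^ P.n)⁻¹)) * (P.hRel N)⁻¹) := by
    intro N hN
    have hN : N ≤ P.n := by simpa [Nat.lt_succ_iff] using hN
    have h6 := pow_ne_zero N hP.Q_ne
    -- On `1 / h_N` the dual operator becomes the interchanged operator on constants, whose value is
    -- affine in `tauM N`. The left eigenvalue equation thereby expresses the pairing with `tauM /
    -- h` by the pairing with `1 / h`.
    have a := (hP.node dia P.dB hN).apply_one' hP.Q_ne (pow_ne_zero _ h3) h6 P.dA
    rw [hP.dABC_neg, qPair_succ, qPair_zero] at a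
    have u := hP.upDia_hRel hN
    have d := hP.dnDia_hRel hN
    rw [← mul_add]
    congr 1
    have ed : P.dA = -(P.x dot * P.x dia * P.q / P.x star) := rfl
    have t : P.tauM N = P.x dia * (P.q ^ 2) ^ N + (P.x dia * (P.q ^ 2) ^ N)⁻¹ := rfl
    rw [show ∀ a b c d e : ℂ, a * (b - c) + d * (e - c) = a * b + d * e - (a + d) * c by
      intros; ring, u, d]
    trans (P.hRel N)⁻¹ * (P.dA / (P.x dia ^ 2 * P.q ^ 2) * ((1 - ((P.q ^ 2) ^ N)⁻¹ *
        (P.q ^ 2) ^ 0) * (1 - P.x dia ^ 2 * (P.q ^ 2) ^ N * (P.q ^ 2) ^ 0) * 1) +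
        (-P.x dot ^ 2 + P.dA / (P.x dia ^ 2 * P.q ^ 2) *
          (P.dB + ((P.q ^ 2) ^ P.n)⁻¹ - 1)))
    · rw [← a, upDia, dnDia]; ring
    · rw [t, ed]
      have h8 := pow_ne_zero P.n hP.Q_ne
      generalize P.dB = b
      generalize (P.hRel N)⁻¹ = f
      field_simp
      ring
  rw [Finset.sum_congr rfl e, Finset.sum_add_distrib] at key
  rw [hP.row_sum_Z hM, vecOf, vecOf]
  have h6 := pow_ne_zero M hP.Q_ne
  have key' : P.x dot / (P.x star * P.q) * ∑ N ∈ Finset.range (P.n + 1), P.Pinv dia dot star M N *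
        (P.tauM N * (P.hRel N)⁻¹) + (-(P.x dot ^ 2) - P.x dot / (P.x star * P.x dia * P.q) *
        (P.x dia ^ 2 + P.dB + ((P.q ^ 2) ^ P.n)⁻¹)) * ∑ N ∈ Finset.range (P.n + 1),
        P.Pinv dia dot star M N * (P.hRel N)⁻¹ =
      (((P.q ^ 2) ^ M)⁻¹ - 1) * (1 - P.x dot ^ 2 * (P.q ^ 2) ^ M) *
        ∑ N ∈ Finset.range (P.n + 1), P.Pinv dia dot star M N * (P.hRel N)⁻¹ := by
    rw [← key, Finset.mul_sum, Finset.mul_sum]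
    simp only [mul_left_comm (P.Pinv dia dot star M _)]
  generalize ∑ N ∈ Finset.range (P.n + 1), P.Pinv dia dot star M N *
        (P.tauM N * (P.hRel N)⁻¹) = S at *
  generalize ∑ N ∈ Finset.range (P.n + 1), P.Pinv dia dot star M N * (P.hRel N)⁻¹ = T at *
  have : S = P.x star * P.q / P.x dot * (P.x dot / (P.x star * P.q) * S) := by field_simp
  rw [this, eq_sub_of_add_eq key']
  generalize ((P.q ^ 2) ^ P.n)⁻¹ = c
  field_simp
  ring

/-- Since `A^⋄` acts on this vector through its row sums, the three-term relation becomes `upZ M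
(v_{M+1} - v_M) + dnZ M (v_{M-1} - v_M) = 0`. With `dnZ 0 = 0` and `upZ M ≠ 0` all differences
vanish in turn. -/
lemma vecOf_hRel_const (hP : P.Admissible) {M : ℕ} (hM : M ≤ P.n) :
    P.vecOf (fun N => (P.hRel N)⁻¹) M = P.vecOf (fun N => (P.hRel N)⁻¹) 0 := by
  induction M using Nat.strong_induction_on with
  | _ M ih =>
    rcases M with _ | M
    · rfl
    · have a := hP.apply_vecOf (M := M) (by omega) (fun N => (P.hRel N)⁻¹)
      rw [hP.apply_vecOf_hRel (by omega), ih M (by omega) (by omega),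
        ih (M - 1) (by omega) (by omega)] at a
      refine mul_left_cancel₀ (hP.upZ_ne (M := M) (by omega)) ?_
      linear_combination a

end Admissible

end Params

end

end BelliardSlavnov

/-! ### Normalization of the second reference state -/

namespace BelliardSlavnov

noncomputable section

namespace Params

open Label

namespace Admissible

variable {P : Params}

lemma hRel_inv_mul_prod (hP : P.Admissible) {N : ℕ} (hN : N ≤ P.n) :
    (P.hRel N)⁻¹ * (∏ j ∈ Finset.range N, (1 - P.dA * (P.q ^ 2) ^ j)) =
      ∏ j ∈ Finset.range N, (1 - P.dA / (P.x dia ^ 2 * P.q ^ 2 * (P.q ^ 2) ^ j)) := by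
  induction N with
  | zero => simp [hRel]
  | succ N ih =>
    rw [Finset.prod_range_succ, Finset.prod_range_succ, ← ih (by omega)]
    linear_combination (∏ j ∈ Finset.range N, (1 - P.dA * (P.q ^ 2) ^ j)) *
      hP.hRel_succ (show N < P.n by omega)

/-- Division by `h_N` replaces the parameter `dA` of the well-poised series by `0`. The homogeneous
coordinates `γ, δ` are there to allow this value, so that one summation formula serves both sums. -/
lemma wt_mul_hRel_inv (hP : P.Admissible) {N : ℕ} (hN : N ≤ P.n) :
    P.wt N * (P.hRel N)⁻¹ = vwpTerm (P.q ^ 2) (P.x dia ^ 2) P.dB 0 1 P.n N := by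
  have h3 := hP.x_ne dia
  have hQ := hP.Q_ne
  have h := hP.hRel_inv_mul_prod hN
  have e : ∏ j ∈ Finset.range N, (P.dA - P.x dia ^ 2 * (P.q ^ 2) ^ (j + 1) * 1) =
      (∏ j ∈ Finset.range N, (1 - P.dA / (P.x dia ^ 2 * P.q ^ 2 * (P.q ^ 2) ^ j))) *
        ∏ j ∈ Finset.range N, (0 - P.x dia ^ 2 * (P.q ^ 2) ^ (j + 1) * 1) := by
    rw [← Finset.prod_mul_distrib]
    refine Finset.prod_congr rfl fun j _ => ?_
    have := pow_ne_zero j hQ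
    have hq := hP.q_ne
    rw [pow_succ]
    field_simp
    ring
  have h0 : ∏ j ∈ Finset.range N, (P.dA - P.x dia ^ 2 * (P.q ^ 2) ^ (j + 1) * 1) ≠ 0 :=
    Finset.prod_ne_zero_iff.2 fun j hj => by
      rw [mul_one]; exact hP.dA_fac' j (by have := Finset.mem_range.1 hj; omega)
  rw [e] at h0
  obtain ⟨h1, h2⟩ := mul_ne_zero_iff.1 h0
  rw [wt, vwpTerm, vwpTerm, e]
  simp only [zero_mul, sub_zero, Finset.prod_const_one]
  simp only [zero_sub] at h2 ⊢
  generalize ∏ j ∈ Finset.range N, -(P.x dia ^ 2 * (P.q ^ 2) ^ (j + 1) * 1) = g at *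
  rw [← h] at h1 ⊢
  generalize ∏ j ∈ Finset.range N, (1 - P.dA * (P.q ^ 2) ^ j) = f at *
  obtain ⟨h4, h5⟩ := mul_ne_zero_iff.1 h1
  generalize (P.hRel N)⁻¹ = k at *
  simp only [div_eq_mul_inv, mul_inv, mul_one]
  trans (k * f * (f⁻¹ * k⁻¹)) * (qPoch (P.x dia ^ 2) (P.q ^ 2) N * qPoch P.dB (P.q ^ 2) N *
    qPoch ((P.q ^ 2) ^ P.n)⁻¹ (P.q ^ 2) N * ((qPoch (P.q ^ 2) (P.q ^ 2) N)⁻¹ *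
    (qPoch (P.x dia ^ 2 * P.q ^ 2 * P.dB⁻¹) (P.q ^ 2) N)⁻¹ * g⁻¹ *
    (qPoch (P.x dia ^ 2 * (P.q ^ 2) ^ (P.n + 1)) (P.q ^ 2) N)⁻¹) *
    ((1 - P.x dia ^ 2 * (P.q ^ 2) ^ (2 * N)) * (1 - P.x dia ^ 2)⁻¹) *
    (P.x dia ^ 2 * (P.q ^ 2) ^ (P.n + 1) * P.dB⁻¹) ^ N)
  · ring
  · rw [← mul_inv_rev, mul_inv_cancel₀ h1]
    ring

lemma sum_wt_hRel (hP : P.Admissible) :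
    ∑ N ∈ Finset.range (P.n + 1), P.wt N * (P.hRel N)⁻¹ =
      qPoch (P.x dia ^ 2 * P.q ^ 2) (P.q ^ 2) P.n /
        (P.dB ^ P.n * qPoch (P.x dia ^ 2 * P.q ^ 2 / P.dB) (P.q ^ 2) P.n) := by
  have hx := hP.x_ne dia
  have h := vwp_sum (Q := P.q ^ 2) (a := P.x dia ^ 2) (b := P.dB) (γ := 0) (δ := 1) (N := P.n)
    hP.Q_ne hP.dB_ne hP.Q_pow_ne hP.spec_dia hP.dB_fac' (fun j _ => by
      rw [zero_sub, mul_one]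
      exact neg_ne_zero.2 (mul_ne_zero (pow_ne_zero _ hx) (pow_ne_zero _ hP.Q_ne)))
  rw [Finset.sum_congr rfl fun N hN =>
    hP.wt_mul_hRel_inv (by simpa [Nat.lt_succ_iff] using hN)]
  have e : ∏ j ∈ Finset.range P.n, (0 - P.x dia ^ 2 * (P.q ^ 2) ^ (j + 1) * 1 / P.dB) =
      (P.dB ^ P.n)⁻¹ * ∏ j ∈ Finset.range P.n, (0 - P.x dia ^ 2 * (P.q ^ 2) ^ (j + 1) * 1) := by
    rw [← inv_pow, ← Finset.card_range P.n, ← Finset.prod_const, Finset.card_range,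
      ← Finset.prod_mul_distrib]
    exact Finset.prod_congr rfl fun j _ => by ring
  have h0 : ∏ j ∈ Finset.range P.n, (0 - P.x dia ^ 2 * (P.q ^ 2) ^ (j + 1) * 1) ≠ 0 :=
    Finset.prod_ne_zero_iff.2 fun j _ => by
      rw [zero_sub, mul_one]
      exact neg_ne_zero.2 (mul_ne_zero (pow_ne_zero _ hx) (pow_ne_zero _ hP.Q_ne))
  rw [e] at h
  have h1 := hP.vwp_hyp_dB
  have h2 := pow_ne_zero P.n hP.dB_ne
  refine mul_right_cancel₀ (mul_ne_zero h1 h0) (h.trans ?_)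
  field_simp

lemma vecOf_hRel_zero (hP : P.Admissible) :
    P.vecOf (fun N => (P.hRel N)⁻¹) 0 =
      ((P.x star * P.x dia / P.x dot) ^ P.n * P.q ^ (P.n ^ 2))⁻¹ *
        qPoch (-(P.q * (P.x star * P.x dia / P.x dot))) (P.q ^ 2) P.n /
      qPoch (P.x dot ^ 2 * P.q ^ 2) (P.q ^ 2) P.n := by
  have e : ∑ N ∈ Finset.range (P.n + 1), P.Pinv dia dot star 0 N * (P.hRel N)⁻¹ =
      (P.ν₀ dia dot star)⁻¹ * ∑ N ∈ Finset.range (P.n + 1), P.wt N * (P.hRel N)⁻¹ := by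
    rw [Finset.mul_sum]
    refine Finset.sum_congr rfl fun N hN => ?_
    rw [hP.Pinv_eq (by simpa [Nat.lt_succ_iff] using hN), hP.racP_zero]
    ring
  rw [vecOf, e, hP.sum_wt_hRel, hP.ν₀_eq, fRel, Finset.range_zero, Finset.prod_empty, one_mul]
  have h1 := hP.vwp_hyp_dB
  have h2 := pow_ne_zero P.n hP.dB_ne
  have h3 := hP.qPoch_sq dia
  have h4 := hP.qPoch_sq dot
  generalize ((P.x star * P.x dia / P.x dot) ^ P.n * P.q ^ (P.n ^ 2))⁻¹ = c
  field_simp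

lemma ν₀_star_eq (hP : P.Admissible) :
    P.ν₀ star dia dot = qPoch (P.x star ^ 2 * P.q ^ 2) (P.q ^ 2) P.n *
        qPoch (P.x dia ^ 2 * P.q ^ 2) (P.q ^ 2) P.n /
      (P.dB ^ P.n * (((P.x dot * P.x dia / P.x star) ^ P.n * P.q ^ (P.n ^ 2))⁻¹ *
          qPoch (-(P.q * (P.x dot * P.x dia / P.x star))) (P.q ^ 2) P.n) *
        (((P.x dot * P.x star / P.x dia) ^ P.n * P.q ^ (P.n ^ 2))⁻¹ *
          qPoch (-(P.q * (P.x dot * P.x star / P.x dia))) (P.q ^ 2) P.n)) := by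
  have h1 := hP.r₀_ne
  have h2 := hP.x_ne star
  have h3 := hP.x_ne dia
  have h4 := hP.x_ne dot
  have h5 := hP.q_ne
  rw [ν₀, hP.b_div_c, hP.b_div_c, ← qPoch_reflect h5 (div_ne_zero (mul_ne_zero h4 h3) h2),
    ← qPoch_reflect h5 (div_ne_zero (mul_ne_zero h4 h2) h3)]
  rw [show -(P.b dia * P.b dot / P.c star) * P.r₀ * P.q ^ (2 * P.n + 1) = P.dB by
      rw [hP.b_eq, hP.b_eq, hP.c_eq, dB]; field_simp,
    show -(P.b star * P.c dot / P.b dia) * P.r₀ * P.q ^ (1 - 2 * P.n : ℤ) =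
        -((P.x dot * P.x dia / P.x star)⁻¹ * P.q ^ (1 - 2 * P.n : ℤ)) by
      rw [hP.b_eq, hP.c_eq, hP.b_eq]; field_simp,
    show -(P.c star * P.c dot / P.c dia) * P.r₀ * P.q ^ (1 - 2 * P.n : ℤ) =
        -((P.x dot * P.x star / P.x dia)⁻¹ * P.q ^ (1 - 2 * P.n : ℤ)) by
      rw [hP.c_eq, hP.c_eq, hP.c_eq]; field_simp]

/-- The reference states are compatible: the constant vector, in the eigenbasis of `A`, is a
multiple of the vector with dual coordinates `1 / h_N`. -/
lemma fgh_mul_vecOf_hRel (hP : P.Admissible) {M : ℕ} (hM : M ≤ P.n) :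
    P.fgh / P.ν₀ star dia dot * P.vecOf (fun N => (P.hRel N)⁻¹) M = 1 := by
  have h2 := hP.x_ne star
  have h3 := hP.x_ne dia
  have h4 := hP.x_ne dot
  have h5 := hP.q_ne
  have e : ∀ a, P.q ^ 2 * P.r₀ ^ 2 * P.b a ^ 2 = P.x a ^ 2 * P.q ^ 2 := fun a => by
    rw [x]; ring
  have e1 : P.q * P.r₀ * P.b dot * P.b dia / P.b star =
      P.q * (P.x dot * P.x dia / P.x star) := by
    have := hP.r₀_ne; have := hP.b_ne star; rw [x, x, x]; field_simp
  have e2 : P.q * P.r₀ * P.b dot * P.b star / P.b dia =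
      P.q * (P.x dot * P.x star / P.x dia) := by
    have := hP.r₀_ne; have := hP.b_ne dia; rw [x, x, x]; field_simp
  have e3 : P.q * P.r₀ * P.b dia * P.b star / P.b dot =
      P.q * (P.x star * P.x dia / P.x dot) := by
    have := hP.r₀_ne; have := hP.b_ne dot; rw [x, x, x]; field_simp
  rw [hP.vecOf_hRel_const hM, hP.vecOf_hRel_zero, hP.ν₀_star_eq, fgh, e, e, e, e1, e2, e3]
  have n1 := hP.qPoch_star_dia
  have n2 := hP.qPoch_dot_dia
  have n3 := hP.qPoch_dot_star
  have n4 := hP.qPoch_sq dot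
  have n5 := hP.qPoch_sq star
  have n6 := hP.qPoch_sq dia
  have n7 := pow_ne_zero P.n hP.dB_ne
  have n8 := pow_ne_zero P.n (div_ne_zero (mul_ne_zero h2 h3) h4)
  have n9 := pow_ne_zero P.n (div_ne_zero (mul_ne_zero h4 h3) h2)
  have n10 := pow_ne_zero P.n (div_ne_zero (mul_ne_zero h4 h2) h3)
  have n11 := pow_ne_zero (P.n ^ 2) h5
  -- After the Pochhammer symbols cancel, only signs and powers of `q` and of the parameters remain;
  -- the exponent count is `n(n-1) + n(2n+1) = 3n²`.
  have key : (-1) ^ P.n * P.q ^ (P.n * (P.n - 1)) * P.dB ^ P.n =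
      (P.x star * P.x dia / P.x dot) ^ P.n * (P.x dot * P.x dia / P.x star) ^ P.n *
        (P.x dot * P.x star / P.x dia) ^ P.n * (P.q ^ (P.n ^ 2)) ^ 3 := by
    rw [dB, neg_pow (P.x dot * P.x star * P.x dia * P.q ^ (2 * P.n + 1)),
      mul_pow _ (P.q ^ (2 * P.n + 1)),
      ← mul_pow (P.x star * P.x dia / P.x dot), ← mul_pow (_ * (P.x dot * P.x dia / P.x star)),
      show P.x star * P.x dia / P.x dot * (P.x dot * P.x dia / P.x star) *
        (P.x dot * P.x star / P.x dia) = P.x dot * P.x star * P.x dia by field_simp]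
    have e4 : P.q ^ (P.n * (P.n - 1)) * (P.q ^ (2 * P.n + 1)) ^ P.n = (P.q ^ (P.n ^ 2)) ^ 3 := by
      rw [← pow_mul, ← pow_mul, ← pow_add]
      congr 1
      rcases P.n with _ | n
      · rfl
      · rw [Nat.add_sub_cancel]; ring
    rw [← e4]
    have e5 : ((-1 : ℂ) ^ P.n) * (-1) ^ P.n = 1 := by rw [← mul_pow]; simp
    linear_combination P.q ^ (P.n * (P.n - 1)) * (P.q ^ (2 * P.n + 1)) ^ P.n *
      (P.x dot * P.x star * P.x dia) ^ P.n * e5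
  clear e e1 e2 e3
  generalize qPoch (-(P.q * (P.x star * P.x dia / P.x dot))) (P.q ^ 2) P.n = p₁ at *
  generalize qPoch (-(P.q * (P.x dot * P.x dia / P.x star))) (P.q ^ 2) P.n = p₂ at *
  generalize qPoch (-(P.q * (P.x dot * P.x star / P.x dia))) (P.q ^ 2) P.n = p₃ at *
  generalize qPoch (P.x dot ^ 2 * P.q ^ 2) (P.q ^ 2) P.n = p₄ at *
  generalize qPoch (P.x star ^ 2 * P.q ^ 2) (P.q ^ 2) P.n = p₅ at *
  generalize qPoch (P.x dia ^ 2 * P.q ^ 2) (P.q ^ 2) P.n = p₆ at *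
  generalize (P.x star * P.x dia / P.x dot) ^ P.n = t₁ at *
  generalize (P.x dot * P.x dia / P.x star) ^ P.n = t₂ at *
  generalize (P.x dot * P.x star / P.x dia) ^ P.n = t₃ at *
  generalize P.dB ^ P.n = b at *
  generalize P.q ^ (P.n ^ 2) = c at *
  field_simp
  linear_combination key

end Admissible

end Params

end

end BelliardSlavnov

/-! ### The coefficients of `Y_ε` at a generic point -/

namespace BelliardSlavnov

noncomputable section

namespace Params

open Label

/-- The spectral variable `q u² + q⁻¹ u⁻²`. -/
def specV (P : Params) (u : ℂ) : ℂ := tau P.q (u ^ 2)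

/-- The grid variable `w` with `x^⋄ w = q⁻¹ u⁻²`. -/
def gridW (P : Params) (u : ℂ) : ℂ := (P.x dia * P.q * u ^ 2)⁻¹

/-- The common part of the coefficients `B` of the Askey–Wilson operator at a generic point. -/
def genU (P : Params) (u : ℂ) : ℂ :=
  (1 - P.x dia ^ 2 * P.gridW u) * (1 - P.dB * P.gridW u) *
    (1 - ((P.q ^ 2) ^ P.n)⁻¹ * P.gridW u) /
  ((1 - P.x dia ^ 2 * P.gridW u ^ 2) * (1 - P.x dia ^ 2 * P.q ^ 2 * P.gridW u ^ 2))

/-- The common part of the coefficients `D` of the Askey–Wilson operator at a generic point. -/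
def genD (P : Params) (u : ℂ) : ℂ :=
  (1 - P.gridW u) * (P.x dia ^ 2 * P.gridW u - P.dB) *
    (P.x dia ^ 2 * P.gridW u - ((P.q ^ 2) ^ P.n)⁻¹) /
  (P.x dia ^ 2 * (1 - P.x dia ^ 2 * P.gridW u ^ 2) * (P.x dia ^ 2 * P.gridW u ^ 2 - P.q ^ 2))

lemma bf_mul_bf {a c : ℂ} (ha : a ≠ 0) (hc : c ≠ 0) :
    bf a * bf c = a * c + (a * c)⁻¹ - (a / c + (a / c)⁻¹) := by
  rw [bf, bf]; field_simp; ring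

namespace Admissible

variable {P : Params} {u : ℂ}

lemma tau_gridW (hP : P.Admissible) : tau (P.x dia) (P.gridW u) = P.specV u := by
  have h := hP.x_ne dia
  rw [tau, specV, tau, gridW, show P.x dia * (P.x dia * P.q * u ^ 2)⁻¹ = (P.q * u ^ 2)⁻¹ by
    field_simp, inv_inv, add_comm]

/-- The shifts of `u` by `q` in `Y_ε` are the shifts of the grid variable by `Q = q²`, in the
opposite direction. Together with `tau_gridW` this identifies `Y_ε` with an operator in the variable
`w`. -/
lemma gridW_div (hP : P.Admissible) : P.gridW (u / P.q) = P.q ^ 2 * P.gridW u := by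
  have h := hP.q_ne
  rw [gridW, gridW, div_pow]
  simp only [mul_inv, div_eq_mul_inv, inv_inv]
  ring

lemma gridW_mul (P : Params) : P.gridW (P.q * u) = P.gridW u / P.q ^ 2 := by
  rw [gridW, gridW, mul_pow]
  simp only [mul_inv, div_eq_mul_inv]
  ring

lemma gridW_ne (hP : P.Admissible) (hu : u ≠ 0) : P.gridW u ≠ 0 :=
  inv_ne_zero (mul_ne_zero (mul_ne_zero (hP.x_ne _) hP.q_ne) (pow_ne_zero _ hu))

/-- A product `b(a) b(c)` depends only on `a c` and `a / c`, hence it is a difference of two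
spectral values. All products in `Y_ε` and `g` thus become values of polynomials with roots `specV
v_i`. -/
lemma bf_mul_bf_down (hP : P.Admissible) {v : ℂ} (hu : u ≠ 0) (hv : v ≠ 0) :
    bf (u / (P.q * v)) * bf (u * v) = P.specV (u / P.q) - P.specV v := by
  have := hP.q_ne
  rw [bf_mul_bf (div_ne_zero hu (mul_ne_zero this hv)) (mul_ne_zero hu hv), specV, specV, tau, tau]
  field_simp
  ring

lemma bf_mul_bf_up (hP : P.Admissible) {v : ℂ} (hu : u ≠ 0) (hv : v ≠ 0) :
    bf (P.q * u / v) * bf (P.q ^ 2 * u * v) = P.specV (P.q * u) - P.specV v := by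
  have := hP.q_ne
  rw [bf_mul_bf (div_ne_zero (mul_ne_zero this hu) hv)
    (mul_ne_zero (mul_ne_zero hP.Q_ne hu) hv), specV, specV, tau, tau]
  field_simp
  ring

lemma g_eq (hP : P.Admissible) {v : ℂ} (hu : u ≠ 0) (hv : v ≠ 0) :
    P.g u v = (P.specV u - P.specV v)⁻¹ := by
  have := hP.q_ne
  rw [g, bf_mul_bf (div_ne_zero hu hv) (mul_ne_zero (mul_ne_zero this hu) hv), specV, specV, tau,
    tau]
  congr 1
  field_simp
  ring

lemma ζ_sq (hP : P.Admissible) : P.ζ ^ 2 = (P.x dia * P.q ^ P.n)⁻¹ := by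
  have h1 := hP.r₀_ne
  have h2 := hP.x_ne dia
  have h3 := pow_ne_zero P.n hP.q_ne
  rw [hP.ζ_c, hP.c_eq]
  field_simp

/-- The product is invariant under `ζ → -ζ`, so only `ζ²` enters, and `ζ²` is expressed by the
parameter of `⋄`. -/
lemma ζ_mul (hP : P.Admissible) (a c : ℂ) :
    (a * P.ζ⁻¹ - c * P.ζ) * (a * P.ζ - c * P.ζ⁻¹) =
      (a - c * (P.x dia * P.q ^ P.n)⁻¹) * (a - c * (P.x dia * P.q ^ P.n)) := by
  have h1 := hP.ζ_ne
  have h2 := hP.x_ne dia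
  have h3 := pow_ne_zero P.n hP.q_ne
  have h4 := hP.ζ_sq
  have h5 : (P.ζ⁻¹) ^ 2 = P.x dia * P.q ^ P.n := by rw [inv_pow, h4, inv_inv]
  have h6 : P.ζ⁻¹ * P.ζ = 1 := inv_mul_cancel₀ h1
  have h7 : (P.x dia * P.q ^ P.n)⁻¹ * (P.x dia * P.q ^ P.n) = 1 :=
    inv_mul_cancel₀ (mul_ne_zero h2 h3)
  linear_combination (a ^ 2 + c ^ 2) * h6 - a * c * h4 - a * c * h5 - c ^ 2 * h7

lemma den₀_eq (hu : u ≠ 0) : bf (u ^ 2) = (u ^ 4 - 1) / u ^ 2 := by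
  rw [bf]; field_simp

lemma den₁_eq (hP : P.Admissible) (hu : u ≠ 0) :
    bf (P.q * u ^ 2) = (P.q ^ 2 * u ^ 4 - 1) / (P.q * u ^ 2) := by
  have := hP.q_ne
  rw [bf]; field_simp

lemma den₂_eq (hP : P.Admissible) (hu : u ≠ 0) :
    bf (P.q ^ 2 * u ^ 2) = (P.q ^ 4 * u ^ 4 - 1) / (P.q ^ 2 * u ^ 2) := by
  have := hP.q_ne
  rw [bf]; field_simp

lemma genU_eq (hP : P.Admissible) (hu : u ≠ 0) :
    P.genU u = (1 - P.x dia / (P.q * u ^ 2)) *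
        (1 + P.x dot * P.x star * (P.q ^ P.n) ^ 2 / u ^ 2) *
        (1 - (P.x dia * P.q * (P.q ^ P.n) ^ 2 * u ^ 2)⁻¹) * (P.q ^ 2 * u ^ 8) /
      ((P.q ^ 2 * u ^ 4 - 1) * (u ^ 4 - 1)) := by
  have h1 := hP.q_ne
  have h2 := hP.x_ne dia
  have h3 := pow_ne_zero P.n hP.q_ne
  have e1 : 1 - P.x dia ^ 2 * P.gridW u ^ 2 = (P.q ^ 2 * u ^ 4 - 1) / (P.q ^ 2 * u ^ 4) := by
    rw [gridW]; field_simp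
  have e2 : 1 - P.x dia ^ 2 * P.q ^ 2 * P.gridW u ^ 2 = (u ^ 4 - 1) / u ^ 4 := by
    rw [gridW]; field_simp
  rw [genU, e1, e2, gridW, dB, pow_succ P.q (2 * P.n), mul_comm 2 P.n, pow_mul P.q P.n 2,
    ← pow_mul P.q 2 P.n, mul_comm 2 P.n, pow_mul P.q P.n 2]
  generalize P.q ^ 2 * u ^ 4 - 1 = f
  generalize u ^ 4 - 1 = g
  generalize P.q ^ P.n = t at *
  -- If a denominator vanishes both sides are zero by the convention for division, so no genericity
  -- of `u` is needed.
  by_cases hf : f = 0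
  · simp [hf]
  by_cases hg : g = 0
  · simp [hg]
  field_simp
  ring

lemma genD_eq (hP : P.Admissible) (hu : u ≠ 0) :
    P.genD u = -((1 - (P.x dia * P.q * u ^ 2)⁻¹) *
        (P.x dia / (P.q * u ^ 2) + P.x dot * P.x star * P.x dia * P.q * (P.q ^ P.n) ^ 2) *
        (P.x dia / (P.q * u ^ 2) - ((P.q ^ P.n) ^ 2)⁻¹) * (P.q ^ 4 * u ^ 8)) /
      (P.x dia ^ 2 * (P.q ^ 2 * u ^ 4 - 1) * (P.q ^ 4 * u ^ 4 - 1)) := by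
  have h1 := hP.q_ne
  have h2 := hP.x_ne dia
  have h3 := pow_ne_zero P.n hP.q_ne
  have e1 : 1 - P.x dia ^ 2 * P.gridW u ^ 2 = (P.q ^ 2 * u ^ 4 - 1) / (P.q ^ 2 * u ^ 4) := by
    rw [gridW]; field_simp
  have e2 : P.x dia ^ 2 * P.gridW u ^ 2 - P.q ^ 2 =
      -((P.q ^ 4 * u ^ 4 - 1) / (P.q ^ 2 * u ^ 4)) := by
    rw [gridW]; field_simp; ring
  rw [genD, e1, e2, gridW, dB, pow_succ P.q (2 * P.n), mul_comm 2 P.n, pow_mul P.q P.n 2,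
    ← pow_mul P.q 2 P.n, mul_comm 2 P.n, pow_mul P.q P.n 2]
  generalize P.q ^ 2 * u ^ 4 - 1 = f
  generalize P.q ^ 4 * u ^ 4 - 1 = g
  generalize P.q ^ P.n = t at *
  by_cases hf : f = 0
  · simp [hf]
  by_cases hg : g = 0
  · simp [hg]
  field_simp
  ring

lemma AWCoef_gen (hP : P.Admissible) (hu : u ≠ 0) (h₀ : bf (u ^ 2) ≠ 0)
    (h₁ : bf (P.q * u ^ 2) ≠ 0) (h₂ : bf (P.q ^ 2 * u ^ 2) ≠ 0) :
    AWCoef (P.q ^ 2) (P.x dia ^ 2) P.dB ((P.q ^ 2) ^ P.n)⁻¹ (P.gridW u) (P.genU u) (P.genD u) := by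
  have hq := hP.q_ne
  have hx := hP.x_ne dia
  rw [den₀_eq hu] at h₀
  rw [hP.den₁_eq hu] at h₁
  rw [hP.den₂_eq hu] at h₂
  replace h₀ := (div_ne_zero_iff.1 h₀).1
  replace h₁ := (div_ne_zero_iff.1 h₁).1
  replace h₂ := (div_ne_zero_iff.1 h₂).1
  refine Or.inl ⟨?_, ?_, ?_, rfl, rfl⟩
  · contrapose! h₁
    rw [gridW] at h₁
    field_simp at h₁
    linear_combination h₁
  · contrapose! h₀
    rw [gridW] at h₀
    field_simp at h₀
    linear_combination h₀
  · contrapose! h₂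
    rw [gridW] at h₂
    field_simp at h₂
    linear_combination -h₂

/-- The first coefficient of `Y_ε`, up to the last factor of `Λ₁^ε`. -/
lemma coef₁ (hP : P.Admissible) (hu : u ≠ 0) (f : ℂ) (k : ℤ) :
    u ^ (2 * k + 1) * (P.q ^ (-(P.n : ℤ) - 1) / u ^ k *
      (P.q ^ (P.n + 1) * u * P.ζ⁻¹ - u⁻¹ * P.ζ) * (P.q ^ (P.n + 1) * u * P.ζ - u⁻¹ * P.ζ⁻¹) *
      (u * P.c star * (P.q ^ P.n)⁻¹ + u⁻¹ * P.b dot * P.q ^ P.n) * f) /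
      (bf (u ^ 2) * bf (P.q * u ^ 2)) =
    P.genU u * (u ^ k * f / (P.r₀ * P.x star)) := by
  have h1 := hP.q_ne
  have h2 := hP.x_ne dia
  have h4 := hP.x_ne star
  have h5 := hP.r₀_ne
  have h3 := pow_ne_zero P.n hP.q_ne
  have h6 := zpow_ne_zero k hu
  have e := hP.ζ_mul (P.q ^ (P.n + 1) * u) u⁻¹
  rw [mul_assoc (P.q ^ (-(P.n : ℤ) - 1) / u ^ k) _ _, e, hP.genU_eq hu, den₀_eq hu, hP.den₁_eq hu,
    hP.c_eq, hP.b_eq, zpow_add₀ hu, two_mul, zpow_add₀ hu, zpow_one, pow_succ P.q P.n,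
    zpow_sub₀ h1, zpow_neg, zpow_natCast, zpow_one]
  clear e
  generalize P.q ^ 2 * u ^ 4 - 1 = f₁
  generalize u ^ 4 - 1 = f₀
  generalize P.q ^ P.n = t at *
  by_cases hf : f₁ = 0
  · simp [hf]
  by_cases hg : f₀ = 0
  · simp [hg]
  field_simp

/-- The second coefficient of `Y_ε`, up to the last factor of `Λ₂^ε`. -/
lemma coef₂ (hP : P.Admissible) (hu : u ≠ 0) (h₀ : bf (u ^ 2) ≠ 0) (f : ℂ) (k : ℤ) :
    P.q ^ (-k - 1) * u⁻¹ * ((u ^ 2 - (u ^ 2)⁻¹) * P.q ^ (-(P.n : ℤ) - 1) /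
      (u ^ k * (P.q * u ^ 2 - P.q⁻¹ * (u ^ 2)⁻¹)) *
      (P.q ^ ((P.n : ℤ) - 1) * u⁻¹ * P.ζ - u * P.ζ⁻¹) *
      (P.q ^ ((P.n : ℤ) - 1) * u⁻¹ * P.ζ⁻¹ - u * P.ζ) *
      (P.q ^ 2 * u * P.b dot * P.q ^ P.n + u⁻¹ * P.c star * (P.q ^ P.n)⁻¹) * f) /
      (bf (u ^ 2) * bf (P.q ^ 2 * u ^ 2)) =
    P.genD u * ((P.q * u) ^ (-k) * f * P.x dia / (P.r₀ * P.x star * P.q ^ 2 * u ^ 2)) := by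
  have h1 := hP.q_ne
  have h2 := hP.x_ne dia
  have h4 := hP.x_ne star
  have h5 := hP.r₀_ne
  have h3 := pow_ne_zero P.n hP.q_ne
  have h6 := zpow_ne_zero k hu
  have h7 := zpow_ne_zero k h1
  have e := hP.ζ_mul u (P.q ^ ((P.n : ℤ) - 1) * u⁻¹)
  have e' : (P.q ^ ((P.n : ℤ) - 1) * u⁻¹ * P.ζ - u * P.ζ⁻¹) *
      (P.q ^ ((P.n : ℤ) - 1) * u⁻¹ * P.ζ⁻¹ - u * P.ζ) = 
      (u * P.ζ⁻¹ - P.q ^ ((P.n : ℤ) - 1) * u⁻¹ * P.ζ) *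
      (u * P.ζ - P.q ^ ((P.n : ℤ) - 1) * u⁻¹ * P.ζ⁻¹) := by ring
  have e₁ : P.q * u ^ 2 - P.q⁻¹ * (u ^ 2)⁻¹ = (P.q ^ 2 * u ^ 4 - 1) / (P.q * u ^ 2) := by
    field_simp
  have e₀ : u ^ 2 - (u ^ 2)⁻¹ = (u ^ 4 - 1) / u ^ 2 := by field_simp
  rw [mul_assoc ((u ^ 2 - (u ^ 2)⁻¹) * P.q ^ (-(P.n : ℤ) - 1) / _) _ _, e', e, hP.genD_eq hu, e₁,
    e₀, hP.den₂_eq hu,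
    hP.c_eq, hP.b_eq, zpow_sub₀ h1, zpow_sub₀ h1, zpow_sub₀ h1, zpow_neg, zpow_neg, zpow_neg,
    mul_zpow, zpow_natCast, zpow_one]
  rw [den₀_eq hu] at h₀ ⊢
  replace h₀ := (div_ne_zero_iff.1 h₀).1
  clear e e' e₁ e₀
  generalize P.q ^ 2 * u ^ 4 - 1 = f₁ at *
  generalize P.q ^ 4 * u ^ 4 - 1 = f₂ at *
  generalize u ^ 4 - 1 = f₀ at *
  generalize P.q ^ P.n = t at *
  by_cases hf : f₁ = 0
  · simp [hf]
  by_cases hg : f₂ = 0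
  · simp [hg]
  field_simp
  ring

end Admissible

end Params

end

end BelliardSlavnov

/-! ### The two signs of `Y_ε` and the diagonal term -/

namespace BelliardSlavnov

noncomputable section

namespace Params

open Label

/-- The first coefficient of `Y_ε`. -/
def coefUp (P : Params) (ε : Eps) (u : ℂ) : ℂ :=
  u ^ (2 * ε.val + 1) * P.Λ₁ ε u / (bf (u ^ 2) * bf (P.q * u ^ 2))

/-- The second coefficient of `Y_ε`. -/
def coefDn (P : Params) (ε : Eps) (u : ℂ) : ℂ :=
  P.q ^ (-ε.val - 1) * u⁻¹ * P.Λ₂ ε u / (bf (u ^ 2) * bf (P.q ^ 2 * u ^ 2))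

/-- The diagonal term of the coefficients `L^ε_{jj}`. -/
def coefDiag (P : Params) (u : ℂ) : ℂ :=
  (P.q + P.q⁻¹) ^ 2 / (P.ρ * bf (u ^ 2) * bf (P.q ^ 2 * u ^ 2)) *
    (P.ηs + P.η * ((P.q * u ^ 2 + P.q⁻¹ * (u ^ 2)⁻¹) / (P.q + P.q⁻¹)))

namespace Admissible

variable {P : Params} {u : ℂ}

/-- The two signs differ only in the last factor of `Λ₁`. For `ε = -` it gives the q-Racah factor `1
- dA w`, for `ε = +` the interchanged factor; `Λ₂` behaves in the same way. -/
lemma coefUp_minus (hP : P.Admissible) (hu : u ≠ 0) :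
    P.coefUp .minus u = P.genU u * (1 - P.dA * P.gridW u) / (P.r₀ * P.x dot) := by
  have h1 := hP.q_ne
  have h2 := hP.x_ne dia
  have h3 := hP.x_ne dot
  have h4 := hP.x_ne star
  have h5 := hP.r₀_ne
  rw [coefUp, Λ₁, hP.coef₁ hu, mul_div_assoc (P.genU u)]
  congr 1
  simp only [Eps.val, Eps.isMinus, Eps.isPlus, pow_one, pow_zero, zpow_neg, zpow_one]
  rw [hP.c_eq, hP.c_eq, dA, gridW]
  field_simp
  ring

lemma coefUp_plus (hP : P.Admissible) (hu : u ≠ 0) :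
    P.coefUp .plus u = P.genU u * (1 - P.dA / (P.x dia ^ 2 * P.q ^ 2 * P.gridW u)) /
      (P.r₀ * P.x dot) := by
  have h1 := hP.q_ne
  have h2 := hP.x_ne dia
  have h3 := hP.x_ne dot
  have h4 := hP.x_ne star
  have h5 := hP.r₀_ne
  rw [coefUp, Λ₁, hP.coef₁ hu, mul_div_assoc (P.genU u)]
  congr 1
  simp only [Eps.val, Eps.isMinus, Eps.isPlus, pow_one, pow_zero, zpow_one]
  rw [hP.b_eq, hP.b_eq, dA, gridW]
  field_simp
  ring

lemma coefDn_minus (hP : P.Admissible) (hu : u ≠ 0) (h₀ : bf (u ^ 2) ≠ 0) :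
    P.coefDn .minus u = P.genD u * (P.x dia ^ 2 * P.gridW u - P.dA) / (P.r₀ * P.x dot) := by
  have h1 := hP.q_ne
  have h2 := hP.x_ne dia
  have h3 := hP.x_ne dot
  have h4 := hP.x_ne star
  have h5 := hP.r₀_ne
  rw [coefDn, Λ₂, hP.coef₂ hu h₀, mul_div_assoc (P.genD u)]
  congr 1
  simp only [Eps.val, Eps.isMinus, Eps.isPlus, pow_one, pow_zero, zpow_one, neg_neg]
  rw [hP.c_eq, hP.c_eq, dA, gridW]
  field_simp
  ring

lemma coefDn_plus (hP : P.Admissible) (hu : u ≠ 0) (h₀ : bf (u ^ 2) ≠ 0) :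
    P.coefDn .plus u = P.genD u * P.x dia ^ 2 * P.gridW u * (1 - P.dA * P.gridW u / P.q ^ 2) /
      (P.r₀ * P.x dot) := by
  have h1 := hP.q_ne
  have h2 := hP.x_ne dia
  have h3 := hP.x_ne dot
  have h4 := hP.x_ne star
  have h5 := hP.r₀_ne
  rw [coefDn, Λ₂, hP.coef₂ hu h₀, mul_assoc (P.genD u), mul_assoc (P.genD u),
    mul_div_assoc (P.genD u)]
  congr 1
  simp only [Eps.val, Eps.isMinus, Eps.isPlus, pow_one, pow_zero, zpow_neg, zpow_one]
  rw [hP.b_eq, hP.b_eq, dA, gridW]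
  field_simp
  ring

lemma q_sq_sub_one_ne (hP : P.Admissible) : P.q ^ 2 - 1 ≠ 0 :=
  sub_ne_zero.2 (hP.q_root 2 (by omega))

lemma q_sq_add_one_ne (hP : P.Admissible) : P.q ^ 2 + 1 ≠ 0 := fun h =>
  hP.q_root 4 (by omega) (by linear_combination (P.q ^ 2 - 1) * h)

lemma ρ_eq (P : Params) (hq : P.q ≠ 0) :
    P.ρ = -((P.q ^ 2 - 1) ^ 2 * (P.q ^ 2 + 1) ^ 2 / (P.q ^ 4 * P.r₀ ^ 2)) := by
  rw [ρ]; field_simp; ring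

lemma ρ_ne (hP : P.Admissible) : P.ρ ≠ 0 := by
  have h1 := hP.q_ne
  have h2 := hP.r₀_ne
  have h3 := hP.q_sq_sub_one_ne
  have h4 := hP.q_sq_add_one_ne
  rw [ρ_eq P h1]
  exact neg_ne_zero.2 (div_ne_zero (mul_ne_zero (pow_ne_zero _ h3) (pow_ne_zero _ h4))
    (mul_ne_zero (pow_ne_zero _ h1) (pow_ne_zero _ h2)))

lemma θs_eq (hP : P.Admissible) (a : Label) :
    P.θs a = (P.x a * P.q ^ P.n + (P.x a * P.q ^ P.n)⁻¹) / P.r₀ := by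
  have := hP.r₀_ne
  have := hP.x_ne a
  have := pow_ne_zero P.n hP.q_ne
  rw [θs, hP.b_eq, hP.c_eq]
  field_simp

lemma ωabc_eq (hP : P.Admissible) (a b c : Label) :
    P.ωabc a b c = -((P.q ^ 2 - 1) ^ 2 / (P.q ^ 2 * P.r₀ ^ 2)) *
      ((P.x a * P.q ^ P.n + (P.x a * P.q ^ P.n)⁻¹) * (P.x b * P.q ^ P.n + (P.x b * P.q ^ P.n)⁻¹) -
        (P.q * P.q ^ P.n + (P.q * P.q ^ P.n)⁻¹) * (P.x c * P.q ^ P.n + (P.x c * P.q ^ P.n)⁻¹)) := by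
  have := hP.r₀_ne
  have h := hP.q_ne
  rw [ωabc, hP.θs_eq, hP.θs_eq, hP.θs_eq, pow_succ' P.q P.n,
    show P.q - P.q⁻¹ = (P.q ^ 2 - 1) / P.q by field_simp]
  generalize P.x a * P.q ^ P.n + (P.x a * P.q ^ P.n)⁻¹ = A
  generalize P.x b * P.q ^ P.n + (P.x b * P.q ^ P.n)⁻¹ = B
  generalize P.x c * P.q ^ P.n + (P.x c * P.q ^ P.n)⁻¹ = C
  field_simp

/-- The rational function built from `η` and `η*` is the diagonal coefficient of the Askey–Wilson
operator. The same diagonal serves both signs, as conjugation by `h` affects only the off-diagonal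
part. -/
lemma coefDiag_eq (hP : P.Admissible) (hu : u ≠ 0) (h₀ : bf (u ^ 2) ≠ 0)
    (h₁ : bf (P.q * u ^ 2) ≠ 0) (h₂ : bf (P.q ^ 2 * u ^ 2) ≠ 0) :
    P.coefDiag u = (1 + P.x dot ^ 2 - P.genU u * (1 - P.dA * P.gridW u) -
      P.genD u * (P.x dia ^ 2 * P.gridW u - P.dA)) / (P.r₀ * P.x dot) := by
  have h3 := hP.q_ne
  have h4 := hP.x_ne dia
  have h5 := hP.x_ne dot
  have h6 := hP.x_ne star
  have h7 := hP.r₀_ne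
  have h8 := pow_ne_zero P.n hP.q_ne
  have h9 := hP.q_sq_sub_one_ne
  have h10 := hP.q_sq_add_one_ne
  rw [den₀_eq hu] at h₀
  rw [hP.den₁_eq hu] at h₁
  rw [hP.den₂_eq hu] at h₂
  replace h₀ := (div_ne_zero_iff.1 h₀).1
  replace h₁ := (div_ne_zero_iff.1 h₁).1
  replace h₂ := (div_ne_zero_iff.1 h₂).1
  have eL : P.coefDiag u = P.r₀ ^ 3 * P.q * u ^ 2 * P.q ^ 2 * u ^ 2 * (-(P.ωabc star dia dot *
      (P.q ^ 2 + 1) * (P.q * u ^ 2) + P.ωabc dot dia star * (P.q ^ 2 * u ^ 4 + 1) * P.q) /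
      (P.r₀ ^ 2 * (P.q ^ 2 - 1) ^ 2 * P.q * u ^ 2 * (u ^ 4 - 1) * (P.q ^ 4 * u ^ 4 - 1))) := by
    rw [coefDiag, ηs, η, ρ_eq P h3, den₀_eq hu, hP.den₂_eq hu,
      show P.q + P.q⁻¹ = (P.q ^ 2 + 1) / P.q by field_simp]
    generalize P.q ^ 4 * u ^ 4 - 1 = f₂ at *
    generalize u ^ 4 - 1 = f₀ at *
    generalize P.q ^ 2 - 1 = g at *
    generalize hf : P.q ^ 2 + 1 = f at *
    field_simp
  rw [eL, hP.ωabc_eq, hP.ωabc_eq, hP.genU_eq hu, hP.genD_eq hu, dA, gridW]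
  generalize P.q ^ P.n = t at *
  generalize hf₁ : P.q ^ 2 * u ^ 4 - 1 = f₁ at *
  generalize hf₂ : P.q ^ 4 * u ^ 4 - 1 = f₂ at *
  generalize hf₀ : u ^ 4 - 1 = f₀ at *
  generalize P.q ^ 2 - 1 = g at *
  generalize P.x dot = x at *
  generalize P.x dia = z at *
  generalize P.x star = y at *
  generalize P.q = q at *
  generalize P.r₀ = r at *
  clear eL hP
  field_simp
  subst hf₀ hf₁ hf₂
  ring

end Admissible

end Params

end

end BelliardSlavnov

/-! ### The operator behind the linear system -/

namespace BelliardSlavnov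

noncomputable section

namespace Params

open Label Polynomial

/-- The weights that enter the dual coordinates of the two families of Bethe states. -/
def hFac (P : Params) : Eps → ℕ → ℂ
  | .minus, _ => 1
  | .plus, N => (P.hRel N)⁻¹

/-- The pairing of a polynomial in the spectral variable with a row of the transition matrix. -/
def pairing (P : Params) (ε : Eps) (M : ℕ) (p : ℂ[X]) : ℂ :=
  ∑ N ∈ Finset.range (P.n + 1), P.Pinv dia dot star M N * (P.hFac ε N * p.eval (P.tauM N))

lemma pairing_add (P : Params) (ε : Eps) (M : ℕ) (p r : ℂ[X]) :
    P.pairing ε M (p + r) = P.pairing ε M p + P.pairing ε M r := by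
  simp only [pairing, eval_add, mul_add, Finset.sum_add_distrib]

lemma pairing_C_mul (P : Params) (ε : Eps) (M : ℕ) (a : ℂ) (p : ℂ[X]) :
    P.pairing ε M (C a * p) = a * P.pairing ε M p := by
  simp only [pairing, eval_mul, eval_C, Finset.mul_sum]
  exact Finset.sum_congr rfl fun N _ => by ring

namespace Admissible

variable {P : Params}

lemma qh_ne (hP : P.Admissible) : P.qh ≠ 0 := fun h => hP.q_ne (by rw [← hP.qh_sq, h]; ring)

/-- The subtracted product in `Y_+` is the nodal polynomial of the spectrum of `r₀ A^⋄`. The factor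
with `ζ` at `j` is paired with the factor with `ζ⁻¹` at `n - j`: the product of their arguments is
`q u²` and the quotient is the inverse of a grid point. -/
lemma prod_nodal (hP : P.Admissible) {u : ℂ} (hu : u ≠ 0) :
    ∏ j ∈ Finset.range (P.n + 1), bf (P.qh ^ (1 + 2 * j - P.n : ℤ) * u * P.ζ) *
        bf (P.qh ^ (1 + 2 * j - P.n : ℤ) * u * P.ζ⁻¹) =
      ∏ j ∈ Finset.range (P.n + 1), (P.specV u - tau (P.x dia) ((P.q ^ 2) ^ j)) := by
  have h1 := hP.qh_ne
  have h2 := hP.ζ_ne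
  have h3 := hP.x_ne dia
  have h4 := hP.q_ne
  rw [← Finset.prod_range_reflect (fun j => P.specV u - tau (P.x dia) ((P.q ^ 2) ^ j)),
    Finset.prod_mul_distrib,
    ← Finset.prod_range_reflect (fun j => bf (P.qh ^ (1 + 2 * (j : ℤ) - P.n : ℤ) * u * P.ζ⁻¹)),
    ← Finset.prod_mul_distrib]
  refine Finset.prod_congr rfl fun j hj => ?_
  have hj : j ≤ P.n := by simpa [Nat.lt_succ_iff] using hj
  have c : ((P.n + 1 - 1 - j : ℕ) : ℤ) = P.n - j := by
    rw [Nat.add_sub_cancel, Nat.cast_sub hj]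
  have n1 := zpow_ne_zero (1 + 2 * (j : ℤ) - P.n) h1
  have n2 := zpow_ne_zero (1 + 2 * ((P.n + 1 - 1 - j : ℕ) : ℤ) - P.n) h1
  have e1 : P.qh ^ (1 + 2 * (j : ℤ) - P.n) * u * P.ζ *
      (P.qh ^ (1 + 2 * ((P.n + 1 - 1 - j : ℕ) : ℤ) - P.n) * u * P.ζ⁻¹) = P.q * u ^ 2 := by
    have : P.qh ^ (1 + 2 * (j : ℤ) - P.n) *
        P.qh ^ (1 + 2 * ((P.n + 1 - 1 - j : ℕ) : ℤ) - P.n) = P.q := by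
      rw [← zpow_add₀ h1, c, ← hP.qh_sq, ← zpow_natCast P.qh 2]
      congr 1
      push_cast
      ring
    rw [← this]
    field_simp
  have e2 : P.qh ^ (1 + 2 * (j : ℤ) - P.n) * u * P.ζ /
      (P.qh ^ (1 + 2 * ((P.n + 1 - 1 - j : ℕ) : ℤ) - P.n) * u * P.ζ⁻¹) =
      (P.x dia * (P.q ^ 2) ^ (P.n + 1 - 1 - j))⁻¹ := by
    have : P.qh ^ (1 + 2 * (j : ℤ) - P.n) = P.q ^ P.n * ((P.q ^ 2) ^ (P.n + 1 - 1 - j))⁻¹ *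
        P.qh ^ (1 + 2 * ((P.n + 1 - 1 - j : ℕ) : ℤ) - P.n) := by
      rw [← pow_mul, ← hP.qh_sq, ← pow_mul, ← pow_mul, ← zpow_natCast, ← zpow_natCast, ← zpow_neg,
        ← zpow_add₀ h1, ← zpow_add₀ h1]
      congr 1
      push_cast [Nat.cast_sub hj]
      ring
    rw [this]
    have h5 := hP.ζ_sq
    have n3 := pow_ne_zero (P.n + 1 - 1 - j) hP.Q_ne
    have n4 := pow_ne_zero P.n h4
    field_simp at h5 ⊢
    linear_combination h5
  rw [bf_mul_bf (mul_ne_zero (mul_ne_zero n1 hu) h2)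
    (mul_ne_zero (mul_ne_zero n2 hu) (inv_ne_zero h2)), e1, e2, specV, tau, tau, inv_inv]
  ring

/-- The coefficient of the nodal polynomial in `exists_poly_AWCoef'`, after division by `r₀ x` with
`x` the parameter of `·`, is `-ν₊`. This fixes the constant in the last term of `Y_+`. -/
lemma dA_div (hP : P.Admissible) :
    P.dA / (P.x dia * (P.q ^ 2) ^ (P.n + 1)) / (P.r₀ * P.x dot) = -P.νplus := by
  have h1 := hP.r₀_ne
  have h2 := hP.x_ne star
  have h3 := hP.x_ne dia
  have h4 := hP.x_ne dot
  have h5 := hP.q_ne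
  have h6 := pow_ne_zero P.n h5
  rw [dA, νplus, hP.c_eq, zpow_sub₀ h5, zpow_neg, zpow_one, zpow_mul, zpow_ofNat, zpow_natCast,
    pow_succ]
  field_simp

lemma tauM_succ (P : Params) (N : ℕ) :
    tau (P.x dia) (P.q ^ 2 * (P.q ^ 2) ^ N) = P.tauM (N + 1) := by
  rw [tauM, pow_succ' (P.q ^ 2) N]

lemma awD_mul_tauM_pred (hP : P.Admissible) (X d : ℂ) (n N : ℕ) (f : ℂ → ℂ) :
    awD (P.q ^ 2) X d n N * f (tau (P.x dia) ((P.q ^ 2) ^ N / P.q ^ 2)) =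
      awD (P.q ^ 2) X d n N * f (P.tauM (N - 1)) := by
  rcases N with _ | N
  · rw [awD_zero, zero_mul, zero_mul]
  · rw [pow_succ (P.q ^ 2) N, mul_div_cancel_right₀ _ hP.Q_ne]; rfl

lemma θ_dot_eq (hP : P.Admissible) (M : ℕ) :
    P.θ dot M = (((P.q ^ 2) ^ M)⁻¹ + P.x dot ^ 2 * (P.q ^ 2) ^ M) / (P.r₀ * P.x dot) := by
  have h1 := hP.r₀_ne
  have h4 := hP.x_ne dot
  have h5 := pow_ne_zero M hP.Q_ne
  rw [θ, hP.b_eq, hP.c_eq, pow_mul]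
  field_simp
  ring

/-- The operator `L^ε` acts on polynomials in the spectral variable, and the transition matrix
diagonalizes it. -/
lemma exists_image (hP : P.Admissible) (ε : Eps) (p : ℂ[X]) (hp : p.natDegree ≤ P.n) :
    ∃ r : ℂ[X], r.natDegree ≤ P.n ∧
      (∀ u, u ≠ 0 → bf (u ^ 2) ≠ 0 → bf (P.q * u ^ 2) ≠ 0 → bf (P.q ^ 2 * u ^ 2) ≠ 0 →
        P.coefUp ε u * p.eval (P.specV (u / P.q)) + P.coefDn ε u * p.eval (P.specV (P.q * u)) -
            ε.isPlus * P.νplus * p.coeff P.n * (∏ j ∈ Finset.range (P.n + 1),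
              bf (P.qh ^ (1 + 2 * j - P.n : ℤ) * u * P.ζ) *
                bf (P.qh ^ (1 + 2 * j - P.n : ℤ) * u * P.ζ⁻¹)) +
            P.coefDiag u * p.eval (P.specV u) = r.eval (P.specV u)) ∧
      ∀ M ≤ P.n, P.pairing ε M r = P.θ dot M * P.pairing ε M p := by
  have hQ := hP.Q_ne
  have hz := hP.x_ne dia
  have h1 := hP.r₀_ne
  have h4 := hP.x_ne dot
  cases ε with
  | minus =>
    obtain ⟨r, hr, h⟩ := exists_poly_AWCoef hQ hz P.dA P.dB ((P.q ^ 2) ^ P.n)⁻¹ p hp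
    -- The shift by `1 + x²` turns the q-Racah eigenvalue `(Q^(-M) - 1)(1 - x² Q^M)` into `r₀ x
    -- θ_M`. Generic points and grid points are both instances of `AWCoef`, so one polynomial `r`
    -- serves both claims.
    refine ⟨C (P.r₀ * P.x dot)⁻¹ * (r + C (1 + P.x dot ^ 2) * p),
      (natDegree_C_mul_le _ _).trans (natDegree_add_le_of_degree_le hr
        ((natDegree_C_mul_le _ _).trans hp)), fun u hu b₀ b₁ b₂ => ?_, fun M hM => ?_⟩
    · have e := h _ _ _ (hP.gridW_ne hu) (hP.AWCoef_gen hu b₀ b₁ b₂)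
      rw [← hP.gridW_div, ← gridW_mul, hP.tau_gridW, hP.tau_gridW, hP.tau_gridW] at e
      rw [hP.coefUp_minus hu, hP.coefDn_minus hu b₀, hP.coefDiag_eq hu b₀ b₁ b₂]
      simp only [eval_mul, eval_add, eval_C, Eps.isPlus, Nat.cast_zero]
      rw [← e]
      ring
    · have e : P.pairing .minus M r = (((P.q ^ 2) ^ M)⁻¹ - 1) *
          (1 - P.x dot ^ 2 * (P.q ^ 2) ^ M) * P.pairing .minus M p := by
        simp only [pairing, hFac, one_mul]
        rw [← hP.sum_Pinv_apply hM (fun N => p.eval (P.tauM N))]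
        refine Finset.sum_congr rfl fun N hN => ?_
        have hN : N ≤ P.n := by simpa [Nat.lt_succ_iff] using hN
        have a := h _ _ _ (pow_ne_zero N hQ) (hP.node dia P.dB hN)
        have d := hP.awD_mul_tauM_pred (P.x dia ^ 2) P.dB P.n N fun t => p.eval t
        rw [tauM_succ] at a
        rw [tauM, ← a, upDia, dnDia, ← tauM]
        linear_combination P.Pinv dia dot star M N * (P.x dia ^ 2 * (P.q ^ 2) ^ N - P.dA) * d
      rw [pairing_C_mul, pairing_add, pairing_C_mul, e, hP.θ_dot_eq]
      have := pow_ne_zero M hQ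
      field_simp
      ring
  | plus =>
    obtain ⟨r, hr, h⟩ := exists_poly_AWCoef' hQ hz P.dA P.dB ((P.q ^ 2) ^ P.n)⁻¹ p hp
    refine ⟨C (P.r₀ * P.x dot)⁻¹ * (r + C (1 + P.x dot ^ 2) * p),
      (natDegree_C_mul_le _ _).trans (natDegree_add_le_of_degree_le hr
        ((natDegree_C_mul_le _ _).trans hp)), fun u hu b₀ b₁ b₂ => ?_, fun M hM => ?_⟩
    · have e := h _ _ _ (hP.gridW_ne hu) (hP.AWCoef_gen hu b₀ b₁ b₂)
      rw [← hP.gridW_div, ← gridW_mul, hP.tau_gridW, hP.tau_gridW, hP.tau_gridW] at e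
      have ν := hP.dA_div
      rw [hP.coefUp_plus hu, hP.coefDn_plus hu b₀, hP.coefDiag_eq hu b₀ b₁ b₂, hP.prod_nodal hu]
      simp only [eval_mul, eval_add, eval_C, Eps.isPlus, Nat.cast_one]
      rw [← neg_eq_iff_eq_neg] at ν
      rw [← ν]
      linear_combination (P.r₀ * P.x dot)⁻¹ * e
    · have e : P.pairing .plus M r = (((P.q ^ 2) ^ M)⁻¹ - 1) *
          (1 - P.x dot ^ 2 * (P.q ^ 2) ^ M) * P.pairing .plus M p := by
        simp only [pairing, hFac]
        rw [← hP.sum_Pinv_apply hM (fun N => (P.hRel N)⁻¹ * p.eval (P.tauM N))]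
        refine Finset.sum_congr rfl fun N hN => ?_
        have hN' : N < P.n + 1 := by simpa using hN
        have hN : N ≤ P.n := by omega
        have a := h _ _ _ (pow_ne_zero N hQ) (hP.node dia P.dB hN)
        have d := hP.awD_mul_tauM_pred (P.x dia ^ 2) P.dB P.n N fun t => p.eval t
        -- On the grid the nodal polynomial vanishes, so the term of degree `n + 1` does not
        -- contribute to the pairing.
        rw [tauM_succ, Finset.prod_eq_zero (Finset.mem_range.2 hN') (sub_self _), mul_zero,
          add_zero] at a
        have u' := hP.upDia_hRel hN
        have d' := hP.dnDia_hRel hN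
        rw [← tauM] at a
        have x : P.upDia N * ((P.hRel (N + 1))⁻¹ * p.eval (P.tauM (N + 1)) -
            (P.hRel N)⁻¹ * p.eval (P.tauM N)) + P.dnDia N * ((P.hRel (N - 1))⁻¹ *
            p.eval (P.tauM (N - 1)) - (P.hRel N)⁻¹ * p.eval (P.tauM N)) =
            (P.upDia N * (P.hRel (N + 1))⁻¹) * p.eval (P.tauM (N + 1)) +
            (P.dnDia N * (P.hRel (N - 1))⁻¹) * p.eval (P.tauM (N - 1)) -
            (P.upDia N + P.dnDia N) * ((P.hRel N)⁻¹ * p.eval (P.tauM N)) := by ring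
        rw [x, u', d', ← a, upDia, dnDia]
        linear_combination P.Pinv dia dot star M N * (P.hRel N)⁻¹ * (P.x dia ^ 2 *
          (P.q ^ 2) ^ N * (1 - P.dA * (P.q ^ 2) ^ N / P.q ^ 2)) * d
      rw [pairing_C_mul, pairing_add, pairing_C_mul, e, hP.θ_dot_eq]
      have := pow_ne_zero M hQ
      field_simp
      ring

end Admissible

end Params

end

end BelliardSlavnov

/-! ### Solution and rank of the linear system -/

namespace BelliardSlavnov

noncomputable section

section

open Module

/-- A square matrix of size `n + 1` with `n + 1` different eigenvalues has corank one after
subtracting one of them. -/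
lemma rank_sub_eigenvalue {n : ℕ} (L : Matrix (Fin (n + 1)) (Fin (n + 1)) ℂ)
    (X : Fin (n + 1) → Fin (n + 1) → ℂ) {θ : Fin (n + 1) → ℂ} (hθ : Function.Injective θ)
    (hX : ∀ M, X M ≠ 0) (h : ∀ M, L.mulVec (X M) = θ M • X M) (M : Fin (n + 1)) :
    (L - θ M • (1 : Matrix (Fin (n + 1)) (Fin (n + 1)) ℂ)).rank = n := by
  have hli : LinearIndependent ℂ X :=
    Module.End.eigenvectors_linearIndependent' L.mulVecLin θ hθ X fun K =>
      Module.End.hasEigenvector_iff.2 ⟨Module.End.mem_eigenspace_iff.2 (h K), hX K⟩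
  have happ : ∀ K, (L - θ M • (1 : Matrix (Fin (n + 1)) (Fin (n + 1)) ℂ)).mulVecLin (X K) =
      (θ K - θ M) • X K := fun K => by
    rw [Matrix.mulVecLin_apply, Matrix.sub_mulVec, h, Matrix.smul_mulVec, Matrix.one_mulVec,
      sub_smul]
  have hrn := LinearMap.finrank_range_add_finrank_ker
    (L - θ M • (1 : Matrix (Fin (n + 1)) (Fin (n + 1)) ℂ)).mulVecLin
  rw [finrank_fin_fun] at hrn
  -- One eigenvector in the kernel bounds the rank by `n` from above; the other `n` independent
  -- eigenvectors lie in the range and bound it from below.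
  have hker : 0 < finrank ℂ (LinearMap.ker
      (L - θ M • (1 : Matrix (Fin (n + 1)) (Fin (n + 1)) ℂ)).mulVecLin) := by
    have hm : X M ∈ LinearMap.ker
        (L - θ M • (1 : Matrix (Fin (n + 1)) (Fin (n + 1)) ℂ)).mulVecLin := by
      rw [LinearMap.mem_ker, happ, sub_self, zero_smul]
    have : Nontrivial (LinearMap.ker
        (L - θ M • (1 : Matrix (Fin (n + 1)) (Fin (n + 1)) ℂ)).mulVecLin) :=
      ⟨⟨⟨X M, hm⟩, 0, fun h0 => hX M (by simpa using congrArg Subtype.val h0)⟩⟩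
    exact finrank_pos
  have hrange : n ≤ (L - θ M • (1 : Matrix (Fin (n + 1)) (Fin (n + 1)) ℂ)).rank := by
    have hli' := hli.comp M.succAbove M.succAbove_right_injective
    have hc := finrank_span_eq_card hli'
    rw [Fintype.card_fin] at hc
    refine hc.ge.trans (Submodule.finrank_mono (Submodule.span_le.2 ?_))
    rintro _ ⟨K, rfl⟩
    refine ⟨(θ (M.succAbove K) - θ M)⁻¹ • X (M.succAbove K), ?_⟩
    rw [map_smul, happ, smul_smul, inv_mul_cancel₀, one_smul]
    · rfl
    · exact sub_ne_zero.2 fun e => M.succAbove_ne K (hθ e)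
  rw [Matrix.rank] at hrange ⊢
  omega

end

namespace Params

open Label Polynomial

/-- The monic polynomial in the spectral variable with roots at the points `v`. -/
def nodePoly (P : Params) {m : ℕ} (v : Fin m → ℂ) : ℂ[X] := ∏ i, (X - C (P.specV (v i)))

lemma nodePoly_monic (P : Params) {m : ℕ} (v : Fin m → ℂ) : (P.nodePoly v).Monic :=
  monic_prod_of_monic _ _ fun _ _ => monic_X_sub_C _

lemma natDegree_nodePoly (P : Params) {m : ℕ} (v : Fin m → ℂ) :
    (P.nodePoly v).natDegree = m := by
  rw [nodePoly, natDegree_prod_of_monic _ _ fun i _ => monic_X_sub_C _]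
  simp

lemma eval_nodePoly (P : Params) {m : ℕ} (v : Fin m → ℂ) (t : ℂ) :
    (P.nodePoly v).eval t = ∏ i, (t - P.specV (v i)) := by
  simp [nodePoly, eval_prod]

/-- The factor of the scalar products that depends on a single Bethe parameter. -/
def nodeFac (ε : Eps) (u : ℂ) : ℂ := bf (u ^ 2) * u ^ (-ε.val)

/-- The coefficient of `𝒢^ε`. -/
def gCoef (P : Params) (ε : Eps) : ℂ :=
  ε.val * (P.q + P.q⁻¹) * P.q ^ (-ε.val * (P.n + 1)) * P.b dot ^ ε.isMinus * P.c star ^ ε.isPlus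

/-- The coefficient that relates the reference states of the two types. -/
def refCoef (P : Params) : Eps → ℂ
  | .minus => 1
  | .plus => P.fgh / P.ν₀ star dia dot

/-- The normalization of the scalar products. -/
def scalCoef (P : Params) (ε : Eps) (M : ℕ) : ℂ :=
  (P.gCoef ε * -(P.q + P.q⁻¹)⁻¹) ^ P.n * P.refCoef ε * P.fRel M

namespace Admissible

variable {P : Params}

lemma q_add_inv_ne (hP : P.Admissible) : P.q + P.q⁻¹ ≠ 0 := by
  have h := hP.q_ne
  have h1 := hP.q_sq_add_one_ne
  contrapose! h1
  field_simp at h1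
  simpa using h1

lemma Q_pow_injective (hP : P.Admissible) : Function.Injective fun N => (P.q ^ 2) ^ N := by
  have key : ∀ N k, (P.q ^ 2) ^ N ≠ (P.q ^ 2) ^ (N + k + 1) := fun N k h => by
    rw [add_assoc, pow_add] at h
    exact hP.Q_pow_ne k ((mul_eq_left₀ (pow_ne_zero N hP.Q_ne)).1 h.symm)
  intro N N' h
  rcases lt_trichotomy N N' with hlt | rfl | hlt
  · obtain ⟨k, rfl⟩ := Nat.exists_eq_add_of_lt hlt
    exact absurd h (key N k)
  · rfl
  · obtain ⟨k, rfl⟩ := Nat.exists_eq_add_of_lt hlt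
    exact absurd h.symm (key N' k)

lemma θ_eq_tau (hP : P.Admissible) (a : Label) (M : ℕ) :
    P.θ a M = tau (P.x a) ((P.q ^ 2) ^ M) / P.r₀ := by
  have h1 := hP.r₀_ne
  have h2 := hP.x_ne a
  have h3 := pow_ne_zero M hP.Q_ne
  rw [tau, θ, hP.b_eq, hP.c_eq, pow_mul]
  field_simp

lemma tauM_injective (hP : P.Admissible) {N N' : ℕ} (h : N ≤ P.n) (h' : N' ≤ P.n)
    (e : P.tauM N = P.tauM N') : N = N' := by
  have h4 := hP.spec_dia (N + N') (by omega)
  rw [pow_add] at h4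
  exact hP.Q_pow_injective ((tau_eq_tau (hP.x_ne _) (pow_ne_zero N hP.Q_ne)
    (pow_ne_zero N' hP.Q_ne) e).resolve_right h4)

lemma θ_injective (hP : P.Admissible) (a : Label) {M M' : ℕ} (h : M ≤ P.n) (h' : M' ≤ P.n)
    (e : P.θ a M = P.θ a M') : M = M' := by
  by_contra hne
  have h4 := hP.spec' a (M + M') (by omega) (by omega)
  rw [pow_add] at h4
  rw [hP.θ_eq_tau, hP.θ_eq_tau, div_left_inj' hP.r₀_ne] at e
  exact hne (hP.Q_pow_injective ((tau_eq_tau (hP.x_ne _) (pow_ne_zero M hP.Q_ne)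
    (pow_ne_zero M' hP.Q_ne) e).resolve_right h4))

lemma Y_eq (hP : P.Admissible) (ε : Eps) {u : ℂ} (hu : u ≠ 0) {m : ℕ} {v : Fin m → ℂ}
    (hv : ∀ i, v i ≠ 0) :
    P.Y ε u v = P.coefUp ε u * (P.nodePoly v).eval (P.specV (u / P.q)) +
      P.coefDn ε u * (P.nodePoly v).eval (P.specV (P.q * u)) -
      ε.isPlus * P.νplus * ∏ j ∈ Finset.range (P.n + 1),
        bf (P.qh ^ (1 + 2 * j - P.n : ℤ) * u * P.ζ) *
          bf (P.qh ^ (1 + 2 * j - P.n : ℤ) * u * P.ζ⁻¹) := by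
  rw [Y, eval_nodePoly, eval_nodePoly, Finset.prod_congr rfl fun i _ => hP.bf_mul_bf_down hu (hv i),
    Finset.prod_congr rfl fun i _ => hP.bf_mul_bf_up hu (hv i)]
  rfl

lemma tauM_eq (hP : P.Admissible) (N : ℕ) : P.tauM N = P.r₀ * P.θ dia N := by
  have h1 := hP.r₀_ne
  have h2 := hP.x_ne dia
  have h3 := pow_ne_zero N hP.Q_ne
  rw [tauM, tau, θ, hP.b_eq, hP.c_eq, pow_mul]
  field_simp

lemma prod_U_sub (hP : P.Admissible) {m : ℕ} (v : Fin m → ℂ) (N : ℕ) :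
    ∏ i, (P.U (v i) - P.r₀ / (P.q + P.q⁻¹) * P.θ dia N) =
      (-(P.q + P.q⁻¹)⁻¹) ^ m * (P.nodePoly v).eval (P.tauM N) := by
  have h1 := hP.q_add_inv_ne
  have c : (-(P.q + P.q⁻¹)⁻¹) ^ m = ∏ _i : Fin m, (-(P.q + P.q⁻¹)⁻¹) := by simp
  rw [eval_nodePoly, c, ← Finset.prod_mul_distrib]
  refine Finset.prod_congr rfl fun i _ => ?_
  rw [U, hP.tauM_eq, specV, tau, mul_inv]
  ring

lemma scalMinus_eq (hP : P.Admissible) (M : ℕ) (v : Fin P.n → ℂ) :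
    P.scalMinus M v = P.scalCoef .minus M *
      ((∏ i, nodeFac .minus (v i)) * P.pairing .minus M (P.nodePoly v)) := by
  simp only [scalMinus, G, hP.prod_U_sub, scalCoef, pairing, hFac, refCoef, gCoef, nodeFac, mul_pow]
  simp only [one_mul, Finset.mul_sum]
  exact Finset.sum_congr rfl fun N _ => by ring

lemma scalPlus_eq (hP : P.Admissible) (M : ℕ) (v : Fin P.n → ℂ) :
    P.scalPlus M v = P.scalCoef .plus M *
      ((∏ i, nodeFac .plus (v i)) * P.pairing .plus M (P.nodePoly v)) := by
  simp only [scalPlus, G, hP.prod_U_sub, scalCoef, pairing, hFac, refCoef, gCoef, nodeFac, mul_pow]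
  simp only [Finset.mul_sum]
  exact Finset.sum_congr rfl fun N _ => by ring

lemma wt_zero (hP : P.Admissible) : P.wt 0 = 1 := by
  have h := hP.spec_dia 0 (Nat.zero_le _)
  rw [pow_zero, mul_one] at h
  simp [wt, vwpTerm, qPoch_zero, div_self (sub_ne_zero.2 h.symm)]

/-- The rows of the transition matrix separate polynomials. -/
lemma exists_pairing_ne (hP : P.Admissible) (ε : Eps) (M : ℕ) :
    ∃ r : ℂ[X], r.natDegree ≤ P.n ∧ P.pairing ε M r ≠ 0 := by
  -- A polynomial that vanishes at every grid point except `N = 0`, where the weight and the q-Racah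
  -- polynomial are both `1`.
  refine ⟨∏ N ∈ Finset.range P.n, (X - C (P.tauM (N + 1))), ?_, ?_⟩
  · rw [natDegree_prod_of_monic _ _ fun i _ => monic_X_sub_C _]
    simp
  · rw [pairing, Finset.sum_range_succ', Finset.sum_eq_zero, zero_add]
    · rw [hP.Pinv_eq (Nat.zero_le _), hP.wt_zero, hP.racP_zero_right, eval_prod]
      refine mul_ne_zero (mul_ne_zero (mul_ne_zero (inv_ne_zero hP.ν₀_ne) one_ne_zero) one_ne_zero)
        (mul_ne_zero ?_ (Finset.prod_ne_zero_iff.2 fun N hN => ?_))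
      · cases ε <;> simp [hFac, hRel]
      · have hN : N < P.n := Finset.mem_range.1 hN
        rw [eval_sub, eval_X, eval_C, sub_ne_zero]
        exact fun e => absurd (hP.tauM_injective (by omega) (by omega) e) (by omega)
    · intro N hN
      rw [eval_prod, Finset.prod_eq_zero hN (by simp)]
      ring

lemma fRel_ne (hP : P.Admissible) {M : ℕ} (hM : M ≤ P.n) : P.fRel M ≠ 0 := by
  induction M with
  | zero => simp [fRel]
  | succ M ih =>
    rw [hP.fRel_succ]
    exact mul_ne_zero (ih (by omega)) (div_ne_zero (mul_ne_zero (hP.dA_fac M hM)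
      (mul_ne_zero hP.q_ne (hP.x_ne _))) (mul_ne_zero (mul_ne_zero (mul_ne_zero (hP.x_ne _)
      (pow_ne_zero _ hP.Q_ne)) (hP.x_ne _)) (hP.dS_fac M hM)))

lemma scalCoef_ne (hP : P.Admissible) (ε : Eps) {M : ℕ} (hM : M ≤ P.n) : P.scalCoef ε M ≠ 0 := by
  refine mul_ne_zero (mul_ne_zero (pow_ne_zero _ (mul_ne_zero ?_ (neg_ne_zero.2 (inv_ne_zero
    hP.q_add_inv_ne)))) ?_) (hP.fRel_ne hM)
  · refine mul_ne_zero (mul_ne_zero (mul_ne_zero (mul_ne_zero ?_ hP.q_add_inv_ne)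
      (zpow_ne_zero _ hP.q_ne)) (pow_ne_zero _ (hP.b_ne _))) (pow_ne_zero _ (hP.c_ne _))
    cases ε <;> simp [Eps.val]
  · cases ε with
    | minus => exact one_ne_zero
    | plus =>
      have := hP.fgh_mul_vecOf_hRel (Nat.zero_le _)
      exact fun h => by simp only [refCoef] at h; rw [h, zero_mul] at this; exact zero_ne_one this

section Generic

variable {y : Fin (P.n + 1) → ℂ}

lemma nodeFac_ne (hy : P.Generic y) (ε : Eps) (k : Fin (P.n + 1)) : nodeFac ε (y k) ≠ 0 :=
  mul_ne_zero (hy.den₀ k) (zpow_ne_zero _ (hy.ne_zero k))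

lemma specV_sub_ne (hP : P.Admissible) (hy : P.Generic y) {j k : Fin (P.n + 1)} (h : j ≠ k) :
    P.specV (y j) - P.specV (y k) ≠ 0 := by
  have := hP.g_eq (hy.ne_zero j) (hy.ne_zero k)
  rw [g] at this
  intro h0
  rw [h0, inv_zero, inv_eq_zero] at this
  exact mul_ne_zero (hy.den_pair j k h).1 (hy.den_pair j k h).2 this

lemma specV_injective (hP : P.Admissible) (hy : P.Generic y) :
    Function.Injective fun k => P.specV (y k) := fun j k h => by
  by_contra hne
  exact hP.specV_sub_ne hy hne (sub_eq_zero.2 h)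

/-- The coefficients `L^ε_{jk}` describe the action of an operator on the polynomials
`nodePoly`. -/
lemma L_eq (hP : P.Admissible) (hy : P.Generic y) (ε : Eps) (j k : Fin (P.n + 1)) {r : ℂ[X]}
    (hr : ∀ u, u ≠ 0 → bf (u ^ 2) ≠ 0 → bf (P.q * u ^ 2) ≠ 0 → bf (P.q ^ 2 * u ^ 2) ≠ 0 →
        P.coefUp ε u * (P.nodePoly (omit1 y j)).eval (P.specV (u / P.q)) +
            P.coefDn ε u * (P.nodePoly (omit1 y j)).eval (P.specV (P.q * u)) -
            ε.isPlus * P.νplus * (P.nodePoly (omit1 y j)).coeff P.n *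
              (∏ j ∈ Finset.range (P.n + 1),
              bf (P.qh ^ (1 + 2 * j - P.n : ℤ) * u * P.ζ) *
                bf (P.qh ^ (1 + 2 * j - P.n : ℤ) * u * P.ζ⁻¹)) +
            P.coefDiag u * (P.nodePoly (omit1 y j)).eval (P.specV u) = r.eval (P.specV u)) :
    P.L ε y j k = nodeFac ε (y k) / nodeFac ε (y j) *
      ((∏ i : Fin P.n, (P.specV (y k) - P.specV (y (k.succAbove i)))⁻¹) *
        r.eval (P.specV (y k))) := by
  have e := hr (y k) (hy.ne_zero k) (hy.den₀ k) (hy.den₁ k) (hy.den₂ k)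
  have hc : (P.nodePoly (omit1 y j)).coeff P.n = 1 := by
    have := (P.nodePoly_monic (omit1 y j)).coeff_natDegree
    rwa [natDegree_nodePoly] at this
  rw [hc, mul_one, ← hP.Y_eq ε (hy.ne_zero k) (v := omit1 y j) fun i =>
    hy.ne_zero (j.succAbove i)] at e
  have hfac : (y j / y k) ^ ε.val * (bf (y k ^ 2) / bf (y j ^ 2)) =
      nodeFac ε (y k) / nodeFac ε (y j) := by
    have := hy.ne_zero j
    have := hy.ne_zero k
    rw [nodeFac, nodeFac, div_zpow, zpow_neg, zpow_neg]
    simp only [div_eq_mul_inv, mul_inv, inv_inv]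
    ring
  have hg : ∏ i, P.g (y k) (omit1 y k i) =
      ∏ i : Fin P.n, (P.specV (y k) - P.specV (y (k.succAbove i)))⁻¹ :=
    Finset.prod_congr rfl fun i _ => hP.g_eq (hy.ne_zero k) (hy.ne_zero (k.succAbove i))
  rw [L, hfac, hg, mul_assoc, ← e]
  -- The diagonal term of the operator multiplies the value at `y_k` of the polynomial that omits
  -- `y_j`. It is zero for `k ≠ j`, and for `k = j` it cancels the Lagrange denominator; this
  -- explains the `δ_{jk}` in the matrix.
  by_cases h : j = k
  · subst h
    have h1 : (∏ i : Fin P.n, (P.specV (y j) - P.specV (y (j.succAbove i)))⁻¹) *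
        (P.nodePoly (omit1 y j)).eval (P.specV (y j)) = 1 := by
      rw [eval_nodePoly, ← Finset.prod_mul_distrib]
      exact Finset.prod_eq_one fun i _ =>
        inv_mul_cancel₀ (hP.specV_sub_ne hy (j.succAbove_ne i).symm)
    rw [if_pos rfl, div_self (nodeFac_ne hy ε j)]
    rw [← coefDiag]
    linear_combination -P.coefDiag (y j) * h1
  · have h1 : (P.nodePoly (omit1 y j)).eval (P.specV (y k)) = 0 := by
      obtain ⟨i, hi⟩ := Fin.exists_succAbove_eq (Ne.symm h)
      rw [eval_nodePoly]
      exact Finset.prod_eq_zero (Finset.mem_univ i) (by rw [omit1, hi, sub_self])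
    rw [if_neg h, h1]
    ring

/-- The functional is determined by its values on the `n + 1` polynomials that omit one node each.
Hence the scalar products at the omitted families carry all its information. -/
lemma pairing_lagrange (hP : P.Admissible) (hy : P.Generic y) (ε : Eps) (M : ℕ) {r : ℂ[X]}
    (hr : r.natDegree ≤ P.n) :
    P.pairing ε M r = ∑ k, r.eval (P.specV (y k)) *
      ((∏ i : Fin P.n, (P.specV (y k) - P.specV (y (k.succAbove i)))⁻¹) *
        P.pairing ε M (P.nodePoly (omit1 y k))) := by
  simp only [pairing, Finset.mul_sum]
  rw [Finset.sum_comm]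
  refine Finset.sum_congr rfl fun N _ => ?_
  rw [eval_eq_sum_lagrange hr (hP.specV_injective hy), Finset.mul_sum, Finset.mul_sum]
  refine Finset.sum_congr rfl fun k _ => ?_
  rw [eval_nodePoly]
  simp only [omit1]
  ring

/-- The explicit solution of the linear system. -/
def solVec (P : Params) (ε : Eps) (y : Fin (P.n + 1) → ℂ) (M : ℕ) (k : Fin (P.n + 1)) : ℂ :=
  P.scalCoef ε M * ((∏ i, nodeFac ε (omit1 y k i)) * P.pairing ε M (P.nodePoly (omit1 y k)))

/-- The sum over `k` is the interpolation formula for the image of the polynomial omitting `y_j`.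
Its pairing is `θ_M` times that of the polynomial itself; the factors `nodeFac` only conjugate the
matrix. -/
lemma sum_L_solVec (hP : P.Admissible) (hy : P.Generic y) (ε : Eps) {M : ℕ} (hM : M ≤ P.n)
    (j : Fin (P.n + 1)) :
    ∑ k, P.L ε y j k * solVec P ε y M k = P.θ dot M * solVec P ε y M j := by
  obtain ⟨r, hr, h1, h2⟩ := hP.exists_image ε (P.nodePoly (omit1 y j))
    (natDegree_nodePoly _ _).le
  have hB : ∀ k, ∏ i, nodeFac ε (omit1 y k i) = (∏ i, nodeFac ε (y i)) / nodeFac ε (y k) :=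
    fun k => by
      rw [Fin.prod_univ_succAbove _ k, mul_div_cancel_left₀ _ (nodeFac_ne hy ε k)]
      rfl
  simp only [solVec, hP.L_eq hy ε j _ h1, hB]
  rw [mul_left_comm, mul_left_comm (P.θ dot M), ← h2 M hM, hP.pairing_lagrange hy ε M hr,
    Finset.mul_sum, Finset.mul_sum]
  refine Finset.sum_congr rfl fun k _ => ?_
  have := nodeFac_ne hy ε k
  field_simp

lemma solVec_ne (hP : P.Admissible) (hy : P.Generic y) (ε : Eps) {M : ℕ} (hM : M ≤ P.n) :
    solVec P ε y M ≠ 0 := by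
  obtain ⟨r, hr, h⟩ := hP.exists_pairing_ne ε M
  intro h0
  refine h ?_
  rw [hP.pairing_lagrange hy ε M hr]
  refine Finset.sum_eq_zero fun k _ => ?_
  have := congrFun h0 k
  rw [solVec, Pi.zero_apply] at this
  rw [(mul_eq_zero.1 ((mul_eq_zero.1 this).resolve_left (hP.scalCoef_ne ε hM))).resolve_left
    (Finset.prod_ne_zero_iff.2 fun i _ => nodeFac_ne hy ε _)]
  ring

lemma sum_bsMatrix_solVec (hP : P.Admissible) (hy : P.Generic y) (ε : Eps) {M : ℕ}
    (hM : M ≤ P.n) (j : Fin (P.n + 1)) :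
    ∑ k, P.bsMatrix ε M y j k * solVec P ε y M k = 0 := by
  simp only [bsMatrix, Matrix.of_apply, sub_mul, Finset.sum_sub_distrib, hP.sum_L_solVec hy ε hM]
  simp

lemma rank_bsMatrix (hP : P.Admissible) (hy : P.Generic y) (ε : Eps) (M : Fin (P.n + 1)) :
    (P.bsMatrix ε M y).rank = P.n := by
  have e : P.bsMatrix ε M y = Matrix.of (P.L ε y) -
      P.θ dot M • (1 : Matrix (Fin (P.n + 1)) (Fin (P.n + 1)) ℂ) := by
    ext j k
    simp [bsMatrix, Matrix.one_apply]
  rw [e]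
  refine rank_sub_eigenvalue _ (fun K => solVec P ε y K) (θ := fun K => P.θ dot K)
    (fun K K' h => Fin.ext (hP.θ_injective dot (by omega) (by omega) h))
    (fun K => hP.solVec_ne hy ε (by omega)) (fun K => ?_) M
  ext j
  exact hP.sum_L_solVec hy ε (by omega) j

end Generic

end Admissible

end Params

end

end BelliardSlavnov

/-! ### Identities for the diagonal entries of `A^*` and `A^⋄` -/

namespace BelliardSlavnov

noncomputable section

/-- The quadratic form of the Askey–Wilson relations in two eigenvalues factors, and its zeros are
the two neighbours on the grid. This is the source of tridiagonality. -/
lemma tau_factor {q z s t : ℂ} (hq : q ≠ 0) (hz : z ≠ 0) (ht : t ≠ 0) :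
    tau z s ^ 2 - (q ^ 2 + (q ^ 2)⁻¹) * tau z s * tau z t + tau z t ^ 2 +
        (q ^ 2 - (q ^ 2)⁻¹) ^ 2 =
      (tau z s - tau z (q ^ 2 * t)) * (tau z s - tau z (t / q ^ 2)) := by
  generalize tau z s = c
  rw [tau, tau, tau]
  field_simp
  ring

/-- The diagonal entries of the tridiagonal matrix of `A^*`, from the first Askey–Wilson
relation. -/
lemma AWCoef.diag_star {q x y z t w u₀ d₀ : ℂ}
    (h : AWCoef (q ^ 2) (x ^ 2) (-(x * y * z * q * t ^ 2)) (t ^ 2)⁻¹ w u₀ d₀) (hq : q ≠ 0)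
    (hx : x ≠ 0) (hy : y ≠ 0) (hz : z ≠ 0) (ht : t ≠ 0) (hw : w ≠ 0) :
    (1 + y ^ 2 - u₀ * (1 + x * y * q / z * w) - d₀ * (x ^ 2 * w + x * y * q / z)) / y *
        ((q + q⁻¹) ^ 2 - tau x w ^ 2) =
      -(((x * t + (x * t)⁻¹) * (y * t + (y * t)⁻¹) -
          (q * t + (q * t)⁻¹) * (z * t + (z * t)⁻¹)) * tau x w +
        (q + q⁻¹) * ((x * t + (x * t)⁻¹) * (z * t + (z * t)⁻¹) -
          (q * t + (q * t)⁻¹) * (y * t + (y * t)⁻¹))) := by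
  rw [tau]
  rcases h with ⟨h1, h2, h3, rfl, rfl⟩ | ⟨rfl, h1, rfl, rfl⟩ | ⟨h0, h1, rfl, rfl⟩ |
    ⟨rfl, h1, rfl, rfl⟩
  · generalize he1 : 1 - x ^ 2 * w ^ 2 = e₁ at *
    generalize he2 : 1 - x ^ 2 * q ^ 2 * w ^ 2 = e₂ at *
    generalize he3 : x ^ 2 * w ^ 2 - q ^ 2 = e₃ at *
    field_simp
    subst he1 he2 he3
    ring
  · generalize he1 : 1 - x ^ 2 * q ^ 2 = e₁ at *
    field_simp
    subst he1
    ring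
  · obtain rfl : t ^ 2 = w := inv_injective h0
    generalize he3 : x ^ 2 * (t ^ 2) ^ 2 - q ^ 2 = e₃ at *
    field_simp
    subst he3
    ring
  · have h1 : t ^ 2 = 1 := inv_eq_one.1 h1
    rcases mul_self_eq_one_iff.1 ((sq t).symm.trans h1) with rfl | rfl
    · field_simp
      ring
    · field_simp
      ring

/-- The diagonal entries of the tridiagonal matrix of `A^⋄`. -/
lemma AWCoef.diag_dia {q x y z t w u₀ d₀ : ℂ}
    (h : AWCoef (q ^ 2) (x ^ 2) (-(x * y * z * q * t ^ 2)) (t ^ 2)⁻¹ w u₀ d₀) (hq : q ≠ 0)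
    (hx : x ≠ 0) (hy : y ≠ 0) (hz : z ≠ 0) (ht : t ≠ 0) (hw : w ≠ 0) :
    (q ^ 2 - 1) * ((1 + y ^ 2 - u₀ * (1 + x * y * q / z * w) -
        d₀ * (x ^ 2 * w + x * y * q / z)) / y * tau x w -
        ((x * t + (x * t)⁻¹) * (y * t + (y * t)⁻¹) -
          (q * t + (q * t)⁻¹) * (z * t + (z * t)⁻¹))) =
      (q ^ 2 - 1) * (q + q⁻¹) * (1 + z ^ 2 - u₀ * (1 + x * z * q / y * w) -
        d₀ * (x ^ 2 * w + x * z * q / y)) / z := by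
  rw [tau]
  rcases h with ⟨h1, h2, h3, rfl, rfl⟩ | ⟨rfl, h1, rfl, rfl⟩ | ⟨h0, h1, rfl, rfl⟩ |
    ⟨rfl, h1, rfl, rfl⟩
  · generalize he1 : 1 - x ^ 2 * w ^ 2 = e₁ at *
    generalize he2 : 1 - x ^ 2 * q ^ 2 * w ^ 2 = e₂ at *
    generalize he3 : x ^ 2 * w ^ 2 - q ^ 2 = e₃ at *
    field_simp
    subst he1 he2 he3
    ring
  · generalize he1 : 1 - x ^ 2 * q ^ 2 = e₁ at *
    field_simp
    subst he1
    ring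
  · obtain rfl : t ^ 2 = w := inv_injective h0
    generalize he3 : x ^ 2 * (t ^ 2) ^ 2 - q ^ 2 = e₃ at *
    field_simp
    subst he3
    ring
  · have h1 : t ^ 2 = 1 := inv_eq_one.1 h1
    rcases mul_self_eq_one_iff.1 ((sq t).symm.trans h1) with rfl | rfl
    · field_simp
      ring
    · field_simp
      ring

end

end BelliardSlavnov

/-! ### Matrix entries of `A^*` and of the q-commutator -/

namespace BelliardSlavnov

noncomputable section

namespace Params

open Label

/-- The superdiagonal of the matrix of `A^*` in the eigenbasis of `A`. -/
def upS (P : Params) (M : ℕ) : ℂ :=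
  awU (P.q ^ 2) (P.x dot ^ 2) P.dB P.n M * (1 - P.dS * (P.q ^ 2) ^ M) / (P.r₀ * P.x star)

/-- The subdiagonal of the matrix of `A^*` in the eigenbasis of `A`. -/
def dnS (P : Params) (M : ℕ) : ℂ :=
  awD (P.q ^ 2) (P.x dot ^ 2) P.dB P.n M * (P.x dot ^ 2 * (P.q ^ 2) ^ M - P.dS) /
    (P.r₀ * P.x star)

/-- The coefficient of `|θ*_0⟩` in the expansion of `A |θ*_0⟩`. -/
def lead (P : Params) : ℂ :=
  (1 + P.x dot ^ 2 - (1 - P.dS) * (1 - P.dB) * (1 - ((P.q ^ 2) ^ P.n)⁻¹) /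
    (1 - P.x star ^ 2 * P.q ^ 2)) / (P.r₀ * P.x dot)

/-- The operator `r₀ A^⋄`, as a polynomial in `A` and `A^*`. -/
def opZ (P : Params) {V : Type*} [AddCommGroup V] [Module ℂ V] (A As : Module.End ℂ V) :
    Module.End ℂ V :=
  -(bf (P.q ^ 2) / P.ρ) • (qComm P.q As A + ((P.q + P.q⁻¹) * P.ω / bf (P.q ^ 2)) • 1)

namespace Admissible

variable {P : Params}

lemma dB_eq (P : Params) :
    P.dB = -(P.x dot * P.x star * P.x dia * P.q * (P.q ^ P.n) ^ 2) := by
  rw [dB, pow_succ, pow_mul']; ring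

lemma Q_pow_n (P : Params) : (P.q ^ 2) ^ P.n = (P.q ^ P.n) ^ 2 := by
  rw [← pow_mul, ← pow_mul, mul_comm]

lemma bf_sq_ne (hP : P.Admissible) : bf (P.q ^ 2) ≠ 0 := by
  have h := hP.q_ne
  have h1 := hP.q_sq_sub_one_ne
  have h2 := hP.q_sq_add_one_ne
  rw [bf, show P.q ^ 2 - (P.q ^ 2)⁻¹ = (P.q ^ 2 - 1) * (P.q ^ 2 + 1) / P.q ^ 2 by
    field_simp; ring]
  exact div_ne_zero (mul_ne_zero h1 h2) (pow_ne_zero _ h)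

lemma bf_div_ρ (hP : P.Admissible) : -(bf (P.q ^ 2) / P.ρ) = P.r₀ ^ 2 / bf (P.q ^ 2) := by
  have h := hP.bf_sq_ne
  have h' := hP.r₀_ne
  rw [ρ, ← bf]
  field_simp

/-- In the eigenbasis of `A`, the entry `(M, N)` of `[A^*, A]_q` is that of `A^*` times `q θ_N - q⁻¹
θ_M`. For neighbours this difference is a monomial in `q^(2M)`, so `A^⋄` has the same shape as
`A^*`. -/
lemma upS_mul (hP : P.Admissible) (M : ℕ) :
    -(bf (P.q ^ 2) / P.ρ) * (P.upS M * (P.q * P.θ dot (M + 1) - P.q⁻¹ * P.θ dot M)) =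
      P.upZ M := by
  have h1 := hP.r₀_ne
  have h2 := hP.x_ne dot
  have h4 := hP.x_ne star
  have h5 := hP.q_ne
  have h3 := pow_ne_zero M hP.Q_ne
  have hb := hP.bf_sq_ne
  have e : P.q * P.θ dot (M + 1) - P.q⁻¹ * P.θ dot M =
      P.x dot * P.q * (P.q ^ 2) ^ M * bf (P.q ^ 2) / P.r₀ := by
    rw [hP.θ_eq_tau, hP.θ_eq_tau, tau, tau, bf, pow_succ (P.q ^ 2) M]
    field_simp
    ring
  rw [hP.bf_div_ρ, e, upS, upZ]
  generalize bf (P.q ^ 2) = b at *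
  field_simp

lemma dnS_mul (hP : P.Admissible) (M : ℕ) :
    -(bf (P.q ^ 2) / P.ρ) * (P.dnS M * (P.q * P.θ dot (M - 1) - P.q⁻¹ * P.θ dot M)) =
      P.dnZ M := by
  rcases M with _ | M
  · rw [dnS, dnZ, awD_zero]; ring
  have h1 := hP.r₀_ne
  have h2 := hP.x_ne dot
  have h4 := hP.x_ne star
  have h5 := hP.q_ne
  have h3 := pow_ne_zero M hP.Q_ne
  have hb := hP.bf_sq_ne
  have e : P.q * P.θ dot M - P.q⁻¹ * P.θ dot (M + 1) =
      P.q * bf (P.q ^ 2) / (P.x dot * (P.q ^ 2) ^ (M + 1) * P.r₀) := by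
    rw [hP.θ_eq_tau, hP.θ_eq_tau, tau, tau, bf, pow_succ (P.q ^ 2) M]
    field_simp
    ring
  rw [hP.bf_div_ρ, Nat.add_sub_cancel, e, dnS, dnZ]
  have h6 := pow_ne_zero (M + 1) hP.Q_ne
  generalize bf (P.q ^ 2) = b at *
  field_simp

lemma node' (hP : P.Admissible) {M : ℕ} (hM : M ≤ P.n) :
    AWCoef (P.q ^ 2) (P.x dot ^ 2)
      (-(P.x dot * P.x star * P.x dia * P.q * (P.q ^ P.n) ^ 2)) ((P.q ^ P.n) ^ 2)⁻¹
      ((P.q ^ 2) ^ M) (awU (P.q ^ 2) (P.x dot ^ 2) P.dB P.n M)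
      (awD (P.q ^ 2) (P.x dot ^ 2) P.dB P.n M) := by
  rw [← dB_eq, ← Q_pow_n]
  exact hP.node dot P.dB hM

/-- The diagonal entries of the matrix of `A^*`. -/
lemma diagS (hP : P.Admissible) {M : ℕ} (hM : M ≤ P.n) :
    (P.θ star 0 - P.upS M - P.dnS M) * (-(P.q - P.q⁻¹) ^ 2 * P.θ dot M ^ 2 - P.ρ) =
      P.ω * P.θ dot M + P.η := by
  have h1 := hP.r₀_ne
  have h2 := hP.x_ne star
  have h3 := hP.x_ne dia
  have h4 := hP.x_ne dot
  have h5 := hP.q_ne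
  have h := (hP.node' hM).diag_star h5 h4 h2 h3 (pow_ne_zero P.n h5) (pow_ne_zero M hP.Q_ne)
  have e1 : P.θ star 0 - P.upS M - P.dnS M = (1 + P.x star ^ 2 -
      awU (P.q ^ 2) (P.x dot ^ 2) P.dB P.n M * (1 + P.x dot * P.x star * P.q / P.x dia *
        (P.q ^ 2) ^ M) - awD (P.q ^ 2) (P.x dot ^ 2) P.dB P.n M *
        (P.x dot ^ 2 * (P.q ^ 2) ^ M + P.x dot * P.x star * P.q / P.x dia)) / P.x star /
        P.r₀ := by
    rw [hP.θ_eq_tau, tau, upS, dnS, dS, pow_zero]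
    field_simp
    ring
  have e2 : -(P.q - P.q⁻¹) ^ 2 * P.θ dot M ^ 2 - P.ρ = (P.q ^ 2 - 1) ^ 2 / (P.q ^ 2 * P.r₀ ^ 2) *
      ((P.q + P.q⁻¹) ^ 2 - tau (P.x dot) ((P.q ^ 2) ^ M) ^ 2) := by
    rw [hP.θ_eq_tau, ρ]
    field_simp
    ring
  rw [e1, e2, ω, η, hP.ωabc_eq, hP.ωabc_eq, hP.θ_eq_tau]
  linear_combination (P.q ^ 2 - 1) ^ 2 / (P.q ^ 2 * P.r₀ ^ 3) * h

lemma diagS_mul (hP : P.Admissible) {M : ℕ} (hM : M ≤ P.n) :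
    -(bf (P.q ^ 2) / P.ρ) * ((P.θ star 0 - P.upS M - P.dnS M) *
      (P.q * P.θ dot M - P.q⁻¹ * P.θ dot M) + (P.q + P.q⁻¹) * P.ω / bf (P.q ^ 2)) =
      P.dgZ M := by
  have h1 := hP.r₀_ne
  have h2 := hP.x_ne star
  have h3 := hP.x_ne dia
  have h4 := hP.x_ne dot
  have h5 := hP.q_ne
  have h6 := hP.q_sq_sub_one_ne
  have h7 := hP.q_sq_add_one_ne
  have h := (hP.node' hM).diag_dia h5 h4 h2 h3 (pow_ne_zero P.n h5) (pow_ne_zero M hP.Q_ne)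
  rw [mul_assoc (P.q ^ 2 - 1), mul_div_assoc (P.q ^ 2 - 1)] at h
  replace h := mul_left_cancel₀ h6 h
  have e1 : P.θ star 0 - P.upS M - P.dnS M = (1 + P.x star ^ 2 -
      awU (P.q ^ 2) (P.x dot ^ 2) P.dB P.n M * (1 + P.x dot * P.x star * P.q / P.x dia *
        (P.q ^ 2) ^ M) - awD (P.q ^ 2) (P.x dot ^ 2) P.dB P.n M *
        (P.x dot ^ 2 * (P.q ^ 2) ^ M + P.x dot * P.x star * P.q / P.x dia)) / P.x star /
        P.r₀ := by
    rw [hP.θ_eq_tau, tau, upS, dnS, dS, pow_zero]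
    field_simp
    ring
  have hb : bf (P.q ^ 2) = (P.q ^ 2 - 1) * (P.q ^ 2 + 1) / P.q ^ 2 := by
    rw [bf]; field_simp; ring
  have e3 : P.dgZ M = (1 + P.x dia ^ 2 - awU (P.q ^ 2) (P.x dot ^ 2) P.dB P.n M *
      (1 + P.x dot * P.x dia * P.q / P.x star * (P.q ^ 2) ^ M) -
      awD (P.q ^ 2) (P.x dot ^ 2) P.dB P.n M * (P.x dot ^ 2 * (P.q ^ 2) ^ M +
        P.x dot * P.x dia * P.q / P.x star)) / P.x dia := by
    rw [dgZ, dA]; ring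
  rw [hP.bf_div_ρ, e1, e3, ω, hP.ωabc_eq, hP.θ_eq_tau, hb]
  clear e1 e3 hb
  generalize (1 + P.x dia ^ 2 - awU (P.q ^ 2) (P.x dot ^ 2) P.dB P.n M *
      (1 + P.x dot * P.x dia * P.q / P.x star * (P.q ^ 2) ^ M) -
      awD (P.q ^ 2) (P.x dot ^ 2) P.dB P.n M * (P.x dot ^ 2 * (P.q ^ 2) ^ M +
        P.x dot * P.x dia * P.q / P.x star)) = T at *
  generalize (1 + P.x star ^ 2 -
      awU (P.q ^ 2) (P.x dot ^ 2) P.dB P.n M * (1 + P.x dot * P.x star * P.q / P.x dia *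
        (P.q ^ 2) ^ M) - awD (P.q ^ 2) (P.x dot ^ 2) P.dB P.n M *
        (P.x dot ^ 2 * (P.q ^ 2) ^ M + P.x dot * P.x star * P.q / P.x dia)) / P.x star = S at *
  generalize (P.x dot * P.q ^ P.n + (P.x dot * P.q ^ P.n)⁻¹) *
    (P.x star * P.q ^ P.n + (P.x star * P.q ^ P.n)⁻¹) - (P.q * P.q ^ P.n + (P.q * P.q ^ P.n)⁻¹) *
    (P.x dia * P.q ^ P.n + (P.x dia * P.q ^ P.n)⁻¹) = W at *
  generalize tau (P.x dot) ((P.q ^ 2) ^ M) = c at *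
  have hq : P.q + P.q⁻¹ = (P.q ^ 2 + 1) / P.q := by field_simp
  rw [hq] at h ⊢
  generalize hf : P.q ^ 2 - 1 = f at *
  generalize hg : P.q ^ 2 + 1 = g at *
  have hc : S * c - W = g / P.q * (T / P.x dia) := by linear_combination h
  have : T / P.x dia = P.q / g * (S * c - W) := by rw [hc]; field_simp
  rw [this]
  field_simp
  subst hf
  ring

/-- `A |θ*_0⟩` lies in the span of the first two eigenvectors of `A^*`, expressed by matrix
entries. -/
lemma lead_eq (hP : P.Admissible) (hn : 0 < P.n) {M : ℕ} (hM : M ≤ P.n) :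
    P.upS M * (P.θ dot (M + 1) - P.θ dot M) + P.dnS M * (P.θ dot (M - 1) - P.θ dot M) =
      (P.θ star 1 - P.θ star 0) * (P.θ dot M - P.lead) := by
  have h1 := hP.r₀_ne
  have h2 := hP.x_ne star
  have h3 := hP.x_ne dia
  have h4 := hP.x_ne dot
  have h5 := hP.q_ne
  have h6 := pow_ne_zero M hP.Q_ne
  have hy := hP.spec' star 1 le_rfl (by omega)
  rw [pow_one] at hy
  replace hy := sub_ne_zero.2 hy.symm
  -- With `dS` as free parameter the operator is that of `A^*`, and `θ_M` is affine in the first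
  -- product `qPair`. Its bidiagonal action at `k = 0` gives the eigenvector for `θ*_1` and the
  -- constant `lead`.
  have h := (hP.node dot P.dB hM).apply_qPair hP.Q_ne (pow_ne_zero _ h4) h6 P.dS 0
  simp only [qPair_succ, qPair_zero, pow_zero, mul_one, zero_add, pow_one] at h
  have ed : P.dS * P.dB * ((P.q ^ 2) ^ P.n)⁻¹ / (P.x dot ^ 2 * P.q ^ 2) * P.q ^ 2 =
      P.x star ^ 2 * P.q ^ 2 := by
    have := pow_ne_zero P.n h5
    rw [Q_pow_n, dB_eq, dS]
    field_simp
  rw [ed] at h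
  have key : ∀ s, s ≠ 0 → (1 - s⁻¹) * (1 - P.x dot ^ 2 * s) =
      1 + P.x dot ^ 2 - P.x dot * tau (P.x dot) s := fun s hs => by
    rw [tau]; field_simp; ring
  rw [key _ h6, key _ (mul_ne_zero hP.Q_ne h6), key _ (div_ne_zero h6 hP.Q_ne)] at h
  have d : awD (P.q ^ 2) (P.x dot ^ 2) P.dB P.n M * tau (P.x dot) ((P.q ^ 2) ^ M / P.q ^ 2) =
      awD (P.q ^ 2) (P.x dot ^ 2) P.dB P.n M * tau (P.x dot) ((P.q ^ 2) ^ (M - 1)) := by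
    rcases M with _ | M
    · rw [awD_zero]; ring
    · rw [pow_succ (P.q ^ 2) M, mul_div_cancel_right₀ _ hP.Q_ne]; rfl
  rw [← pow_succ'] at h
  have es : P.θ star 1 - P.θ star 0 =
      -(((P.q ^ 2)⁻¹ - 1) * (P.x star ^ 2 * P.q ^ 2 - 1)) / (P.r₀ * P.x star) := by
    rw [hP.θ_eq_tau, hP.θ_eq_tau, tau, tau, pow_zero, pow_one]
    field_simp
    ring
  rw [es, lead, upS, dnS, hP.θ_eq_tau, hP.θ_eq_tau, hP.θ_eq_tau]
  generalize (1 - P.dS) * (1 - P.dB) * (1 - ((P.q ^ 2) ^ P.n)⁻¹) = K at *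
  have ek : K = (1 - P.x star ^ 2 * P.q ^ 2) * (K / (1 - P.x star ^ 2 * P.q ^ 2)) := by
    field_simp
  generalize K / (1 - P.x star ^ 2 * P.q ^ 2) = K' at *
  rw [ek] at h
  have e0 : ∀ a b c d e f g : ℂ, a * b / (P.r₀ * P.x star) * (c / P.r₀ - d / P.r₀) +
      e * f / (P.r₀ * P.x star) * (g / P.r₀ - d / P.r₀) =
      -(P.r₀ ^ 2 * P.x star * P.x dot)⁻¹ * (a * b * (P.x dot * d - P.x dot * c) +
        e * f * (P.x dot * d - P.x dot * g)) := fun a b c d e f g => by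
    field_simp; ring
  rw [e0]
  have e1 : (P.r₀ ^ 2 * P.x star * P.x dot)⁻¹ * (P.x dot * P.r₀ * P.x star * P.r₀) = 1 := by
    field_simp
  rw [show tau (P.x dot) ((P.q ^ 2) ^ M) / P.r₀ - (1 + P.x dot ^ 2 - K') / (P.r₀ * P.x dot) =
    (P.x dot * tau (P.x dot) ((P.q ^ 2) ^ M) - (1 + P.x dot ^ 2 - K')) / (P.r₀ * P.x dot) by
      field_simp]
  have e2 : ∀ a b : ℂ, -a / (P.r₀ * P.x star) * (b / (P.r₀ * P.x dot)) =
      -(P.r₀ ^ 2 * P.x star * P.x dot)⁻¹ * (a * b) := fun a b => by field_simp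
  rw [e2]
  congr 1
  linear_combination h + (P.x dot ^ 2 * (P.q ^ 2) ^ M - P.dS) * P.x dot * d

end Admissible

end Params

end

end BelliardSlavnov

/-! ### Abstract Leonard pairs: the matrix of `A^*` from the relations -/

namespace BelliardSlavnov

noncomputable section

section Rep

open Module

variable {V : Type*} [AddCommGroup V] [Module ℂ V]

lemma exists_eigenbasis {n : ℕ} (hd : finrank ℂ V = n + 1) (T : End ℂ V) {θ : Fin (n + 1) → ℂ}
    (hθ : Function.Injective θ) {v : Fin (n + 1) → V} (hv : ∀ k, T.HasEigenvector (θ k) (v k)) :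
    ∃ b : Basis (Fin (n + 1)) ℂ V, ⇑b = v := by
  have hli := End.eigenvectors_linearIndependent' T θ hθ v hv
  exact ⟨basisOfLinearIndependentOfCardEqFinrank hli (by rw [hd, Fintype.card_fin]), by simp⟩

lemma repr_apply_eigenbasis {ι : Type*} {T : End ℂ V} {b : Basis ι ℂ V} {θ : ι → ℂ}
    (hb : ∀ k, T (b k) = θ k • b k) (x : V) (k : ι) : b.repr (T x) k = θ k * b.repr x k := by
  have : b.coord k ∘ₗ T = θ k • b.coord k := b.ext fun j => by
    simp only [LinearMap.comp_apply, hb, map_smul, LinearMap.smul_apply, smul_eq_mul,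
      Basis.coord_apply, Basis.repr_self]
    rcases eq_or_ne j k with rfl | h
    · rfl
    · rw [Finsupp.single_eq_of_ne h.symm]; ring
  exact LinearMap.congr_fun this x

lemma repr_apply_eq_sum {ι : Type*} [Fintype ι] (S : End ℂ V) (b : Basis ι ℂ V) (x : V) (k : ι) :
    b.repr (S x) k = ∑ j, b.repr (S (b j)) k * b.repr x j := by
  conv_lhs => rw [← b.sum_repr x]
  simp only [map_sum, map_smul, Finsupp.coe_finsetSum, Finset.sum_apply, Finsupp.smul_apply,
    smul_eq_mul]
  exact Finset.sum_congr rfl fun j _ => mul_comm _ _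

/-- An Askey–Wilson relation, in coordinates with respect to an eigenbasis. -/
lemma askey_wilson_repr {ι : Type*} {T S : End ℂ V} {q ρ ω η : ℂ} (hq : q ≠ 0)
    (h : qComm q⁻¹ T (qComm q T S) = ρ • S + ω • T + η • 1) {b : Basis ι ℂ V} {θ : ι → ℂ}
    (hb : ∀ k, T (b k) = θ k • b k) {x : V} {μ : ℂ} (hx : T x = μ • x) (k : ι) :
    (θ k ^ 2 - (q ^ 2 + (q ^ 2)⁻¹) * θ k * μ + μ ^ 2 - ρ) * b.repr (S x) k =
      (ω * μ + η) * b.repr x k := by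
  have e := congrArg (fun f => b.repr (f x) k) h
  simp only [qComm, LinearMap.sub_apply, LinearMap.add_apply, LinearMap.smul_apply, End.mul_apply,
    End.one_apply, mul_sub, sub_mul, smul_sub, hx, map_smul, map_sub, map_add,
    Finsupp.sub_apply, Finsupp.add_apply, Finsupp.smul_apply, smul_eq_mul,
    repr_apply_eigenbasis hb, Algebra.mul_smul_comm, Algebra.smul_mul_assoc] at e
  field_simp at e ⊢
  linear_combination e

end Rep

/-- A sum with three adjacent terms. -/
lemma exists_tridiag {n : ℕ} (a : Fin (n + 1) → ℂ) (M : Fin (n + 1))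
    (h : ∀ N : Fin (n + 1), (N : ℕ) + 2 ≤ M ∨ (M : ℕ) + 2 ≤ N → a N = 0) :
    ∃ u d : ℂ, ((M : ℕ) = n → u = 0) ∧ ((M : ℕ) = 0 → d = 0) ∧ ∀ f : ℕ → ℂ,
      ∑ N, a N * f N = u * f (M + 1) + d * f (M - 1) + a M * f M := by
  -- Written as indicator sums, the outer coefficients vanish automatically in the first and last
  -- row, so the out-of-range values of `f` do no harm.
  refine ⟨∑ N : Fin (n + 1), if (N : ℕ) = M + 1 then a N else 0,
    ∑ N : Fin (n + 1), if (N : ℕ) + 1 = M then a N else 0, fun hM => ?_, fun hM => ?_,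
    fun f => ?_⟩
  · exact Finset.sum_eq_zero fun N _ => if_neg (by omega)
  · exact Finset.sum_eq_zero fun N _ => if_neg (by omega)
  · have e : a M * f M = ∑ N : Fin (n + 1), (if M = N then a N else 0) * f M := by
      rw [← Finset.sum_mul, Finset.sum_ite_eq, if_pos (Finset.mem_univ _)]
    rw [e, Finset.sum_mul, Finset.sum_mul, ← Finset.sum_add_distrib, ← Finset.sum_add_distrib]
    refine Finset.sum_congr rfl fun N _ => ?_
    rcases lt_trichotomy (N : ℕ) M with h1 | h1 | h1
    · rw [if_neg (by omega), if_neg (c := M = N) (fun e => by rw [e] at h1; omega)]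
      by_cases h2 : (N : ℕ) + 1 = M
      · rw [if_pos h2, ← h2, Nat.add_sub_cancel]; ring
      · rw [if_neg h2, h N (by omega)]; ring
    · have : M = N := Fin.ext h1.symm
      subst this
      rw [if_neg (by omega), if_neg (by omega), if_pos rfl]; ring
    · rw [if_neg (c := (N : ℕ) + 1 = M) (by omega),
        if_neg (c := M = N) (fun e => by rw [e] at h1; omega)]
      by_cases h2 : (N : ℕ) = M + 1
      · rw [if_pos h2, h2]; ring
      · rw [if_neg h2, h N (by omega)]; ring

namespace Params

open Label Module

namespace Admissible

variable {P : Params}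

/-- For `|M - N| ≥ 2` neither neighbour of `N` coincides with `M`; the reflected coincidences have
exponents `M + N ± 1`, which stay between `1` and `2n - 1` and are excluded by `spec`. -/
lemma aw_factor_ne (hP : P.Admissible) (a : Label) {M N : ℕ} (hM : M ≤ P.n) (hN : N ≤ P.n)
    (h : N + 2 ≤ M ∨ M + 2 ≤ N) :
    P.θ a M ^ 2 - (P.q ^ 2 + (P.q ^ 2)⁻¹) * P.θ a M * P.θ a N + P.θ a N ^ 2 - P.ρ ≠ 0 := by
  have h1 := hP.r₀_ne
  have hQ := hP.Q_ne
  have h2 := pow_ne_zero M hQ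
  have h3 := pow_ne_zero N hQ
  have hx := hP.x_ne a
  have e : P.θ a M ^ 2 - (P.q ^ 2 + (P.q ^ 2)⁻¹) * P.θ a M * P.θ a N + P.θ a N ^ 2 - P.ρ =
      (tau (P.x a) ((P.q ^ 2) ^ M) - tau (P.x a) (P.q ^ 2 * (P.q ^ 2) ^ N)) *
        (tau (P.x a) ((P.q ^ 2) ^ M) - tau (P.x a) ((P.q ^ 2) ^ N / P.q ^ 2)) / P.r₀ ^ 2 := by
    rw [← tau_factor hP.q_ne hx h3, hP.θ_eq_tau, hP.θ_eq_tau, ρ]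
    generalize tau (P.x a) ((P.q ^ 2) ^ M) = c
    generalize tau (P.x a) ((P.q ^ 2) ^ N) = d
    ring
  rw [e]
  refine div_ne_zero (mul_ne_zero (sub_ne_zero.2 fun h0 => ?_) (sub_ne_zero.2 fun h0 => ?_))
    (pow_ne_zero _ h1)
  · rcases tau_eq_tau hx h2 (mul_ne_zero hQ h3) h0 with h4 | h4
    · rw [← pow_succ'] at h4
      have := hP.Q_pow_injective h4
      omega
    · rw [← pow_succ', ← pow_add] at h4
      exact hP.spec' a _ (by omega) (by omega) h4
  · rcases tau_eq_tau hx h2 (div_ne_zero h3 hQ) h0 with h4 | h4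
    · rw [eq_div_iff hQ, ← pow_succ] at h4
      have := hP.Q_pow_injective h4
      omega
    · rw [← mul_div_assoc, ← pow_add, show M + N = M + N - 1 + 1 by omega,
        pow_succ (P.q ^ 2) (M + N - 1), mul_div_cancel_right₀ _ hQ] at h4
      exact hP.spec' a _ (by omega) (by omega) h4

/-- The factor vanishes only if `x² Q^(2M-1)` or `x² Q^(2M+1)` equals `1`. By `spec` this can happen
at most in the first row through the first condition and in the last row through the second. -/
lemma diag_factor_ne (hP : P.Admissible) (M : ℕ) (h₁ : P.x dot ^ 2 * (P.q ^ 2) ^ (2 * M) ≠ P.q ^ 2)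
    (h₂ : P.x dot ^ 2 * (P.q ^ 2) ^ (2 * M + 1) ≠ 1) :
    -(P.q - P.q⁻¹) ^ 2 * P.θ dot M ^ 2 - P.ρ ≠ 0 := by
  have h3 := hP.r₀_ne
  have hq := hP.q_ne
  have hx := hP.x_ne dot
  have h5 := pow_ne_zero M hP.Q_ne
  have h6 := hP.q_sq_sub_one_ne
  rw [two_mul, pow_add] at h₁
  rw [pow_succ (P.q ^ 2) (2 * M), two_mul, pow_add] at h₂
  have e2 : -(P.q - P.q⁻¹) ^ 2 * P.θ dot M ^ 2 - P.ρ =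
      -((P.q ^ 2 - 1) ^ 2 * (P.x dot ^ 2 * ((P.q ^ 2) ^ M * (P.q ^ 2) ^ M) - P.q ^ 2) *
        (P.x dot ^ 2 * ((P.q ^ 2) ^ M * (P.q ^ 2) ^ M * P.q ^ 2) - 1)) /
      (P.q ^ 4 * P.r₀ ^ 2 * P.x dot ^ 2 * ((P.q ^ 2) ^ M) ^ 2) := by
    rw [hP.θ_eq_tau, ρ, tau]
    generalize (P.q ^ 2) ^ M = s at *
    field_simp
    ring
  rw [e2]
  exact div_ne_zero (neg_ne_zero.2 (mul_ne_zero (mul_ne_zero (pow_ne_zero _ h6)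
    (sub_ne_zero.2 h₁)) (sub_ne_zero.2 h₂))) (mul_ne_zero (mul_ne_zero (mul_ne_zero
    (pow_ne_zero _ hq) (pow_ne_zero _ h3)) (pow_ne_zero _ hx)) (pow_ne_zero _ h5))

section Rep

variable {V : Type*} [AddCommGroup V] [Module ℂ V] {A As : Module.End ℂ V}
  {v : Fin (P.n + 1) → V} {w₀ : V}

/-- `A |θ*_0⟩` is, modulo `|θ*_0⟩`, an eigenvector of `A^*` for `θ*_1`. -/
lemma exists_lead (hP : P.Admissible) (hn : 0 < P.n) (hL : P.IsLeonardPair A As)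
    (hw : As.HasEigenvector (P.θ star 0) w₀) :
    ∃ c : ℂ, As (A w₀ - c • w₀) = P.θ star 1 • (A w₀ - c • w₀) := by
  have hinj : Function.Injective fun k : Fin (P.n + 1) => P.θ star k := fun K K' h =>
    Fin.ext (hP.θ_injective star (by omega) (by omega) h)
  have hex : ∀ k : Fin (P.n + 1), ∃ w, As.HasEigenvector (P.θ star k) w := fun k =>
    (hL.spec_star k (by omega)).exists_hasEigenvector
  choose w hw' using hex
  obtain ⟨b, hb⟩ := exists_eigenbasis hL.dim As hinj hw'
  have hb' : ∀ k, As (b k) = P.θ star k • b k := fun k => by rw [hb]; exact (hw' k).apply_eq_smul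
  have r0 : ∀ k : Fin (P.n + 1), k ≠ 0 → b.repr w₀ k = 0 := fun k hk => by
    have := repr_apply_eigenbasis hb' w₀ k
    rw [hw.apply_eq_smul, map_smul, Finsupp.smul_apply, smul_eq_mul] at this
    refine (mul_eq_zero.1 (?_ : (P.θ star (0 : Fin (P.n + 1)) - P.θ star k) * _ = 0)).resolve_left
      (sub_ne_zero.2 fun e => hk (hinj e).symm)
    rw [Fin.val_zero]
    linear_combination this
  have r0' : b.repr w₀ 0 ≠ 0 := fun h0 => hw.2 (b.ext_elem fun k => by
    rcases eq_or_ne k 0 with rfl | hk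
    · rw [h0]; simp
    · rw [r0 k hk]; simp)
  -- This constant removes the component along `θ*_0`. Components with `k ≥ 2` vanish by the second
  -- Askey–Wilson relation, so only `θ*_1` is left.
  refine ⟨b.repr (A w₀) 0 / b.repr w₀ 0, b.ext_elem fun k => ?_⟩
  rw [repr_apply_eigenbasis hb', map_smul, Finsupp.smul_apply, smul_eq_mul, map_sub, map_smul,
    Finsupp.sub_apply, Finsupp.smul_apply, smul_eq_mul]
  rcases lt_trichotomy (k : ℕ) 1 with hk | hk | hk
  · obtain rfl : k = 0 := Fin.ext (by rw [Fin.val_zero]; omega)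
    rw [div_mul_cancel₀ _ r0', sub_self, mul_zero, mul_zero]
  · rw [hk]
  · have := askey_wilson_repr hP.q_ne hL.aw₂ hb' hw.apply_eq_smul k
    have hk0 : k ≠ 0 := fun e => by rw [e, Fin.val_zero] at hk; omega
    rw [r0 k hk0, mul_zero] at this ⊢
    rw [(mul_eq_zero.1 this).resolve_left (hP.aw_factor_ne star (by omega) (by omega)
      (by omega))]
    ring

/-- The matrix of `A^*` in the eigenbasis of `A` is tridiagonal with known entries. -/
lemma sum_matrix_star (hP : P.Admissible) (hL : P.IsLeonardPair A As)
    (hv : P.IsEigenData A As v w₀) {b : Basis (Fin (P.n + 1)) ℂ V} (hb : ⇑b = v)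
    (M : Fin (P.n + 1)) (f : ℕ → ℂ) :
    ∑ N, b.repr (As (b N)) M * f N = P.upS M * f (M + 1) + P.dnS M * f (M - 1) +
      (P.θ star 0 - P.upS M - P.dnS M) * f M := by
  have hb' : ∀ k, A (b k) = P.θ dot k • b k := fun k => by rw [hb]; exact (hv.eig k).apply_eq_smul
  have aw : ∀ M N, _ := fun M N => askey_wilson_repr hP.q_ne hL.aw₁ hb' (hb' N) M
  have hw1 : ∀ K, b.repr w₀ K = 1 := fun K => by
    rw [hv.norm, ← hb, map_sum, Finsupp.coe_finsetSum, Finset.sum_apply]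
    simp [Finsupp.single_apply]
  have hM : ∀ M : Fin (P.n + 1), (M : ℕ) ≤ P.n := fun M => by omega
  have row : ∀ M : Fin (P.n + 1), ∃ u d : ℂ, ((M : ℕ) = P.n → u = 0) ∧ ((M : ℕ) = 0 → d = 0) ∧
      ∀ f : ℕ → ℂ, ∑ N, b.repr (As (b N)) M * f N =
        u * f (M + 1) + d * f (M - 1) + b.repr (As (b M)) M * f M := fun M =>
    exists_tridiag _ M fun N hN => by
      have := aw M N
      rw [b.repr_self, Finsupp.single_eq_of_ne (fun e => by rw [e] at hN; omega), mul_zero] at this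
      exact (mul_eq_zero.1 this).resolve_left (hP.aw_factor_ne dot (hM M) (hM N) hN)
  have diag : ∀ M : Fin (P.n + 1), b.repr (As (b M)) M *
      (-(P.q - P.q⁻¹) ^ 2 * P.θ dot M ^ 2 - P.ρ) = P.ω * P.θ dot M + P.η := fun M => by
    have := aw M M
    rw [b.repr_self, Finsupp.single_eq_same, mul_one] at this
    rw [← this]
    have hq := hP.q_ne
    field_simp
    ring
  -- By the normalization `w₀` has all coordinates `1`, so its eigenvalue equation prescribes the
  -- row sums of `A^*`.
  have rsum : ∀ M : Fin (P.n + 1), ∑ N, b.repr (As (b N)) M * 1 = P.θ star 0 := fun M => by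
    have := repr_apply_eq_sum As b w₀ M
    rw [hv.eig_star.apply_eq_smul, map_smul, Finsupp.smul_apply, hw1, smul_eq_mul, mul_one] at this
    rw [this]
    simp only [hw1]
  obtain ⟨u, d, hu, hd, hud⟩ := row M
  have s1 := (hud fun _ => 1).symm.trans (rsum M)
  rw [hud]
  suffices h : u = P.upS M ∧ d = P.dnS M by
    rw [← h.1, ← h.2]
    linear_combination f M * s1
  have uz : P.upS P.n = 0 := by rw [upS, awU_top]; ring
  have dz : P.dnS 0 = 0 := by rw [dnS, awD_zero]; ring
  rcases Nat.eq_zero_or_pos P.n with hn | hn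
  · have h0 : (M : ℕ) = 0 := by omega
    have h1 : (M : ℕ) = P.n := by omega
    rw [hu h1, hd h0]
    exact ⟨by rw [h1, uz], by rw [h0, dz]⟩
  have hstar : P.θ star 1 - P.θ star 0 ≠ 0 :=
    sub_ne_zero.2 fun e => absurd (hP.θ_injective star (by omega) (by omega) e) (by omega)
  obtain ⟨c, hc⟩ := hP.exists_lead hn hL hv.eig_star
  have rlead : ∀ M : Fin (P.n + 1), ∑ N : Fin (P.n + 1), b.repr (As (b N)) M * (P.θ dot N - c) =
      P.θ star 1 * (P.θ dot M - c) := fun M => by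
    have hr : ∀ K, b.repr (A w₀ - c • w₀) K = P.θ dot K - c := fun K => by
      rw [map_sub, map_smul, Finsupp.sub_apply, Finsupp.smul_apply, repr_apply_eigenbasis hb', hw1,
        smul_eq_mul, mul_one, mul_one]
    have := congrArg (fun x => b.repr x M) hc
    simp only [map_smul, Finsupp.smul_apply, smul_eq_mul] at this
    rw [repr_apply_eq_sum, hr] at this
    simpa only [hr] using this
  -- The constant `c` is still unknown. In an end row two entries remain; the diagonal relation and
  -- the row sum fix them, and the equation for the second eigenvector then determines `c`.
  have c_eq : c = P.lead := by
    have aux : ∀ M : Fin (P.n + 1), ((M : ℕ) = 0 ∨ (M : ℕ) = P.n) →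
        -(P.q - P.q⁻¹) ^ 2 * P.θ dot M ^ 2 - P.ρ ≠ 0 → c = P.lead := by
      intro M hM' hK
      obtain ⟨u, d, hu, hd, hud⟩ := row M
      have s1 := (hud fun _ => 1).symm.trans (rsum M)
      have s2 := (hud fun N => P.θ dot N - c).symm.trans (rlead M)
      have e := mul_right_cancel₀ hK ((diag M).trans (hP.diagS (hM M)).symm)
      have s3 := hP.lead_eq hn (hM M)
      refine (sub_eq_zero.1 ((mul_eq_zero.1 (?_ : (P.θ star 1 - P.θ star 0) * _ = 0)).resolve_left
        hstar))
      rcases hM' with h0 | h0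
      · have d0 := hd h0
        rw [h0] at s2 s3 e
        rw [d0] at s1 s2
        rw [dz] at s3 e
        simp only [zero_mul, add_zero, sub_zero, zero_add, mul_one] at s1 s2 s3 e
        rw [e] at s1 s2
        linear_combination s2 - s3 - (P.θ dot 1 - c) * s1
      · have u0 := hu h0
        rw [h0] at s2 s3 e
        rw [u0] at s1 s2
        rw [uz] at s3 e
        simp only [zero_mul, sub_zero, zero_add, mul_one] at s1 s2 s3 e
        rw [e] at s1 s2
        linear_combination s2 - s3 - (P.θ dot (P.n - 1) - c) * s1
    -- The diagonal relation cannot degenerate in both end rows: if it does in the first, then `x² =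
    -- Q`, and in the last row the excluded values would make `q` a root of unity.
    by_cases hx : P.x dot ^ 2 = P.q ^ 2
    · refine aux (Fin.last P.n) (Or.inr (Fin.val_last _)) (hP.diag_factor_ne _ ?_ ?_)
      · rw [hx, Fin.val_last, ← pow_succ']
        intro h
        have := hP.Q_pow_injective (a₁ := 2 * P.n + 1) (a₂ := 1) (h.trans (pow_one _).symm)
        omega
      · rw [hx, Fin.val_last, ← pow_succ']
        exact hP.Q_pow_ne _
    · refine aux 0 (Or.inl (Fin.val_zero _)) (hP.diag_factor_ne _ ?_ ?_)
      · rw [Fin.val_zero, mul_zero, pow_zero, mul_one]; exact hx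
      · rw [Fin.val_zero, mul_zero, zero_add]; exact hP.spec' dot 1 le_rfl (by omega)
  have s2 := (hud fun N => P.θ dot N - c).symm.trans (rlead M)
  have s3 := hP.lead_eq hn (hM M)
  rw [c_eq] at s2
  -- With `c` known, an end row has two unknown entries and two equations, so the possibly
  -- degenerate diagonal relation is not used there.
  rcases Nat.eq_zero_or_pos (M : ℕ) with h0 | hpos
  · have d0 := hd h0
    have hne : P.θ dot 1 - P.θ dot 0 ≠ 0 :=
      sub_ne_zero.2 fun e => absurd (hP.θ_injective dot (by omega) (by omega) e) (by omega)
    rw [h0] at s2 s3 ⊢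
    rw [d0] at s1 s2 ⊢
    rw [dz] at s3 ⊢
    refine ⟨mul_right_cancel₀ hne ?_, rfl⟩
    simp only [zero_mul, add_zero, zero_add, mul_one] at s1 s2 s3
    linear_combination s2 - s3 - (P.θ dot 0 - P.lead) * s1
  rcases (hM M).eq_or_lt with h0 | hlt
  · have u0 := hu h0
    have hne : P.θ dot (P.n - 1) - P.θ dot P.n ≠ 0 :=
      sub_ne_zero.2 fun e => absurd (hP.θ_injective dot (by omega) le_rfl e) (by omega)
    rw [h0] at s2 s3 ⊢
    rw [u0] at s1 s2 ⊢
    rw [uz] at s3 ⊢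
    refine ⟨rfl, mul_right_cancel₀ hne ?_⟩
    simp only [zero_mul, zero_add, mul_one] at s1 s2 s3
    linear_combination s2 - s3 - (P.θ dot P.n - P.lead) * s1
  -- In an interior row there are three unknown entries, but both exponents `2M ± 1` lie in the
  -- range of `spec`, so the diagonal relation determines the diagonal entry.
  have hK : -(P.q - P.q⁻¹) ^ 2 * P.θ dot M ^ 2 - P.ρ ≠ 0 := by
    refine hP.diag_factor_ne _ (fun h => hP.spec' dot (2 * M - 1) (by omega) (by omega) ?_)
      (hP.spec' dot _ (by omega) (by omega))
    rw [show 2 * (M : ℕ) = 2 * M - 1 + 1 by omega, pow_succ (P.q ^ 2) (2 * M - 1), ← mul_assoc] at h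
    exact (mul_eq_right₀ hP.Q_ne).1 h
  have e := mul_right_cancel₀ hK ((diag M).trans (hP.diagS (hM M)).symm)
  have hne : P.θ dot (M + 1) - P.θ dot (M - 1) ≠ 0 :=
    sub_ne_zero.2 fun e => absurd (hP.θ_injective dot (by omega) (by omega) e) (by omega)
  rw [e] at s1 s2
  have hU : u = P.upS M := by
    refine mul_right_cancel₀ hne ?_
    linear_combination s2 - s3 - (P.θ dot (M - 1) - P.lead) * s1
  exact ⟨hU, by linear_combination s1 - hU⟩

end Rep

end Admissible

end Params

end

end BelliardSlavnov

/-! ### Bethe states and their scalar products -/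

namespace BelliardSlavnov

noncomputable section

namespace Params

open Label Module Polynomial

/-- The scalar factor of the dynamical operators with `β = 0`. -/
def dynCoef (P : Params) (α χ : ℂ) : Eps → ℂ → ℤ → ℂ
  | .plus, u, m => bf (u ^ 2) * u⁻¹ * (χ / (α * bf (P.q ^ 2))) * P.q ^ (-m - 2)
  | .minus, u, m => bf (u ^ 2) * u * (χ / (α * bf (P.q ^ 2))) * P.q ^ (m + 2)

namespace Admissible

variable {P : Params}

section Rep

variable {V : Type*} [AddCommGroup V] [Module ℂ V] {A As : Module.End ℂ V}
  {v : Fin (P.n + 1) → V} {w₀ : V}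

/-- With `β = 0` the dynamical operators are, up to a scalar factor, affine functions of
`A^⋄`. -/
lemma dynB_eq (hP : P.Admissible) {α χ : ℂ} (hα : α ≠ 0) (hχ : χ ≠ 0) (ε : Eps) {u : ℂ}
    (hu : u ≠ 0) (m : ℤ) :
    P.dynB A As α 0 χ ε u m =
      P.dynCoef α χ ε u m • (P.specV u • (1 : Module.End ℂ V) - P.opZ A As) := by
  have hq := hP.q_ne
  have hb := hP.bf_sq_ne
  have hρ := hP.ρ_ne
  have ht := zpow_ne_zero m hq
  have e1 : P.q ^ (2 * m) = (P.q ^ m) ^ 2 := by rw [mul_comm, zpow_mul, zpow_ofNat]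
  cases ε with
  | plus =>
    have e2 : P.q ^ (2 * m + 2) = (P.q ^ m) ^ 2 * P.q ^ 2 := by
      rw [zpow_add₀ hq, e1, zpow_ofNat]
    have e3 : P.q ^ (-m - 3) = (P.q ^ m)⁻¹ * (P.q ^ 3)⁻¹ := by
      rw [zpow_sub₀ hq, zpow_neg, zpow_ofNat]; rfl
    have e4 : P.q ^ (-m - 2) = (P.q ^ m)⁻¹ * (P.q ^ 2)⁻¹ := by
      rw [zpow_sub₀ hq, zpow_neg, zpow_ofNat]; rfl
    simp only [dynB, dynCoef, opZ, e1, e2, e3, e4, specV, tau]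
    generalize P.q ^ m = t at *
    generalize bf (P.q ^ 2) = b at *
    simp only [zero_mul, ne_eq, OfNat.ofNat_ne_zero, not_false_eq_true, zero_pow,
      zero_div, zero_smul, sub_zero, add_zero]
    match_scalars
    · field_simp
    · field_simp
      ring
  | minus =>
    have e2 : P.q ^ (2 * m + 1) = (P.q ^ m) ^ 2 * P.q := by rw [zpow_add₀ hq, e1, zpow_one]
    have e3 : P.q ^ (-m - 1) = (P.q ^ m)⁻¹ * P.q⁻¹ := by
      rw [zpow_sub₀ hq, zpow_neg, zpow_one]; rfl
    have e4 : P.q ^ (-m - 4) = (P.q ^ m)⁻¹ * (P.q ^ 4)⁻¹ := by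
      rw [zpow_sub₀ hq, zpow_neg, zpow_ofNat]; rfl
    have e5 : P.q ^ (m + 2) = P.q ^ m * P.q ^ 2 := by rw [zpow_add₀ hq, zpow_ofNat]
    have e6 : P.q ^ (-2 : ℤ) = (P.q ^ 2)⁻¹ := by rw [zpow_neg, zpow_ofNat]
    simp only [dynB, dynCoef, opZ, e1, e2, e3, e4, e5, e6, specV, tau]
    generalize P.q ^ m = t at *
    generalize bf (P.q ^ 2) = b at *
    simp only [zero_mul, ne_eq, OfNat.ofNat_ne_zero, not_false_eq_true, zero_pow,
      zero_div, zero_smul, sub_zero, add_zero, zero_sub]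
    match_scalars
    · field_simp
    · field_simp
      ring

/-- `r₀ A^⋄` acts on the vectors with given dual coordinates by multiplication with its
eigenvalues. -/
lemma opZ_vec (hP : P.Admissible) (hL : P.IsLeonardPair A As) (hv : P.IsEigenData A As v w₀)
    (h : ℕ → ℂ) :
    P.opZ A As (∑ M : Fin (P.n + 1), P.vecOf h M • v M) =
      ∑ M : Fin (P.n + 1), P.vecOf (fun N => P.tauM N * h N) M • v M := by
  obtain ⟨b, hb⟩ := exists_eigenbasis hL.dim A (fun K K' h => Fin.ext
    (hP.θ_injective dot (by omega) (by omega) h)) hv.eig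
  have hb' : ∀ k, A (b k) = P.θ dot k • b k := fun k => by rw [hb]; exact (hv.eig k).apply_eq_smul
  have hr : ∀ (f : ℕ → ℂ) (K : Fin (P.n + 1)), b.repr (∑ M : Fin (P.n + 1), f M • v M) K = f K :=
    fun f K => by
      rw [← hb, b.repr_sum_self fun M : Fin (P.n + 1) => f (M : ℕ)]
  refine b.ext_elem fun M => ?_
  have hM : (M : ℕ) ≤ P.n := by omega
  rw [hr (P.vecOf fun N => P.tauM N * h N), ← hP.apply_vecOf hM, ← hP.upS_mul, ← hP.dnS_mul,
    ← hP.diagS_mul hM, opZ]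
  have s1 := hP.sum_matrix_star hL hv hb M (P.vecOf h)
  have s2 := hP.sum_matrix_star hL hv hb M fun N => P.θ dot N * P.vecOf h N
  have r1 : b.repr (As (∑ M : Fin (P.n + 1), P.vecOf h M • v M)) M =
      ∑ N, b.repr (As (b N)) M * P.vecOf h N := by
    rw [repr_apply_eq_sum]
    simp only [hr]
  have r2 : b.repr (As (A (∑ M : Fin (P.n + 1), P.vecOf h M • v M))) M =
      ∑ N : Fin (P.n + 1), b.repr (As (b N)) M * (P.θ dot N * P.vecOf h N) := by
    rw [repr_apply_eq_sum]
    simp only [repr_apply_eigenbasis hb', hr]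
  rw [s1] at r1
  rw [s2] at r2
  simp only [qComm, LinearMap.smul_apply, LinearMap.add_apply, LinearMap.sub_apply,
    Module.End.mul_apply, Module.End.one_apply, map_smul, map_add, map_sub, Finsupp.smul_apply,
    Finsupp.add_apply, Finsupp.sub_apply, smul_eq_mul, r2, repr_apply_eigenbasis hb', r1, hr]
  ring

/-- Each operator of the string is affine in `A^⋄`, which is diagonal in dual coordinates; hence the
string multiplies these coordinates by the values of a product of linear factors. -/
lemma prod_ofFn_apply (hP : P.Admissible) (hL : P.IsLeonardPair A As)
    (hv : P.IsEigenData A As v w₀) {m : ℕ} (c u : Fin m → ℂ) (h : ℕ → ℂ) :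
    (List.ofFn fun i => c i • (P.specV (u i) • (1 : Module.End ℂ V) - P.opZ A As)).prod
        (∑ M : Fin (P.n + 1), P.vecOf h M • v M) =
      (∏ i, c i) • ∑ M : Fin (P.n + 1),
        P.vecOf (fun N => (∏ i, (P.specV (u i) - P.tauM N)) * h N) M • v M := by
  induction m with
  | zero => simp
  | succ m ih =>
    rw [List.ofFn_succ, List.prod_cons, Module.End.mul_apply, ih, map_smul, LinearMap.smul_apply,
      LinearMap.sub_apply, LinearMap.smul_apply, Module.End.one_apply, hP.opZ_vec hL hv,
      Finset.smul_sum, ← Finset.sum_sub_distrib, smul_smul, Fin.prod_univ_succ,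
      mul_comm (c 0)]
    congr 1
    refine Finset.sum_congr rfl fun M _ => ?_
    rw [smul_smul, ← sub_smul]
    congr 1
    simp only [vecOf, Fin.prod_univ_succ]
    rw [mul_left_comm, ← mul_sub, Finset.mul_sum, ← Finset.sum_sub_distrib]
    congr 1
    exact Finset.sum_congr rfl fun N _ => by ring

/-- The reference states in terms of dual coordinates. -/
lemma reference_state (hP : P.Admissible) (hv : P.IsEigenData A As v w₀) (ε : Eps) :
    (match ε with | .minus => v 0 | .plus => w₀) =
      P.refCoef ε • ∑ M : Fin (P.n + 1), P.vecOf (P.hFac ε) M • v M := by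
  cases ε with
  | minus =>
    have e : ∀ M : Fin (P.n + 1), P.vecOf (P.hFac .minus) M = if M = 0 then 1 else 0 := fun M => by
      simp only [vecOf, hFac, mul_one]
      -- All dual coordinates equal to `1` give the row sums of the transition matrix, which single
      -- out `M = 0`.
      rw [hP.sum_Pinv (by omega)]
      by_cases hM : M = 0
      · subst hM; simp [fRel]
      · rw [if_neg hM, if_neg (by rwa [Fin.val_eq_zero_iff]), mul_zero]
    simp only [refCoef, e, one_smul, ite_smul, zero_smul, Finset.sum_ite_eq', Finset.mem_univ,
      if_true]
  | plus =>
    simp only [refCoef]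
    rw [hv.norm, Finset.smul_sum]
    refine Finset.sum_congr rfl fun M _ => ?_
    have := hP.fgh_mul_vecOf_hRel (M := M) (by omega)
    rw [smul_smul, show P.hFac .plus = fun N => (P.hRel N)⁻¹ from rfl, this, one_smul]

/-- The gauge condition turns `χ / (α b(q²))`, together with the power of `q` at `m₀`, into `-b` or
`c*`. The shifts of `m` along the string contribute total exponent `±n(n+1)`, that is `q^(±(n+1))`
per operator as in `𝒢^ε`. -/
lemma prod_dynCoef (hP : P.Admissible) {α χ : ℂ} {m₀ : ℤ} {ε : Eps} (hχ : χ ≠ 0)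
    (hg : P.Gauge α χ m₀ ε) (u : Fin P.n → ℂ) :
    ∏ i : Fin P.n, P.dynCoef α χ ε (u i) (m₀ + 2 * ((P.n : ℤ) - 1 - (i : ℕ))) =
      (P.gCoef ε * (P.q + P.q⁻¹)⁻¹) ^ P.n * ∏ i, nodeFac ε (u i) := by
  have hq := hP.q_ne
  have hs := hP.q_add_inv_ne
  have hb := hP.bf_sq_ne
  have hm := zpow_ne_zero m₀ hq
  have hQ : ∏ i : Fin P.n, (P.q ^ 2) ^ (P.n - 1 - (i : ℕ) + 1) = (P.q ^ (P.n + 1)) ^ P.n := by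
    rw [Fin.prod_univ_eq_prod_range (fun i => (P.q ^ 2) ^ (P.n - 1 - i + 1)),
      Finset.prod_range_reflect (fun i => (P.q ^ 2) ^ (i + 1)), prod_pow_succ_sq, ← pow_mul,
      mul_comm]
  have hc : ∀ i : Fin P.n, ((P.n - 1 - (i : ℕ) + 1 : ℕ) : ℤ) = (P.n : ℤ) - 1 - (i : ℕ) + 1 :=
    fun i => by omega
  cases ε with
  | minus =>
    have hα : α ≠ 0 := by
      rintro rfl
      simp [Gauge] at hg
    have hk : χ / (α * bf (P.q ^ 2)) * P.q ^ m₀ = -P.b dot := by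
      rw [Gauge, ← bf, zpow_neg] at hg
      field_simp at hg ⊢
      linear_combination hg
    have e : ∀ i : Fin P.n, P.dynCoef α χ .minus (u i) (m₀ + 2 * ((P.n : ℤ) - 1 - (i : ℕ))) =
        nodeFac .minus (u i) * -P.b dot * (P.q ^ 2) ^ (P.n - 1 - (i : ℕ) + 1) := fun i => by
      rw [dynCoef, nodeFac, ← hk, ← pow_mul, ← zpow_natCast P.q (2 * _),
        show m₀ + 2 * ((P.n : ℤ) - 1 - (i : ℕ)) + 2 =
          m₀ + ((2 * (P.n - 1 - (i : ℕ) + 1) : ℕ) : ℤ) by rw [Nat.cast_mul, hc]; push_cast; ring,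
        zpow_add₀ hq, Eps.val, neg_neg, zpow_one]
      ring
    rw [Finset.prod_congr rfl fun i _ => e i, Finset.prod_mul_distrib, Finset.prod_mul_distrib, hQ,
      Finset.prod_const, Finset.card_univ, Fintype.card_fin, mul_assoc, ← mul_pow,
      mul_comm (∏ i, nodeFac _ _)]
    congr 2
    simp only [gCoef, Eps.val, Eps.isMinus, Eps.isPlus, neg_neg, one_mul, pow_zero, pow_one]
    rw [show (P.n : ℤ) + 1 = ((P.n + 1 : ℕ) : ℤ) by push_cast; ring, zpow_natCast]
    push_cast
    generalize P.q + P.q⁻¹ = s at *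
    field_simp
  | plus =>
    have hα : α ≠ 0 := by
      rintro rfl
      simp [Gauge] at hg
    have hk : χ / (α * bf (P.q ^ 2)) * (P.q ^ m₀)⁻¹ = P.c star := by
      rw [Gauge, ← bf] at hg
      field_simp at hg ⊢
      linear_combination -hg
    have e : ∀ i : Fin P.n, P.dynCoef α χ .plus (u i) (m₀ + 2 * ((P.n : ℤ) - 1 - (i : ℕ))) =
        nodeFac .plus (u i) * P.c star * ((P.q ^ 2) ^ (P.n - 1 - (i : ℕ) + 1))⁻¹ := fun i => by
      rw [dynCoef, nodeFac, ← hk, ← pow_mul, ← zpow_natCast P.q (2 * _), ← zpow_neg P.q m₀,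
        ← zpow_neg P.q (_ : ℤ), show -(m₀ + 2 * ((P.n : ℤ) - 1 - (i : ℕ))) - 2 =
          -m₀ + -((2 * (P.n - 1 - (i : ℕ) + 1) : ℕ) : ℤ) by
            rw [Nat.cast_mul, hc]; push_cast; ring,
        zpow_add₀ hq, Eps.val, zpow_neg_one]
      ring
    rw [Finset.prod_congr rfl fun i _ => e i, Finset.prod_mul_distrib, Finset.prod_mul_distrib,
      Finset.prod_inv_distrib, hQ,
      Finset.prod_const, Finset.card_univ, Fintype.card_fin, mul_assoc, ← inv_pow, ← mul_pow,
      mul_comm (∏ i, nodeFac _ _)]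
    congr 2
    simp only [gCoef, Eps.val, Eps.isMinus, Eps.isPlus, pow_zero, pow_one]
    rw [show -1 * ((P.n : ℤ) + 1) = -((P.n + 1 : ℕ) : ℤ) by push_cast; ring, zpow_neg,
      zpow_natCast]
    push_cast
    generalize P.q + P.q⁻¹ = s at *
    have := pow_ne_zero (P.n + 1) hq
    field_simp

/-- The scalar products of the Bethe states with the eigenbasis of `A`. -/
lemma scalar_product (hP : P.Admissible) (hL : P.IsLeonardPair A As)
    (hv : P.IsEigenData A As v w₀) {φ : Fin (P.n + 1) → Module.Dual ℂ V}
    {ξ : Fin (P.n + 1) → ℂ} (hξ : ∀ K, ξ K ≠ 0)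
    (hφ : ∀ K K', φ K (v K') = if K = K' then ξ K else 0) {α χ : ℂ} {m₀ : ℤ} {ε : Eps}
    (hχ : χ ≠ 0) (hg : P.Gauge α χ m₀ ε) {u : Fin P.n → ℂ} (hu : ∀ i, u i ≠ 0)
    (M : Fin (P.n + 1)) :
    φ M (P.bethe A As v w₀ α χ m₀ ε u) / φ M (v M) =
      P.scalCoef ε M * ((∏ i, nodeFac ε (u i)) * P.pairing ε M (P.nodePoly u)) := by
  have hα : α ≠ 0 := by
    rintro rfl
    cases ε <;> simp [Gauge] at hg
  have hvec : ∀ f : ℕ → ℂ, φ M (∑ K : Fin (P.n + 1), f K • v K) = f M * ξ M := fun f => by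
    rw [map_sum]
    simp [hφ]
  -- The operators produce factors `specV u_i - tauM N`, the polynomial has the opposite sign; the
  -- resulting `(-1)^n` is absorbed in `scalCoef`.
  have e : (-1) ^ P.n * P.pairing ε M (P.nodePoly u) = ∑ N ∈ Finset.range (P.n + 1),
      P.Pinv dia dot star M N * ((∏ i, (P.specV (u i) - P.tauM N)) * P.hFac ε N) := by
    rw [pairing, Finset.mul_sum]
    refine Finset.sum_congr rfl fun N _ => ?_
    have c : (-1 : ℂ) ^ P.n = ∏ _i : Fin P.n, (-1 : ℂ) := by simp
    rw [eval_nodePoly, mul_left_comm, mul_left_comm _ (P.hFac ε N), c, ← Finset.prod_mul_distrib,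
      mul_comm (P.hFac ε N)]
    congr 2
    exact Finset.prod_congr rfl fun i _ => by ring
  have hB : P.bethe A As v w₀ α χ m₀ ε u = P.stringB A As α χ ε m₀ u
      (P.refCoef ε • ∑ K : Fin (P.n + 1), P.vecOf (P.hFac ε) K • v K) := by
    rw [← hP.reference_state hv ε]
    cases ε <;> rfl
  rw [hB, stringB]
  simp only [hP.dynB_eq hα hχ ε (hu _)]
  rw [map_smul, hP.prod_ofFn_apply hL hv, map_smul, map_smul, hvec, hP.prod_dynCoef hχ hg, vecOf,
    ← e, hφ, if_pos rfl, scalCoef, mul_neg, neg_pow (P.gCoef ε * _)]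
  have := hξ M
  simp only [smul_eq_mul]
  field_simp

end Rep

end Admissible

end Params

end

end BelliardSlavnov

theorem mainTheorem4 (P : BelliardSlavnov.Params) (hP : P.Admissible)
    (M : Fin (P.n + 1)) :
    -- the explicit formulas at `M'' = 2s` solve the linear system, whose rank is `2s`
    (∀ y : Fin (P.n + 1) → ℂ, P.Generic y →
      (∀ j, ∑ k, P.bsMatrix .minus M y j k *
        P.scalMinus M (BelliardSlavnov.Params.omit1 y k) = 0) ∧
      (∀ j, ∑ k, P.bsMatrix .plus M y j k *
        P.scalPlus M (BelliardSlavnov.Params.omit1 y k) = 0) ∧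
      (∀ ε, (P.bsMatrix ε M y).rank = P.n) ∧
      (∀ ε, ∃ X : Fin (P.n + 1) → ℂ, X ≠ 0 ∧ ∀ j, ∑ k, P.bsMatrix ε M y j k * X k = 0)) ∧
    -- the explicit formulas are the normalized scalar products of on-shell and off-shell states
    (∀ (V : Type*) [AddCommGroup V] [Module ℂ V] (A As : Module.End ℂ V)
      (v : Fin (P.n + 1) → V) (w₀ : V)
      (φ : Fin (P.n + 1) → Module.Dual ℂ V) (ξ : Fin (P.n + 1) → ℂ),
      P.IsLeonardPair A As → P.IsEigenData A As v w₀ →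
      (∀ K, ξ K ≠ 0) → (∀ K K', φ K (v K') = if K = K' then ξ K else 0) →
      ∀ (α χ : ℂ) (m₀ : ℤ), χ ≠ 0 → ∀ u : Fin P.n → ℂ, (∀ i, u i ≠ 0) →
        (P.Gauge α χ m₀ .minus →
          φ M (P.bethe A As v w₀ α χ m₀ .minus u) / φ M (v M) = P.scalMinus M u) ∧
        (P.Gauge α χ m₀ .plus →
          φ M (P.bethe A As v w₀ α χ m₀ .plus u) / φ M (v M) = P.scalPlus M u)) := by
  refine ⟨fun y hy => ⟨fun j => ?_, fun j => ?_, fun ε => hP.rank_bsMatrix hy ε M,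
    fun ε => ⟨_, hP.solVec_ne hy ε (by omega), hP.sum_bsMatrix_solVec hy ε (by omega)⟩⟩,
    fun V _ _ A As v w₀ φ ξ hL hv hξ hφ α χ m₀ hχ u hu => ⟨fun hg => ?_, fun hg => ?_⟩⟩
  · simp only [hP.scalMinus_eq]
    exact hP.sum_bsMatrix_solVec hy .minus (by omega) j
  · simp only [hP.scalPlus_eq]
    exact hP.sum_bsMatrix_solVec hy .plus (by omega) j
  · exact (hP.scalar_product hL hv hξ hφ hχ hg hu M).trans (hP.scalMinus_eq M u).symm
  · exact (hP.scalar_product hL hv hξ hφ hχ hg hu M).trans (hP.scalPlus_eq M u).symm
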